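/- **Setting.** Let $\Sigma=\{0,1\}$ and let $\Sigma^*=\bigcup_{k\ge 1}\Sigma^k$ be the set of finite nonempty strings. A *promise problem* is a function $\phi$ from $\Sigma^*$ to the nonempty subsets of $\Sigma$ ($\phi(s)$ is the set of valid answers on input $s$); a problem $\phi:\Sigma^*\to\Sigma$ is regarded as the promise problem $s\mapsto\{\phi(s)\}$. Write $\phi_1\propto\phi_2$ if there is a function $\mu:\Sigma^*\to\Sigma^*$, computed by a Turing machine in time polynomial in the length of the input, such that $\phi_1(s)\supseteq\phi_2(\mu(s))$ for all $s\in\Sigma^*$. Put $[\phi]=\{\psi\mid\psi\propto\phi\}$, let $\lnot\phi$ be the promise problem $s\mapsto\{1-b\mid b\in\phi(s)\}$, and write $\lnot[\phi]=[\lnot\phi]$. Let $n\ge 1$. An *instance of level $n$* consists of integers $m_1,\dots,m_n\ge 1$ and a Boolean expression, built with $\land,\lor,\lnot$ from variables for the bits of $n$ blocks of lengths $m_1,\dots,m_n$; it describes a function $f:\Sigma^{m_1}\times\cdots\times\Sigma^{m_n}\to\Sigma$. It is encoded as a string by writing each $m_j$ in unary followed by $0$, and then the expression in Polish notation, with $00$,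 $010$, $011$ for $\lnot,\land,\lor$ and $1\,1^{j}\,0\,1^{i}\,0$ for the variable number $i$ of block number $j$, counted from $0$. For $x\in\Sigma^{m_1}$ let $f_x=f(x,\cdot)$. For a constant $c \in \Sigma$ (a function of no blocks) put $\mathrm{SAT}_0(c)=\overline{\mathrm{SAT}}_0(c)=c$, and recursively $$\mathrm{SAT}_n(f)=1\iff\exists x:\overline{\mathrm{SAT}}_{n-1}(f_x)=1,\qquad \overline{\mathrm{SAT}}_n(f)=1\iff\forall x:\mathrm{SAT}_{n-1}(f_x)=1 .$$ Let $W_f=\{x\in\Sigma^{m_1}\mid\overline{\mathrm{SAT}}_{n-1}(f_x)=1\}$, let $\pi_1x$ be the first bit of $x$, and order $\Sigma^{m_1}$ lexicographically, the first bit being the most significant. The following promise problems have the stated value on the encoding of an instance describing $f$ if the stated promise holds, and the value $\Sigma$ if it does not: - $\mathrm{MaxVAL}_n(f)=\{\pi_1\max W_f\}$, promise $\mathrm{SAT}_n(f)=1$; - $\mathrm{MinVAL}_n(f)=\{\pi_1\min W_f\}$, promise $\mathrm{SAT}_n(f)=1$; - $\mathrm{VAL}_n(f)=\{\pi_1x\mid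 x\in W_f\}$, promise $\mathrm{SAT}_n(f)=1$; - $\mathrm{USAT}_n(f)=\{\mathrm{SAT}_n(f)\}$, promise $|W_f|\le 1$; - $\overline{\mathrm{USAT}}_n(f)=\{\overline{\mathrm{SAT}}_n(f)\}$, promise $|\{x\mid\mathrm{SAT}_{n-1}(f_x)=0\}|\le 1$; - $\mathrm{UVAL}_n(f)=\{\pi_1x\mid x\in W_f\}$, promise $|W_f|=1$. On a string that encodes no instance of level $n$, the problems $\mathrm{SAT}_n$ and $\overline{\mathrm{SAT}}_n$ have the answer $0$ and the six promise problems above have the value $\Sigma$. **Theorem.** For every $n\ge 1$, 1. $\lnot[\mathrm{SAT}_n]=[\overline{\mathrm{SAT}}_n]$; 2. $\lnot[\mathrm{MaxVAL}_n]=[\mathrm{MinVAL}_n]$; 3. $\lnot[\mathrm{VAL}_n]=[\mathrm{VAL}_n]$; 4. $\lnot[\mathrm{USAT}_n]=[\overline{\mathrm{USAT}}_n]$; 5. $\lnot[\mathrm{UVAL}_n]=[\mathrm{UVAL}_n]$; 6. $[\mathrm{SAT}_n]=[\mathrm{MaxVAL}_n]$; 7. $\mathrm{UVAL}_n\propto\mathrm{VAL}_n\propto\mathrm{MaxVAL}_n\propto\mathrm{UVAL}_{n+1}$;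 8. $\mathrm{UVAL}_n\propto\mathrm{USAT}_n\propto\mathrm{SAT}_n$. -/

import Mathlib

namespace PromiseHierarchy

/-! ### Strings, promise problems, strong reduction -/

/-- The finite nonempty strings over the alphabet `{0, 1}`. -/
abbrev Str : Type := {s : List Bool // s ≠ []}

/-- The nonempty subsets of the alphabet `{0, 1}`. -/
abbrev Answers : Type := {A : Set Bool // A.Nonempty}

/-- Negation of a nonempty set of answers, elementwise. -/
def Answers.neg (A : Answers) : Answers := ⟨Bool.not '' A.1, A.2.image _⟩

/-- The answer set which is `A` if the promise `P` holds and `{0, 1}` otherwise. -/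
def Answers.promise (P : Prop) (A : Set Bool) (h : P → A.Nonempty) : Answers :=
  ⟨{b | P → b ∈ A}, by
    by_cases hP : P
    · obtain ⟨b, hb⟩ := h hP
      exact ⟨b, fun _ => hb⟩
    · exact ⟨true, fun h' => absurd h' hP⟩⟩

/-- A non-promise problem. -/
abbrev Problem : Type := Str → Bool

/-- A promise problem. -/
abbrev PromiseProblem : Type := Str → Answers

/-- A non-promise problem, regarded as a promise problem with one valid answer per input. -/
def Problem.toPromise (φ : Problem) : PromiseProblem :=
  fun s => ⟨{φ s}, Set.singleton_nonempty _⟩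

/-- The dual of a promise problem. -/
def PromiseProblem.dual (φ : PromiseProblem) : PromiseProblem := fun s => (φ s).neg

/-- `μ` is computed by a Turing machine in time polynomial in the length of the input. -/
def PolyTime (μ : Str → Str) : Prop :=
  Nonempty (Turing.TM2ComputableInPolyTime (Subtype.val : Str → List Bool)
    (Subtype.val : Str → List Bool) μ)

/-- Strong (Karp, many-one) reduction of promise problems. -/
def StrongReduces (φ₁ φ₂ : PromiseProblem) : Prop :=
  ∃ μ : Str → Str, PolyTime μ ∧ ∀ s : Str, (φ₂ (μ s)).1 ⊆ (φ₁ s).1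

/-- The strong closure of a promise problem. -/
def strongClosure (φ : PromiseProblem) : Set PromiseProblem := {ψ | StrongReduces ψ φ}

/-! ### Boolean functions of several blocks of variables -/

/-- Strings of length `m ≥ 1`. -/
abbrev Word (m : ℕ+) : Type := Fin (m : ℕ) → Bool

/-- The first bit of a string. -/
def firstBit {m : ℕ+} (x : Word m) : Bool := x ⟨0, m.pos⟩

/-- `Inputs [m₁, …, mₙ]` is the product of the sets of strings of lengths `m₁, …, mₙ`. -/
@[reducible] def Inputs : List ℕ+ → Type
  | [] => Unit
  | m :: ms => Word m × Inputs ms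

/-- The function `f_x` obtained from `f` by fixing the value `x` of the first argument. -/
def fixFirst {m : ℕ+} {ms : List ℕ+} (f : Inputs (m :: ms) → Bool) (x : Word m) :
    Inputs ms → Bool := fun y => f (x, y)

mutual

/-- The quantified formula `∃ x, ∀ y⁽¹⁾, ∃ y⁽²⁾, …, f(x, y⁽¹⁾, y⁽²⁾, …) = 1`. -/
def SatHolds : (ms : List ℕ+) → (Inputs ms → Bool) → Prop
  | [], f => f () = true
  | m :: ms, f => ∃ x : Word m, CoSatHolds ms (fixFirst f x)

/-- The quantified formula `∀ x, ∃ y⁽¹⁾, ∀ y⁽²⁾, …, f(x, y⁽¹⁾, y⁽²⁾, …) = 1`. -/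
def CoSatHolds : (ms : List ℕ+) → (Inputs ms → Bool) → Prop
  | [], f => f () = true
  | m :: ms, f => ∀ x : Word m, SatHolds ms (fixFirst f x)

end

/-! ### Boolean expressions and their encoding as strings -/

/-- Variables of a function on `Inputs ms`: the `i`-th bit of one of the blocks. -/
inductive Var : List ℕ+ → Type
  | head {m : ℕ+} {ms : List ℕ+} (i : Fin (m : ℕ)) : Var (m :: ms)
  | tail {m : ℕ+} {ms : List ℕ+} (v : Var ms) : Var (m :: ms)

/-- The value of a variable. -/
def Var.eval : {ms : List ℕ+} → Var ms → Inputs ms → Bool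
  | _ :: _, .head i, (x, _) => x i
  | _ :: _, .tail v, (_, y) => v.eval y

/-- The variable with index `i` in block `j` (both counted from `0`) is written `1ʲ 0 1ⁱ 0`. -/
def Var.encode : {ms : List ℕ+} → Var ms → List Bool
  | _ :: _, .head i => false :: (List.replicate (i : ℕ) true ++ [false])
  | _ :: _, .tail v => true :: v.encode

/-- Boolean expressions. -/
inductive Expr (ms : List ℕ+) : Type
  | var (v : Var ms) : Expr ms
  | neg (e : Expr ms) : Expr ms
  | and (e₁ e₂ : Expr ms) : Expr ms
  | or (e₁ e₂ : Expr ms) : Expr ms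

/-- The value of a Boolean expression. -/
def Expr.eval {ms : List ℕ+} : Expr ms → Inputs ms → Bool
  | .var v, x => v.eval x
  | .neg e, x => !(e.eval x)
  | .and e₁ e₂, x => e₁.eval x && e₂.eval x
  | .or e₁ e₂, x => e₁.eval x || e₂.eval x

/-- Boolean expressions are written in Polish (prefix) notation, with the symbols
`00` for `¬`, `010` for `∧`, `011` for `∨`, and `1` in front of a variable. -/
def Expr.encode {ms : List ℕ+} : Expr ms → List Bool
  | .var v => true :: v.encode
  | .neg e => false :: false :: e.encode
  | .and e₁ e₂ => false :: true :: false :: (e₁.encode ++ e₂.encode)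
  | .or e₁ e₂ => false :: true :: true :: (e₁.encode ++ e₂.encode)

/-- An instance of level `n`: block lengths `m₁, …, mₙ` and a Boolean expression. -/
structure Instance (n : ℕ) where
  /-- the length of the first block -/
  m : ℕ+
  /-- the lengths of the other blocks -/
  ms : List ℕ+
  /-- there are `n` blocks -/
  length_eq : ms.length + 1 = n
  /-- the expression -/
  expr : Expr (m :: ms)

/-- The function described by an instance. -/
def Instance.fn {n : ℕ} (F : Instance n) : Inputs (F.m :: F.ms) → Bool := F.expr.eval

/-- Block lengths are written in unary, each followed by a `0`. -/
def encodeSizes : List ℕ+ → List Bool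
  | [] => []
  | k :: ks => List.replicate (k : ℕ) true ++ false :: encodeSizes ks

/-- An instance is written as its `n` block lengths followed by its expression. -/
def Instance.encode {n : ℕ} (F : Instance n) : List Bool :=
  encodeSizes (F.m :: F.ms) ++ F.expr.encode

theorem unary_inj : ∀ {a b : ℕ} {s t : List Bool},
    List.replicate a true ++ false :: s = List.replicate b true ++ false :: t →
      a = b ∧ s = t
  | 0, 0, _, _, h => ⟨rfl, by simpa using h⟩
  | 0, _ + 1, _, _, h => by simp [List.replicate_succ] at h
  | _ + 1, 0, _, _, h => by simp [List.replicate_succ] at h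
  | a + 1, b + 1, s, t, h => by
    have h' : List.replicate a true ++ false :: s = List.replicate b true ++ false :: t := by
      simpa [List.replicate_succ] using h
    obtain ⟨h1, h2⟩ := unary_inj h'
    exact ⟨by rw [h1], h2⟩

theorem Var.encode_inj : ∀ {ms : List ℕ+} (v w : Var ms) {s t : List Bool},
    v.encode ++ s = w.encode ++ t → v = w ∧ s = t
  | _ :: _, .head i, .head j, s, t, h => by
    have h' : List.replicate (i : ℕ) true ++ false :: s =
        List.replicate (j : ℕ) true ++ false :: t := by
      simpa [Var.encode] using h
    obtain ⟨h1, h2⟩ := unary_inj h'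
    exact ⟨by rw [Fin.ext h1], h2⟩
  | _ :: _, .head _, .tail _, _, _, h => by simp [Var.encode] at h
  | _ :: _, .tail _, .head _, _, _, h => by simp [Var.encode] at h
  | _ :: _, .tail v, .tail w, s, t, h => by
    have h' : v.encode ++ s = w.encode ++ t := by simpa [Var.encode] using h
    obtain ⟨h1, h2⟩ := Var.encode_inj v w h'
    exact ⟨by rw [h1], h2⟩

theorem Expr.encode_inj {ms : List ℕ+} : ∀ (d e : Expr ms) {s t : List Bool},
    d.encode ++ s = e.encode ++ t → d = e ∧ s = t := by
  intro d
  induction d with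
  | var v =>
    intro e s t h
    cases e with
    | var w =>
      obtain ⟨h1, h2⟩ := Var.encode_inj v w (by simpa [Expr.encode] using h)
      exact ⟨by rw [h1], h2⟩
    | _ => simp [Expr.encode] at h
  | neg d ih =>
    intro e s t h
    cases e with
    | neg e =>
      obtain ⟨h1, h2⟩ := ih e (by simpa [Expr.encode] using h)
      exact ⟨by rw [h1], h2⟩
    | _ => simp [Expr.encode] at h
  | and d₁ d₂ ih₁ ih₂ =>
    intro e s t h
    cases e with
    | and e₁ e₂ =>
      obtain ⟨h1, h2⟩ := ih₁ e₁ (by simpa [Expr.encode] using h)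
      obtain ⟨h3, h4⟩ := ih₂ e₂ h2
      exact ⟨by rw [h1, h3], h4⟩
    | _ => simp [Expr.encode] at h
  | or d₁ d₂ ih₁ ih₂ =>
    intro e s t h
    cases e with
    | or e₁ e₂ =>
      obtain ⟨h1, h2⟩ := ih₁ e₁ (by simpa [Expr.encode] using h)
      obtain ⟨h3, h4⟩ := ih₂ e₂ h2
      exact ⟨by rw [h1, h3], h4⟩
    | _ => simp [Expr.encode] at h

theorem encodeSizes_inj : ∀ {ks ls : List ℕ+} {s t : List Bool}, ks.length = ls.length →
    encodeSizes ks ++ s = encodeSizes ls ++ t → ks = ls ∧ s = t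
  | [], [], _, _, _, h => ⟨rfl, by simpa [encodeSizes] using h⟩
  | [], _ :: _, _, _, hl, _ => by simp at hl
  | _ :: _, [], _, _, hl, _ => by simp at hl
  | k :: ks, l :: ls, s, t, hl, h => by
    obtain ⟨h1, h2⟩ := unary_inj (a := k) (b := l) (s := encodeSizes ks ++ s)
      (t := encodeSizes ls ++ t) (by simpa [encodeSizes] using h)
    obtain ⟨h3, h4⟩ := encodeSizes_inj (by simpa using hl) h2
    exact ⟨by rw [PNat.coe_injective h1, h3], h4⟩

/-- A string encodes at most one instance of level `n`. -/
theorem Instance.encode_injective (n : ℕ) :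
    Function.Injective (Instance.encode : Instance n → List Bool) := by
  rintro ⟨m, ms, hl, e⟩ ⟨m', ms', hl', e'⟩ h
  obtain ⟨h1, h2⟩ := encodeSizes_inj (by simp; omega) h
  obtain ⟨rfl, rfl⟩ := List.cons.inj h1
  obtain ⟨rfl, -⟩ := Expr.encode_inj e e' (s := []) (t := []) (by simpa using h2)
  rfl

/-! ### The problems of level `n` -/

/-- The problem with answer `1` on exactly the strings which encode an instance of level `n`
with property `P`. -/
noncomputable def decisionProblem (n : ℕ) (P : Instance n → Prop) : Problem := by
  classical
  exact fun s => decide (∃ F : Instance n, F.encode = s.1 ∧ P F)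

/-- The promise problem whose valid answers on the encoding of an instance `F` of level `n` are
those in `A F`; a string which encodes no instance does not satisfy the promise. -/
def promiseProblem (n : ℕ) (A : Instance n → Answers) : PromiseProblem :=
  fun s => ⟨{b | ∀ F : Instance n, F.encode = s.1 → b ∈ (A F).1}, by
    by_cases h : ∃ F : Instance n, F.encode = s.1
    · obtain ⟨F, hF⟩ := h
      obtain ⟨b, hb⟩ := (A F).2
      exact ⟨b, fun G hG => (Instance.encode_injective n (hF.trans hG.symm)) ▸ hb⟩
    · exact ⟨true, fun F hF => absurd ⟨F, hF⟩ h⟩⟩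

/-- The set of all `x` such that the remaining formula `∀ y⁽¹⁾, ∃ y⁽²⁾, …` holds of `f_x`. -/
def Instance.witnesses {n : ℕ} (F : Instance n) : Set (Word F.m) :=
  {x | CoSatHolds F.ms (fixFirst F.fn x)}

/-- The set of all `x` such that the remaining formula `∃ y⁽¹⁾, ∀ y⁽²⁾, …` fails for `f_x`. -/
def Instance.counterexamples {n : ℕ} (F : Instance n) : Set (Word F.m) :=
  {x | ¬ SatHolds F.ms (fixFirst F.fn x)}

/-- The truth of the formula `∃ x, ∀ y⁽¹⁾, …` of an instance. -/
def Instance.Sat {n : ℕ} (F : Instance n) : Prop := SatHolds (F.m :: F.ms) F.fn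

/-- The truth of the formula `∀ x, ∃ y⁽¹⁾, …` of an instance. -/
def Instance.CoSat {n : ℕ} (F : Instance n) : Prop := CoSatHolds (F.m :: F.ms) F.fn

/-- The first bits of the lexicographically greatest element of `S` (if there is one). -/
def firstBitMax {m : ℕ+} (S : Set (Word m)) : Set Bool :=
  {b | ∃ w : Lex (Word m), IsGreatest {v | ofLex v ∈ S} w ∧ b = firstBit (ofLex w)}

/-- The first bits of the lexicographically least element of `S` (if there is one). -/
def firstBitMin {m : ℕ+} (S : Set (Word m)) : Set Bool :=
  {b | ∃ w : Lex (Word m), IsLeast {v | ofLex v ∈ S} w ∧ b = firstBit (ofLex w)}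

theorem Instance.Sat.nonempty {n : ℕ} {F : Instance n} (h : F.Sat) : F.witnesses.Nonempty := by
  obtain ⟨x, hx⟩ := (by simpa [Instance.Sat, SatHolds] using h :
    ∃ x : Word F.m, CoSatHolds F.ms (fixFirst F.fn x))
  exact ⟨x, hx⟩

theorem firstBitMax_nonempty {m : ℕ+} {S : Set (Word m)} (h : S.Nonempty) :
    (firstBitMax S).Nonempty := by
  obtain ⟨x, hx⟩ := h
  have : Finite (Lex (Word m)) := inferInstanceAs (Finite (Word m))
  obtain ⟨w, hw, hmax⟩ := Set.exists_max_image {v : Lex (Word m) | ofLex v ∈ S} id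
    (Set.toFinite _) ⟨toLex x, hx⟩
  exact ⟨_, w, ⟨hw, fun v hv => hmax v hv⟩, rfl⟩

theorem firstBitMin_nonempty {m : ℕ+} {S : Set (Word m)} (h : S.Nonempty) :
    (firstBitMin S).Nonempty := by
  obtain ⟨x, hx⟩ := h
  have : Finite (Lex (Word m)) := inferInstanceAs (Finite (Word m))
  obtain ⟨w, hw, hmin⟩ := Set.exists_min_image {v : Lex (Word m) | ofLex v ∈ S} id
    (Set.toFinite _) ⟨toLex x, hx⟩
  exact ⟨_, w, ⟨hw, fun v hv => hmin v hv⟩, rfl⟩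

/-- `SAT_n`. -/
noncomputable def SAT (n : ℕ) : PromiseProblem := (decisionProblem n Instance.Sat).toPromise

/-- `coSAT_n`. -/
noncomputable def coSAT (n : ℕ) : PromiseProblem := (decisionProblem n Instance.CoSat).toPromise

/-- `MaxVAL_n`. -/
def MaxVAL (n : ℕ) : PromiseProblem := promiseProblem n fun F =>
  Answers.promise F.Sat (firstBitMax F.witnesses) fun h => firstBitMax_nonempty h.nonempty

/-- `MinVAL_n`. -/
def MinVAL (n : ℕ) : PromiseProblem := promiseProblem n fun F =>
  Answers.promise F.Sat (firstBitMin F.witnesses) fun h => firstBitMin_nonempty h.nonempty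

/-- `VAL_n`. -/
def VAL (n : ℕ) : PromiseProblem := promiseProblem n fun F =>
  Answers.promise F.Sat (firstBit '' F.witnesses) fun h => h.nonempty.image _

open Classical in
/-- `USAT_n`. -/
noncomputable def USAT (n : ℕ) : PromiseProblem := promiseProblem n fun F =>
  Answers.promise (F.witnesses.encard ≤ 1) {decide F.Sat} fun _ => Set.singleton_nonempty _

open Classical in
/-- `coUSAT_n`. -/
noncomputable def coUSAT (n : ℕ) : PromiseProblem := promiseProblem n fun F =>
  Answers.promise (F.counterexamples.encard ≤ 1) {decide F.CoSat} fun _ => Set.singleton_nonempty _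

/-- `UVAL_n`. -/
def UVAL (n : ℕ) : PromiseProblem := promiseProblem n fun F =>
  Answers.promise (∃! x, x ∈ F.witnesses) (firstBit '' F.witnesses)
    fun h => Set.Nonempty.image _ h.exists

end PromiseHierarchy

/-!
Each reduction rewrites the expression of an instance. Negating the expression exchanges `SAT n`
with `coSAT n` and `USAT n` with `coUSAT n`. Substituting the complement of the first block reverses
the lexicographic order and flips first bits, which gives the dualities of `MaxVAL n`, `MinVAL n`,
`VAL n` and `UVAL n`. The greatest witness has first bit `1` if and only if some witness has, which
is decided by `SAT n` after conjoining the first bit; conversely, `f` is satisfiable if and only if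
the greatest witness `b x` of `¬ b ∨ f (x, y)` has first bit `b = 1`. Finally, that `x` is a witness
and that there is no greater one is a conjunction of a formula with `n - 1` quantifiers and of one
with `n` quantifiers, starting with `∀`; evaluated on disjoint parts of common blocks, the two
become one formula with `n` quantifiers, whose only witness is the greatest witness of `f`.

All these rewritings are computable in polynomial time: two machines which run one after the other
compute the composite, programs with finitely many string registers are simulated by machines, and
the functions they compute in polynomial time are closed under recursion along strings which
increases the accumulator by a polynomial amount in each step. The substitution in Polish notation
and the recognition of encodings are such recursions.
-/

namespace PromiseHierarchy

/-! ### Composition of polynomial-time machines -/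

section Steps

variable {C : Type*} {f : C → Option C} {s t : ℕ} {a b c : C}

/-- `c` is reached from `a` in exactly `t` steps of `f`: the propositional counterpart of
`StateTransition.EvalsTo`. -/
def StepsTo (f : C → Option C) (t : ℕ) (a c : C) : Prop := (flip bind f)^[t] (some a) = some c

theorem StepsTo.refl (f : C → Option C) (a : C) : StepsTo f 0 a a := rfl

theorem StepsTo.trans (h : StepsTo f s a b) (h' : StepsTo f t b c) : StepsTo f (s + t) a c := by
  unfold StepsTo at *
  rw [add_comm, Function.iterate_add_apply, h, h']

theorem StepsTo.single (h : f a = some b) : StepsTo f 1 a b := by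
  simpa [StepsTo, flip] using h

theorem stepsTo_zero : StepsTo f 0 a c ↔ a = c := by simp [StepsTo]

theorem stepsTo_succ : StepsTo f (t + 1) a c ↔ ∃ b, f a = some b ∧ StepsTo f t b c := by
  unfold StepsTo
  rw [Function.iterate_succ_apply]
  cases h : f a with
  | none =>
    have : flip bind f (some a) = none := h
    rw [this, Function.iterate_fixed (rfl : flip bind f none = none)]
    simp
  | some b => simp [flip, h]

theorem StepsTo.head (h : f a = some b) (h' : StepsTo f t b c) : StepsTo f (t + 1) a c :=
  stepsTo_succ.2 ⟨b, h, h'⟩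

end Steps

section Machines

open Turing Function

variable {K K' Λ Λ' σ σ' τ γ : Type*} [DecidableEq K'] {Γ : K → Type*}
  {Γ' : K' → Type*}

/-- A statement of a machine, as a statement of a larger machine in which stack `k` is called
`e k`, label `l` is called `lbl l` and the state is the first component of the new state. Instead
of halting, the larger machine proceeds to `exit`. -/
def embedStmt (e : K → K') (v : σ' ≃ σ × τ) (lbl : Λ → Λ') (exit : Option Λ') :
    TM2.Stmt (fun k => Γ' (e k)) Λ σ → TM2.Stmt Γ' Λ' σ'
  | .push k f q => .push (e k) (fun x => f (v x).1) (embedStmt e v lbl exit q)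
  | .peek k f q =>
    .peek (e k) (fun x a => v.symm (f (v x).1 a, (v x).2)) (embedStmt e v lbl exit q)
  | .pop k f q =>
    .pop (e k) (fun x a => v.symm (f (v x).1 a, (v x).2)) (embedStmt e v lbl exit q)
  | .load f q => .load (fun x => v.symm (f (v x).1, (v x).2)) (embedStmt e v lbl exit q)
  | .branch f q r =>
    .branch (fun x => f (v x).1) (embedStmt e v lbl exit q) (embedStmt e v lbl exit r)
  | .goto f => .goto fun x => lbl (f (v x).1)
  | .halt => exit.elim .halt fun l => .goto fun _ => l

variable {e : K → K'} {v : σ' ≃ σ × τ} {lbl : Λ → Λ'} {exit : Option Λ'}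
  {w : τ}

/-- Of the larger machine of `embedStmt`, the configuration `c'` corresponds to `c`, the other state
component being `w` and the other stacks being those of `R`. -/
def EmbedsCfg (e : K → K') (v : σ' ≃ σ × τ) (lbl : Λ → Λ') (exit : Option Λ') (w : τ)
    (R : ∀ k, List (Γ' k)) (c : TM2.Cfg (fun k => Γ' (e k)) Λ σ) (c' : TM2.Cfg Γ' Λ' σ') : Prop :=
  c'.l = c.l.elim exit (some ∘ lbl) ∧ c'.var = v.symm (c.var, w) ∧
    (∀ k, c'.stk (e k) = c.stk k) ∧ ∀ k ∉ Set.range e, c'.stk k = R k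

theorem EmbedsCfg.of_update {R : ∀ k, List (Γ' k)} {k : K} {y : List (Γ' (e k))}
    {c : TM2.Cfg (fun k => Γ' (e k)) Λ σ} {c' : TM2.Cfg Γ' Λ' σ'}
    (h : EmbedsCfg e v lbl exit w (update R (e k) y) c c') : EmbedsCfg e v lbl exit w R c c' :=
  ⟨h.1, h.2.1, h.2.2.1, fun j hj =>
    (h.2.2.2 j hj).trans (update_of_ne (fun hk => hj ⟨k, hk.symm⟩) _ _)⟩

variable [DecidableEq K]

theorem embedsCfg_single_iff (he : Injective e) {l : Option Λ} {x : σ} {k : K}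
    {y : List (Γ' (e k))} {c' : TM2.Cfg Γ' Λ' σ'} :
    EmbedsCfg e v lbl exit w (fun _ => []) ⟨l, x, update (fun _ => []) k y⟩ c' ↔
      c' = ⟨l.elim exit (some ∘ lbl), v.symm (x, w), update (fun _ => []) (e k) y⟩ := by
  obtain ⟨l', x', R'⟩ := c'
  simp only [EmbedsCfg, TM2.Cfg.mk.injEq, and_congr_right_iff]
  rintro - -
  constructor
  · rintro ⟨h, h'⟩
    funext j
    by_cases hj : j ∈ Set.range e
    · obtain ⟨i, rfl⟩ := hj
      rw [h, ← update_comp_eq_of_injective' (fun _ => []) he k]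
    · rw [h' j hj, update_of_ne (fun hk => hj ⟨k, hk.symm⟩)]
  · rintro rfl
    exact ⟨fun i => congr_fun (update_comp_eq_of_injective' (fun _ => []) he k y) i,
      fun j hj => update_of_ne (fun hk => hj ⟨k, hk.symm⟩) _ _⟩

theorem stepAux_embedStmt (he : Injective e) (q : TM2.Stmt (fun k => Γ' (e k)) Λ σ) (x : σ)
    (w : τ) (R : ∀ k, List (Γ' k)) :
    EmbedsCfg e v lbl exit w R (TM2.stepAux q x fun k => R (e k))
      (TM2.stepAux (embedStmt e v lbl exit q) (v.symm (x, w)) R) := by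
  induction q generalizing x R with
  | push k f q ih =>
    have := (ih x (update R (e k) (f x :: R (e k)))).of_update
    rw [update_comp_eq_of_injective' R he k] at this
    simpa [embedStmt] using this
  | peek k f q ih => simpa [embedStmt] using ih (f x (R (e k)).head?) R
  | pop k f q ih =>
    have := (ih (f x (R (e k)).head?) (update R (e k) (R (e k)).tail)).of_update
    rw [update_comp_eq_of_injective' R he k] at this
    simpa [embedStmt] using this
  | load f q ih => simpa [embedStmt] using ih (f x) R
  | branch f q r ihq ihr => cases h : f x <;> simp [embedStmt, TM2.stepAux, h, ihq, ihr]
  | goto f => simp [embedStmt, EmbedsCfg]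
  | halt => cases exit <;> simp [embedStmt, EmbedsCfg]

theorem exists_stepsTo_embedsCfg (he : Injective e)
    {M : Λ → TM2.Stmt (fun k => Γ' (e k)) Λ σ} {M' : Λ' → TM2.Stmt Γ' Λ' σ'}
    (hM : ∀ l, M' (lbl l) = embedStmt e v lbl exit (M l)) {R : ∀ k, List (Γ' k)} {t : ℕ}
    {c d : TM2.Cfg (fun k => Γ' (e k)) Λ σ} (h : StepsTo (TM2.step M) t c d)
    {c' : TM2.Cfg Γ' Λ' σ'} (hc : EmbedsCfg e v lbl exit w R c c') :
    ∃ d', StepsTo (TM2.step M') t c' d' ∧ EmbedsCfg e v lbl exit w R d d' := by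
  induction t generalizing c c' with
  | zero => exact ⟨c', .refl _ _, stepsTo_zero.1 h ▸ hc⟩
  | succ t ih =>
    obtain ⟨b, hb, h⟩ := stepsTo_succ.1 h
    obtain ⟨_ | l, x, S⟩ := c
    · simp at hb
    obtain ⟨l', x', R'⟩ := c'
    obtain ⟨rfl, rfl, hS, hR⟩ : l' = some (lbl l) ∧ x' = v.symm (x, w) ∧ _ ∧ _ := hc
    obtain rfl : (fun k => R' (e k)) = S := funext hS
    obtain rfl : TM2.stepAux (M l) x (fun k => R' (e k)) = b := by simpa using hb
    obtain ⟨h₁, h₂, h₃, h₄⟩ :=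
      stepAux_embedStmt (v := v) (lbl := lbl) (exit := exit) he (M l) x w R'
    obtain ⟨d', hd, hd'⟩ := ih h ⟨h₁, h₂, h₃, fun k hk => (h₄ k hk).trans (hR k hk)⟩
    exact ⟨d', hd.head (by simp [hM]), hd'⟩

/-- A loop which moves the content of stack `k` to stack `k'`, reversing it and translating the
alphabet by `f` and `g`; a symbol on its way is kept in the second state component. -/
def transferStmt [Inhabited γ] (k k' : K) (f : Γ k → γ) (g : γ → Γ k') (loop next : Λ) :
    TM2.Stmt Γ Λ (σ × Option γ) :=
  .pop k (fun x a => (x.1, a.map f)) <|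
    .branch (fun x => x.2.isSome)
      (.push k' (fun x => g (x.2.getD default)) (.goto fun _ => loop))
      (.goto fun _ => next)

theorem stepsTo_transferStmt [Inhabited γ] {M : Λ → TM2.Stmt Γ Λ (σ × Option γ)} {k k' : K}
    {f : Γ k → γ} {g : γ → Γ k'} {loop next : Λ}
    (hM : M loop = transferStmt k k' f g loop next) (hk : k ≠ k') (x : σ) (a : Option γ)
    (S : ∀ k, List (Γ k)) :
    StepsTo (TM2.step M) ((S k).length + 1) ⟨some loop, (x, a), S⟩
      ⟨some next, (x, none),
        update (update S k []) k' (((S k).map (g ∘ f)).reverse ++ S k')⟩ := by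
  induction hl : S k generalizing a S with
  | nil =>
    refine .single ?_
    have hS : update (update S k []) k' (S k') = update S k [] := by
      rw [← update_of_ne hk.symm [] S, update_eq_self]
    simp [hM, transferStmt, hl, hS]
  | cons b l ih =>
    refine .head (b := ⟨some loop, (x, some (f b)),
      update (update S k l) k' (g (f b) :: S k')⟩) (by simp [hM, transferStmt, hl, hk.symm]) ?_
    have hS : update (update (update S k l) k' (g (f b) :: S k')) k [] =
        update (update S k []) k' (g (f b) :: S k') := by
      rw [update_comm hk, update_idem, update_comm hk.symm]
    simpa [hS] using ih (some (f b)) (update (update S k l) k' (g (f b) :: S k')) (by simp [hk])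

/-- The number of push instructions in a statement. -/
def pushCount : TM2.Stmt Γ Λ σ → ℕ
  | .push _ _ q => pushCount q + 1
  | .peek _ _ q => pushCount q
  | .pop _ _ q => pushCount q
  | .load _ q => pushCount q
  | .branch _ q r => pushCount q + pushCount r
  | .goto _ => 0
  | .halt => 0

theorem length_stepAux_stk_le (q : TM2.Stmt Γ Λ σ) (x : σ) (S : ∀ k, List (Γ k)) (k : K) :
    ((TM2.stepAux q x S).stk k).length ≤ (S k).length + pushCount q := by
  have length_update_le (j : K) (y : List (Γ j)) {n : ℕ} (h : y.length ≤ (S j).length + n) :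
      (update S j y k).length ≤ (S k).length + n := by
    obtain rfl | hk := eq_or_ne k j
    · simpa using h
    · simp [hk]
  induction q generalizing x S with
  | push j f _ ih =>
    have := length_update_le j (f x :: S j) (n := 1) (by simp)
    grind [TM2.stepAux, pushCount]
  | peek j f _ ih => exact ih _ _ length_update_le
  | pop j f _ ih =>
    have := length_update_le j (S j).tail (n := 0) (by simp)
    grind [TM2.stepAux, pushCount]
  | load f _ ih => exact ih _ _ length_update_le
  | branch f q r ihq ihr => cases h : f x <;> grind [TM2.stepAux, pushCount]
  | goto f => simp
  | halt => simp

theorem StepsTo.length_stk_le {M : Λ → TM2.Stmt Γ Λ σ} {B t : ℕ} (hB : ∀ l, pushCount (M l) ≤ B)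
    {c d : TM2.Cfg Γ Λ σ} (h : StepsTo (TM2.step M) t c d) (k : K) :
    (d.stk k).length ≤ (c.stk k).length + t * B := by
  induction t generalizing c with
  | zero => simp [stepsTo_zero.1 h]
  | succ t ih =>
    obtain ⟨b, hb, h⟩ := stepsTo_succ.1 h
    obtain ⟨_ | l, x, S⟩ := c
    · simp at hb
    obtain rfl : TM2.stepAux (M l) x S = b := by simpa using hb
    grind [length_stepAux_stk_le (M l) x S k]

theorem initList_eq (tm : FinTM2) (l : List (tm.Γ tm.k₀)) :
    initList tm l = ⟨some tm.main, tm.initialState, update (fun _ => []) tm.k₀ l⟩ := by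
  unfold initList
  congr 1
  funext k
  obtain rfl | hk := eq_or_ne k tm.k₀ <;> simp [*]

theorem haltList_eq (tm : FinTM2) (l : List (tm.Γ tm.k₁)) :
    haltList tm l = ⟨none, tm.initialState, update (fun _ => []) tm.k₁ l⟩ := by
  unfold haltList
  congr 1
  funext k
  obtain rfl | hk := eq_or_ne k tm.k₁ <;> simp [*]

theorem exists_length_output_le (tm : FinTM2) : ∃ B : ℕ, ∀ {t l l'},
    StepsTo tm.step t (initList tm l) (haltList tm l') → l'.length ≤ l.length + t * B := by
  have := tm.ΛFin
  refine ⟨∑ l, pushCount (tm.m l), fun {t l l'} h => ?_⟩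
  have := StepsTo.length_stk_le (fun l => Finset.single_le_sum
    (f := fun l => pushCount (tm.m l)) (by simp) (Finset.mem_univ l)) h tm.k₁
  simp only [initList_eq, haltList_eq, update_self] at this
  refine this.trans (Nat.add_le_add_right ?_ _)
  obtain hk | hk := eq_or_ne tm.k₁ tm.k₀
  · rw [hk]; simp
  · simp [hk]

section Composite

variable {K₁ K₂ Λ₁ Λ₂ σ₁ σ₂ : Type*} {γ : Type} [DecidableEq K₁] [DecidableEq K₂]
  {Γ₁ : K₁ → Type} {Γ₂ : K₂ → Type} [Inhabited γ]

/-- The stack alphabets of a composite machine: those of its two parts, and that of an auxiliary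
stack. -/
abbrev CompΓ (Γ₁ : K₁ → Type) (Γ₂ : K₂ → Type) (γ : Type) : K₁ ⊕ K₂ ⊕ Unit → Type
  | .inl k => Γ₁ k
  | .inr (.inl k) => Γ₂ k
  | .inr (.inr _) => γ

/-- The code of the composite of two machines, `f` and `g` translating the alphabet of the output
stack `k₁` of the first into the alphabet of the input stack `k₂` of the second. The output of the
first machine is moved to the auxiliary stack and from there to `k₂`, hence reversed twice. -/
def compCode (M₁ : Λ₁ → TM2.Stmt Γ₁ Λ₁ σ₁) (M₂ : Λ₂ → TM2.Stmt Γ₂ Λ₂ σ₂) (k₁ : K₁) (k₂ : K₂)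
    (f : Γ₁ k₁ → γ) (g : γ → Γ₂ k₂) (main₂ : Λ₂) :
    Λ₁ ⊕ Λ₂ ⊕ Bool → TM2.Stmt (CompΓ Γ₁ Γ₂ γ) (Λ₁ ⊕ Λ₂ ⊕ Bool) ((σ₁ × σ₂) × Option γ)
  | .inl l => embedStmt .inl (Equiv.prodAssoc _ _ _) .inl (some (.inr (.inr false))) (M₁ l)
  | .inr (.inl l) => embedStmt (.inr ∘ .inl)
      (((Equiv.prodComm _ _).prodCongr (.refl _)).trans (.prodAssoc _ _ _)) (.inr ∘ .inl) none
      (M₂ l)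
  | .inr (.inr false) => transferStmt (.inl k₁) (.inr (.inr ())) f id (.inr (.inr false))
      (.inr (.inr true))
  | .inr (.inr true) => transferStmt (.inr (.inr ())) (.inr (.inl k₂)) id g (.inr (.inr true))
      (.inr (.inl main₂))

theorem stepsTo_compCode {M₁ : Λ₁ → TM2.Stmt Γ₁ Λ₁ σ₁} {M₂ : Λ₂ → TM2.Stmt Γ₂ Λ₂ σ₂}
    {k₀ k₁ : K₁} {k₂ k₃ : K₂} {f : Γ₁ k₁ → γ} {g : γ → Γ₂ k₂} {main₁ : Λ₁} {main₂ : Λ₂}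
    {x₁ : σ₁} {x₂ : σ₂} {t₁ t₂ : ℕ} {y₀ : List (Γ₁ k₀)} {y : List (Γ₁ k₁)} {y₃ : List (Γ₂ k₃)}
    (h₁ : StepsTo (TM2.step M₁) t₁ ⟨some main₁, x₁, update (fun _ => []) k₀ y₀⟩
      ⟨none, x₁, update (fun _ => []) k₁ y⟩)
    (h₂ : StepsTo (TM2.step M₂) t₂ ⟨some main₂, x₂, update (fun _ => []) k₂ (y.map (g ∘ f))⟩
      ⟨none, x₂, update (fun _ => []) k₃ y₃⟩) :
    StepsTo (TM2.step (compCode M₁ M₂ k₁ k₂ f g main₂))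
      (t₁ + (y.length + 1) + (y.length + 1) + t₂)
      ⟨some (.inl main₁), ((x₁, x₂), none), update (fun _ => []) (.inl k₀) y₀⟩
      ⟨none, ((x₁, x₂), none), update (fun _ => []) (.inr (.inl k₃)) y₃⟩ := by
  let M := compCode M₁ M₂ k₁ k₂ f g main₂
  obtain ⟨c₁, run₁, hc₁⟩ := exists_stepsTo_embedsCfg (M' := M) (R := fun _ => [])
    (v := .prodAssoc _ _ _) (lbl := .inl) (exit := some (.inr (.inr false)))
    (w := (x₂, none)) Sum.inl_injective (fun _ => rfl) h₁
    ((embedsCfg_single_iff Sum.inl_injective).2 rfl)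
  obtain rfl := (embedsCfg_single_iff Sum.inl_injective).1 hc₁
  have run₂ : StepsTo (TM2.step M) (y.length + 1)
      ⟨some (.inr (.inr false)), ((x₁, x₂), none), update (fun _ => []) (.inl k₁) y⟩
      ⟨some (.inr (.inr true)), ((x₁, x₂), none),
        update (fun _ => []) (.inr (.inr ())) (y.map f).reverse⟩ := by
    simpa using stepsTo_transferStmt (M := M) (loop := .inr (.inr false)) rfl (by simp) (x₁, x₂)
      none (update (fun _ => []) (.inl k₁) y)
  have run₃ : StepsTo (TM2.step M) (y.length + 1)
      ⟨some (.inr (.inr true)), ((x₁, x₂), none),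
        update (fun _ => []) (.inr (.inr ())) (y.map f).reverse⟩
      ⟨some (.inr (.inl main₂)), ((x₁, x₂), none),
        update (fun _ => []) (.inr (.inl k₂)) (y.map (g ∘ f))⟩ := by
    simpa using stepsTo_transferStmt (M := M) (loop := .inr (.inr true)) rfl (by simp) (x₁, x₂)
      none (update (fun _ => []) (.inr (.inr ())) (y.map f).reverse)
  have hi := (Sum.inr_injective (α := K₁)).comp (Sum.inl_injective (β := Unit) (α := K₂))
  obtain ⟨c₄, run₄, hc₄⟩ := exists_stepsTo_embedsCfg (M' := M) (R := fun _ => [])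
    (v := ((Equiv.prodComm _ _).prodCongr (.refl _)).trans (.prodAssoc _ _ _))
    (lbl := .inr ∘ .inl) (exit := none) (w := (x₁, none)) hi (fun _ => rfl) h₂
    ((embedsCfg_single_iff hi).2 rfl)
  obtain rfl := (embedsCfg_single_iff hi).1 hc₄
  exact ((run₁.trans run₂).trans run₃).trans run₄

end Composite

/-- The composite of two machines, `f` and `g` translating the output alphabet of the first into
the input alphabet of the second. -/
def compTM (tm₁ tm₂ : FinTM2) {γ : Type} [Inhabited γ] [Fintype γ] (f : tm₁.Γ tm₁.k₁ → γ)
    (g : γ → tm₂.Γ tm₂.k₀) : FinTM2 :=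
  letI := tm₁.kFin; letI := tm₁.ΛFin; letI := tm₁.σFin
  letI := tm₂.kFin; letI := tm₂.ΛFin; letI := tm₂.σFin
  { K := tm₁.K ⊕ tm₂.K ⊕ Unit
    k₀ := .inl tm₁.k₀
    k₁ := .inr (.inl tm₂.k₁)
    Γ := CompΓ tm₁.Γ tm₂.Γ γ
    Λ := tm₁.Λ ⊕ tm₂.Λ ⊕ Bool
    main := .inl tm₁.main
    σ := (tm₁.σ × tm₂.σ) × Option γ
    initialState := ((tm₁.initialState, tm₂.initialState), none)
    Γk₀Fin := tm₁.Γk₀Fin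
    m := compCode tm₁.m tm₂.m tm₁.k₁ tm₂.k₀ f g tm₂.main }

theorem polynomial_eval_monotone (P : Polynomial ℕ) : Monotone fun n => P.eval n := by
  intro a b h
  simp only [Polynomial.eval_eq_sum]
  exact Finset.sum_le_sum fun i _ => Nat.mul_le_mul_left _ (Nat.pow_le_pow_left h i)

theorem stepsTo_compTM {tm₁ tm₂ : FinTM2} {γ : Type} [Inhabited γ] [Fintype γ]
    {f : tm₁.Γ tm₁.k₁ → γ} {g : γ → tm₂.Γ tm₂.k₀} {t₁ t₂ : ℕ} {y₀ : List (tm₁.Γ tm₁.k₀)}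
    {y : List (tm₁.Γ tm₁.k₁)} {y₃ : List (tm₂.Γ tm₂.k₁)}
    (h₁ : StepsTo tm₁.step t₁ (initList tm₁ y₀) (haltList tm₁ y))
    (h₂ : StepsTo tm₂.step t₂ (initList tm₂ (y.map (g ∘ f))) (haltList tm₂ y₃)) :
    StepsTo (compTM tm₁ tm₂ f g).step (t₁ + (y.length + 1) + (y.length + 1) + t₂)
      (initList (compTM tm₁ tm₂ f g) y₀) (haltList (compTM tm₁ tm₂ f g) y₃) := by
  rw [initList_eq, haltList_eq] at h₁ h₂
  exact (congrArg₂ (StepsTo _ _) (initList_eq (compTM tm₁ tm₂ f g) _)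
    (haltList_eq (compTM tm₁ tm₂ f g) _)).mpr (stepsTo_compCode h₁ h₂)

theorem nonempty_tm2ComputableInPolyTime_comp {α β δ αΓ βΓ δΓ : Type} [Inhabited βΓ]
    {eα : α → List αΓ} {eβ : β → List βΓ} {eδ : δ → List δΓ} {f : α → β} {g : β → δ}
    (hg : Nonempty (TM2ComputableInPolyTime eβ eδ g))
    (hf : Nonempty (TM2ComputableInPolyTime eα eβ f)) :
    Nonempty (TM2ComputableInPolyTime eα eδ (g ∘ f)) := by
  obtain ⟨⟨⟨tm₁, i₁, o₁⟩, P₁, h₁⟩⟩ := hf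
  obtain ⟨⟨⟨tm₂, i₂, o₂⟩, P₂, h₂⟩⟩ := hg
  let _ : Fintype βΓ := letI := tm₂.Γk₀Fin; .ofEquiv _ i₂
  obtain ⟨B, hB⟩ := exists_length_output_le tm₁
  let L : Polynomial ℕ := .X + P₁ * .C B
  refine ⟨⟨compTM tm₁ tm₂ o₁ i₂.symm, i₁, o₂⟩, P₁ + (L + 1) + (L + 1) + P₂.comp L, fun a => ?_⟩
  obtain ⟨⟨t₁, run₁⟩, ht₁ : t₁ ≤ P₁.eval (eα a).length⟩ := h₁ a
  obtain ⟨⟨t₂, run₂⟩, ht₂ : t₂ ≤ P₂.eval (eβ (f a)).length⟩ := h₂ (f a)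
  have length_le : (eβ (f a)).length ≤ L.eval (eα a).length := by
    have := hB run₁
    simp only [List.length_map] at this
    simp only [L, Polynomial.eval_add, Polynomial.eval_X, Polynomial.eval_mul, Polynomial.eval_C]
    exact this.trans (Nat.add_le_add_left (Nat.mul_le_mul_right _ ht₁) _)
  have translate : ((eβ (f a)).map o₁.symm).map (i₂.symm ∘ o₁) = (eβ (f a)).map i₂.symm := by
    simp [Function.comp_assoc]
  have run := stepsTo_compTM (f := o₁) (g := i₂.symm) run₁
    (translate.symm ▸ run₂ : StepsTo _ _ (initList tm₂ _) _)
  rw [List.length_map] at run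
  refine ⟨⟨_, run⟩, ?_⟩
  have := polynomial_eval_monotone P₂ length_le
  simp only [Polynomial.eval_add, Polynomial.eval_one, Polynomial.eval_comp] at this ⊢
  omega

end Machines

theorem PolyTime.comp {μ ν : Str → Str} (hν : PolyTime ν) (hμ : PolyTime μ) : PolyTime (ν ∘ μ) :=
  nonempty_tm2ComputableInPolyTime_comp hν hμ

theorem StrongReduces.trans {φ₁ φ₂ φ₃ : PromiseProblem} (h : StrongReduces φ₁ φ₂)
    (h' : StrongReduces φ₂ φ₃) : StrongReduces φ₁ φ₃ := by
  obtain ⟨μ, hμ, h⟩ := h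
  obtain ⟨ν, hν, h'⟩ := h'
  exact ⟨ν ∘ μ, hν.comp hμ, fun s => (h' (μ s)).trans (h s)⟩

theorem strongClosure_eq {φ ψ : PromiseProblem} (hφψ : StrongReduces φ ψ)
    (hψφ : StrongReduces ψ φ) : strongClosure φ = strongClosure ψ :=
  Set.ext fun _ => ⟨fun h => h.trans hφψ, fun h => h.trans hψφ⟩

/-! ### A programming language over registers -/

section Programs

open Turing Function

/-- Programs over registers, numbered by `ℕ`, which hold bit strings. -/
inductive Prog : Type
  | skip : Prog
  | push (r : ℕ) (b : Bool) : Prog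
  | seq (p q : Prog) : Prog
  /-- remove the first bit of a register and branch on it -/
  | pop (r : ℕ) (ifNil : Prog) (ifCons : Bool → Prog) : Prog
  /-- as long as a register is nonempty, remove its first bit and branch on it -/
  | loop (r : ℕ) (body : Bool → Prog) : Prog

/-- `Exec p s s' t`: started with register contents `s`, the program `p` ends with register
contents `s'` after `t` steps. -/
inductive Exec : Prog → (ℕ → List Bool) → (ℕ → List Bool) → ℕ → Prop
  | skip (s) : Exec .skip s s 1
  | push (r b s) : Exec (.push r b) s (update s r (b :: s r)) 1
  | seq {p q s s' s'' t t'} : Exec p s s' t → Exec q s' s'' t' → Exec (.seq p q) s s'' (t + t')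
  | pop_nil {r p q s s' t} : s r = [] → Exec p s s' t → Exec (.pop r p q) s s' (t + 1)
  | pop_cons {r p q s s' t b l} : s r = b :: l → Exec (q b) (update s r l) s' t →
      Exec (.pop r p q) s s' (t + 1)
  | loop_nil {r p s} : s r = [] → Exec (.loop r p) s s 1
  | loop_cons {r p s s' s'' t t' b l} : s r = b :: l → Exec (p b) (update s r l) s' t →
      Exec (.loop r p) s' s'' t' → Exec (.loop r p) s s'' (t + t' + 1)

theorem Exec.length_le {p : Prog} {s s' : ℕ → List Bool} {t : ℕ} (h : Exec p s s' t) (r : ℕ) :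
    (s' r).length ≤ (s r).length + t := by
  induction h <;> grind [update_apply]

/-- A bound for the registers used by a program. -/
def Prog.bound : Prog → ℕ
  | .skip => 0
  | .push r _ => r + 1
  | .seq p q => max p.bound q.bound
  | .pop r p q => max (r + 1) (max p.bound (Finset.univ.sup fun b => (q b).bound))
  | .loop r p => max (r + 1) (Finset.univ.sup fun b => (p b).bound)

/-- The labels of the machine code of a program. -/
def Prog.Label : Prog → Type
  | .skip => Unit
  | .push _ _ => Unit
  | .seq p q => p.Label ⊕ q.Label
  | .pop _ p q => Unit ⊕ p.Label ⊕ Σ b, (q b).Label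
  | .loop _ p => Unit ⊕ Σ b, (p b).Label

instance Prog.finite_label : ∀ p : Prog, Finite p.Label
  | .skip => inferInstanceAs (Finite Unit)
  | .push _ _ => inferInstanceAs (Finite Unit)
  | .seq p q =>
    have := p.finite_label
    have := q.finite_label
    inferInstanceAs (Finite (p.Label ⊕ q.Label))
  | .pop _ p q =>
    have := p.finite_label
    have := fun b => (q b).finite_label
    inferInstanceAs (Finite (Unit ⊕ p.Label ⊕ Σ b, (q b).Label))
  | .loop _ p =>
    have := fun b => (p b).finite_label
    inferInstanceAs (Finite (Unit ⊕ Σ b, (p b).Label))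

/-- The label at which a program starts. -/
def Prog.entry : (p : Prog) → p.Label
  | .skip => ()
  | .push _ _ => ()
  | .seq p _ => .inl p.entry
  | .pop _ _ _ => .inl ()
  | .loop _ _ => .inl ()

/-- The machine code of a program, within a machine with stacks `K` and labels `L` in which
register `r` is the stack `ρ r` and label `l` is called `lbl l`. The state of the machine is the
bit removed last. -/
def Prog.code {K L : Type} (ρ : ℕ → K) : (p : Prog) → (lbl : p.Label → L) → (exit : L) →
    p.Label → TM2.Stmt (fun _ : K => Bool) L (Option Bool)
  | .skip, _, exit, _ => .goto fun _ => exit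
  | .push r b, _, exit, _ => .push (ρ r) (fun _ => b) (.goto fun _ => exit)
  | .seq p q, lbl, _, .inl l => p.code ρ (fun l => lbl (.inl l)) (lbl (.inr q.entry)) l
  | .seq _ q, lbl, exit, .inr l => q.code ρ (fun l => lbl (.inr l)) exit l
  | .pop r p q, lbl, _, .inl _ => .pop (ρ r) (fun _ a => a) (.goto fun a =>
      a.elim (lbl (.inr (.inl p.entry))) fun b => lbl (.inr (.inr ⟨b, (q b).entry⟩)))
  | .pop _ p _, lbl, exit, .inr (.inl l) => p.code ρ (fun l => lbl (.inr (.inl l))) exit l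
  | .pop _ _ q, lbl, exit, .inr (.inr ⟨b, l⟩) =>
      (q b).code ρ (fun l => lbl (.inr (.inr ⟨b, l⟩))) exit l
  | .loop r p, lbl, exit, .inl _ => .pop (ρ r) (fun _ a => a) (.goto fun a =>
      a.elim exit fun b => lbl (.inr ⟨b, (p b).entry⟩))
  | .loop _ p, lbl, _, .inr ⟨b, l⟩ => (p b).code ρ (fun l => lbl (.inr ⟨b, l⟩)) (lbl (.inl ())) l

section Machine

variable {N : ℕ}

theorem update_comp_val [NeZero N] {s : ℕ → List Bool} {r : ℕ} (hr : r < N) (l : List Bool) :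
    update (fun k : Fin N => s k) (Fin.ofNat N r) l = fun k : Fin N => update s r l k := by
  funext k
  simp only [update_apply, Fin.ext_iff, Fin.val_ofNat, Nat.mod_eq_of_lt hr]

section Pop

variable [NeZero N] {L : Type} {M : L → TM2.Stmt (fun _ : Fin N => Bool) L (Option Bool)} {l : L}
  {r : ℕ} {target : Option Bool → L}

theorem stepsTo_pop (hr : r < N)
    (hM : M l = .pop (Fin.ofNat N r) (fun _ a => a) (.goto target)) (a : Option Bool)
    (s : ℕ → List Bool) : StepsTo (TM2.step M) 1 ⟨some l, a, fun k => s k⟩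
      ⟨some (target (s r).head?), (s r).head?, fun k => update s r (s r).tail k⟩ :=
  .single (by
    simp only [TM2.step, hM, TM2.stepAux, Fin.val_ofNat, Nat.mod_eq_of_lt hr, update_comp_val hr])

theorem stepsTo_pop_nil (hr : r < N)
    (hM : M l = .pop (Fin.ofNat N r) (fun _ a => a) (.goto target)) (a : Option Bool)
    {s : ℕ → List Bool} (hs : s r = []) : StepsTo (TM2.step M) 1 ⟨some l, a, fun k => s k⟩
      ⟨some (target none), none, fun k => s k⟩ := by
  have run := stepsTo_pop hr hM a s
  rwa [hs, List.tail_nil, List.head?_nil, ← hs, update_eq_self] at run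

theorem stepsTo_pop_cons (hr : r < N)
    (hM : M l = .pop (Fin.ofNat N r) (fun _ a => a) (.goto target)) (a : Option Bool)
    {s : ℕ → List Bool} {b : Bool} {t : List Bool} (hs : s r = b :: t) :
    StepsTo (TM2.step M) 1 ⟨some l, a, fun k => s k⟩
      ⟨some (target (some b)), some b, fun k => update s r t k⟩ := by
  simpa only [hs, List.head?_cons, List.tail_cons] using stepsTo_pop hr hM a s

end Pop

theorem Exec.stepsTo [NeZero N] {p : Prog} {s s' : ℕ → List Bool} {t : ℕ} (h : Exec p s s' t)
    (hp : p.bound ≤ N) {L : Type} (M : L → TM2.Stmt (fun _ : Fin N => Bool) L (Option Bool))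
    (lbl : p.Label → L) (exit : L) (hM : ∀ l, M (lbl l) = p.code (Fin.ofNat N) lbl exit l)
    (a : Option Bool) : ∃ a', StepsTo (TM2.step M) t ⟨some (lbl p.entry), a, fun k => s k⟩
      ⟨some exit, a', fun k => s' k⟩ := by
  induction h generalizing exit a with
  | skip s => exact ⟨a, .single (by rw [TM2.step, hM]; rfl)⟩
  | push r b s =>
    have hr : r < N := hp
    refine ⟨a, .single ?_⟩
    simp only [TM2.step, hM, Prog.code, TM2.stepAux, update_comp_val hr, Fin.val_ofNat,
      Nat.mod_eq_of_lt hr]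
  | seq _ _ ih ih' =>
    obtain ⟨hp, hq⟩ := max_le_iff.1 hp
    obtain ⟨b, h⟩ := ih hp (fun l => lbl (.inl l)) _ (fun l => hM (.inl l)) a
    obtain ⟨c, h'⟩ := ih' hq (fun l => lbl (.inr l)) _ (fun l => hM (.inr l)) b
    exact ⟨c, h.trans h'⟩
  | pop_nil h _ ih =>
    simp only [Prog.bound, max_le_iff] at hp
    obtain ⟨b, h'⟩ := ih hp.2.1 (fun l => lbl (.inr (.inl l))) _ (fun l => hM (.inr (.inl l))) none
    exact ⟨b, Nat.add_comm .. ▸ (stepsTo_pop_nil hp.1 (hM _) a h).trans h'⟩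
  | @pop_cons _ _ _ _ _ _ b _ h _ ih =>
    simp only [Prog.bound, max_le_iff, Finset.sup_le_iff] at hp
    obtain ⟨c, h'⟩ := ih (hp.2.2 b (Finset.mem_univ b)) (fun l => lbl (.inr (.inr ⟨b, l⟩))) _
      (fun l => hM (.inr (.inr ⟨b, l⟩))) (some b)
    exact ⟨c, Nat.add_comm .. ▸ (stepsTo_pop_cons hp.1 (hM _) a h).trans h'⟩
  | loop_nil h =>
    simp only [Prog.bound, max_le_iff] at hp
    exact ⟨none, stepsTo_pop_nil hp.1 (hM (.inl ())) a h⟩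
  | @loop_cons _ _ _ _ _ _ _ b _ h _ _ ih ih' =>
    have hp' := hp
    simp only [Prog.bound, max_le_iff, Finset.sup_le_iff] at hp'
    obtain ⟨c, h'⟩ := ih (hp'.2 b (Finset.mem_univ b)) (fun l => lbl (.inr ⟨b, l⟩)) _
      (fun l => hM (.inr ⟨b, l⟩)) (some b)
    obtain ⟨d, run⟩ := ih' hp lbl exit hM c
    exact ⟨d, Nat.add_comm .. ▸ (stepsTo_pop_cons hp'.1 (hM _) a h).trans (h'.trans run)⟩

/-- The machine executing a program, with input in register `r` and output in register `r'`. -/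
noncomputable def Prog.machine (N : ℕ) [NeZero N] (p : Prog) (r r' : ℕ) : FinTM2 where
  K := Fin N
  k₀ := Fin.ofNat N r
  k₁ := Fin.ofNat N r'
  Γ := fun _ => Bool
  Λ := Option p.Label
  main := some p.entry
  ΛFin := Fintype.ofFinite _
  σ := Option Bool
  initialState := none
  Γk₀Fin := inferInstanceAs (Fintype Bool)
  m := fun l => l.elim (.load (fun _ => none) .halt) (p.code (Fin.ofNat N) some none)

theorem Exec.stepsTo_machine [NeZero N] {p : Prog} {r r' : ℕ} (hp : p.bound ≤ N) (hr : r < N)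
    (hr' : r' < N) {l l' : List Bool} {t : ℕ}
    (h : Exec p (update (fun _ => []) r l) (update (fun _ => []) r' l') t) :
    StepsTo (p.machine N r r').step (t + 1) (initList (p.machine N r r') l)
      (haltList (p.machine N r r') l') := by
  obtain ⟨a, run⟩ := h.stepsTo hp (p.machine N r r').m some none (fun _ => rfl) none
  rw [← update_comp_val hr, ← update_comp_val hr'] at run
  exact (congrArg₂ (StepsTo _ _) (initList_eq (p.machine N r r') l)
    (haltList_eq (p.machine N r r') l')).mpr (run.trans (.single rfl))

theorem PolyTime.of_prog {μ : Str → Str} (p : Prog) (r r' : ℕ) (P : Polynomial ℕ)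
    (h : ∀ s : Str, ∃ t ≤ P.eval s.1.length,
      Exec p (update (fun _ => []) r s.1) (update (fun _ => []) r' (μ s).1) t) : PolyTime μ := by
  choose t ht h using h
  let N := max p.bound (max (r + 1) (r' + 1))
  have : NeZero N := ⟨by grind⟩
  refine ⟨⟨⟨p.machine N r r', Equiv.refl Bool, Equiv.refl Bool⟩, P + 1, fun s =>
    ⟨⟨t s + 1, ?_⟩, by simpa using ht s⟩⟩⟩
  have key := (h s).stepsTo_machine (N := N) (by grind) (by grind) (by grind)
  rw [← List.map_id s.1, ← List.map_id (μ s).1] at key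
  exact key

end Machine

end Programs

/-! ### Functions computable by polynomial-time programs -/

section Running

open Function

/-- The program `p` leads from register contents `s` to `s'` in at most `T` steps. -/
def RunsIn (p : Prog) (s s' : ℕ → List Bool) (T : ℕ) : Prop := ∃ t ≤ T, Exec p s s' t

variable {p q : Prog} {r : ℕ} {s s' s'' : ℕ → List Bool} {T T' : ℕ}

theorem RunsIn.mono (h : RunsIn p s s' T) (hT : T ≤ T') : RunsIn p s s' T' :=
  let ⟨t, ht, h⟩ := h
  ⟨t, ht.trans hT, h⟩

theorem RunsIn.seq (h : RunsIn p s s' T) (h' : RunsIn q s' s'' T') :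
    RunsIn (.seq p q) s s'' (T + T') :=
  let ⟨_, ht, h⟩ := h
  let ⟨_, ht', h'⟩ := h'
  ⟨_, Nat.add_le_add ht ht', h.seq h'⟩

theorem RunsIn.pop_nil {body : Bool → Prog} (hr : s r = []) (h : RunsIn p s s' T) :
    RunsIn (.pop r p body) s s' (T + 1) :=
  let ⟨_, ht, h⟩ := h
  ⟨_, Nat.succ_le_succ ht, .pop_nil hr h⟩

theorem RunsIn.pop_cons {body : Bool → Prog} {b : Bool} {l : List Bool} (hr : s r = b :: l)
    (h : RunsIn (body b) (update s r l) s' T) : RunsIn (.pop r p body) s s' (T + 1) :=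
  let ⟨_, ht, h⟩ := h
  ⟨_, Nat.succ_le_succ ht, .pop_cons hr h⟩

theorem RunsIn.skip : RunsIn .skip s s 1 := ⟨1, le_rfl, .skip s⟩

theorem RunsIn.push (b : Bool) : RunsIn (.push r b) s (update s r (b :: s r)) 1 :=
  ⟨1, le_rfl, .push r b s⟩

theorem RunsIn.length_le (h : RunsIn p s s' T) (r : ℕ) : (s' r).length ≤ (s r).length + T :=
  let ⟨_, ht, h⟩ := h
  (h.length_le r).trans (Nat.add_le_add_left ht _)

theorem exists_runsIn_loop {body : Bool → Prog} (I : List Bool → (ℕ → List Bool) → Prop)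
    (apply_eq : ∀ l s, I l s → s r = l)
    (step : ∀ b l s, I (b :: l) s → ∃ s', I l s' ∧ RunsIn (body b) (update s r l) s' T)
    (l : List Bool) (s : ℕ → List Bool) (h : I l s) :
    ∃ s', I [] s' ∧ RunsIn (.loop r body) s s' (l.length * (T + 1) + 1) := by
  induction l generalizing s with
  | nil => exact ⟨s, h, 1, by simp, .loop_nil (apply_eq _ _ h)⟩
  | cons b l ih =>
    obtain ⟨s', h', t, ht, run⟩ := step b l s h
    obtain ⟨s'', h'', t', ht', run'⟩ := ih s' h'
    refine ⟨s'', h'', t + t' + 1, ?_, .loop_cons (apply_eq _ _ h) run run'⟩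
    rw [List.length_cons, Nat.succ_mul]
    omega

theorem runsIn_clearRegister (r : ℕ) (s : ℕ → List Bool) :
    RunsIn (.loop r fun _ => .skip) s (update s r []) ((s r).length * 2 + 1) := by
  obtain ⟨_, rfl, run⟩ := exists_runsIn_loop (r := r) (body := fun _ => .skip) (T := 1)
    (fun l s' => s' = update s r l) (by simp)
    (by rintro b l _ rfl; exact ⟨_, rfl, by rw [update_idem]; exact .skip⟩) (s r) s (by simp)
  exact run

/-- Put a copy of the string in register `r` in front of register `r'`, using the empty register
`tmp`. -/
def Prog.copy (r tmp r' : ℕ) : Prog :=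
  .seq (.loop r fun b => .push tmp b) (.loop tmp fun b => .seq (.push r b) (.push r' b))

theorem runsIn_copy {r tmp r' : ℕ} (h : r ≠ tmp) (h' : r ≠ r') (h'' : tmp ≠ r')
    {s : ℕ → List Bool} (hs : s tmp = []) :
    RunsIn (.copy r tmp r') s (update s r' (s r ++ s r')) ((s r).length * 5 + 2) := by
  obtain ⟨_, ⟨x, hx, rfl⟩, run⟩ := exists_runsIn_loop (r := r) (body := fun b => .push tmp b)
    (T := 1)
    (fun l s' => ∃ x, l.reverse ++ x = (s r).reverse ∧ s' = update (update s r l) tmp x)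
    (by rintro l _ ⟨x, -, rfl⟩; simp [h])
    (by
      rintro b l _ ⟨x, hx, rfl⟩
      refine ⟨_, ⟨b :: x, by simpa using hx, rfl⟩, ?_⟩
      convert RunsIn.push b using 1
      grind [update_apply])
    (s r) s ⟨[], by simp, by simp [← hs]⟩
  obtain ⟨_, ⟨y, hy, rfl⟩, run'⟩ := exists_runsIn_loop (r := tmp)
    (body := fun b => .seq (.push r b) (.push r' b)) (T := 2)
    (fun l s' => ∃ y, l.reverse ++ y = s r ∧
      s' = update (update (update s r y) tmp l) r' (y ++ s r'))
    (by rintro l _ ⟨x, -, rfl⟩; simp [h''])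
    (by
      rintro b l _ ⟨y, hy, rfl⟩
      refine ⟨_, ⟨b :: y, by simpa using hy, rfl⟩, ?_⟩
      convert (RunsIn.push b).seq (RunsIn.push b) using 1
      grind [update_apply])
    x (update (update s r []) tmp x) ⟨[], by simp_all, by grind [update_apply]⟩
  obtain rfl : x = (s r).reverse := by simpa using hx
  obtain rfl : y = s r := by simpa using hy
  have restore : update (update s r (s r)) tmp [] = s := by
    rw [update_eq_self, ← hs, update_eq_self]
  rw [restore, List.length_reverse] at run'
  exact (run.seq run').mono (by omega)

variable {K : Type*} [Fintype K]

/-- Run the programs `p k` one after the other, in some order. -/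
noncomputable def Prog.forEach (p : K → Prog) : Prog :=
  (Finset.univ : Finset K).toList.foldr (fun k q => .seq (p k) q) .skip

theorem runsIn_forEach {p : K → Prog} {o : K → ℕ} (ho : Injective o) (x : K → List Bool)
    (h : ∀ k s', (∀ r, (∀ k' ≠ k, o k' ≠ r) → s' r = s r) →
      RunsIn (p k) s' (update s' (o k) (x k)) T) :
    RunsIn (.forEach p) s (extend o x s) (Fintype.card K * T + 1) := by
  suffices key : ∀ ks : List K, ks.Nodup → ∀ s', (∀ k ∉ ks, s' (o k) = x k) →
      (∀ r, (∀ k ∉ ks, o k ≠ r) → s' r = s r) →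
      RunsIn (ks.foldr (fun k q => .seq (p k) q) .skip) s' (extend o x s) (ks.length * T + 1) by
    have := key Finset.univ.toList (Finset.nodup_toList _) s (by simp) (by simp)
    rwa [Finset.length_toList, Finset.card_univ] at this
  intro ks hks
  induction ks with
  | nil =>
    intro s' hx hs
    obtain rfl : s' = extend o x s := by
      funext r
      by_cases hr : ∃ k, o k = r
      · obtain ⟨k, rfl⟩ := hr
        rw [hx k (by simp), ho.extend_apply]
      · rw [hs r (by simpa using hr), extend_apply' _ _ _ hr]
    exact RunsIn.skip.mono (by simp)
  | cons k ks ih =>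
    intro s' hx hs
    obtain ⟨_, hks⟩ := List.nodup_cons.1 hks
    refine ((h k s' fun r hr => hs r ?_).seq (ih hks _ ?_ ?_)).mono ?_
    · grind
    · grind [Injective, update_apply]
    · grind [update_apply]
    · rw [List.length_cons, Nat.succ_mul]
      omega

/-- Empty the registers `m k`. -/
noncomputable def Prog.clear (m : K → ℕ) : Prog := .forEach fun k => .loop (m k) fun _ => .skip

theorem runsIn_clear {m : K → ℕ} (hm : Injective m) {N : ℕ} (hN : ∀ k, (s (m k)).length ≤ N) :
    RunsIn (.clear m) s (extend m (fun _ => []) s) (Fintype.card K * (N * 2 + 1) + 1) := by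
  refine runsIn_forEach hm _ fun k s' hs' => (runsIn_clearRegister (m k) s').mono ?_
  have := hN k
  rw [hs' (m k) fun k' hk => hm.ne hk]
  omega

/-- An injective enumeration of registers with numbers at least `n`. -/
noncomputable def fresh (n : ℕ) (k : K) : ℕ := n + Fintype.equivFin K k

variable {n : ℕ}

theorem le_fresh (k : K) : n ≤ fresh n k := Nat.le_add_right _ _

theorem fresh_lt (k : K) : fresh n k < n + Fintype.card K :=
  Nat.add_lt_add_left (Fintype.equivFin K k).2 n

theorem fresh_injective : Injective (fresh n : K → ℕ) := fun _ _ h =>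
  (Fintype.equivFin K).injective (Fin.ext (Nat.add_left_cancel h))

end Running

section Extend

open Function

variable {ι κ A B : Type*} {m : ι → A} {o : κ → A}

theorem extend_eq_self {x : ι → B} {s : A → B} (h : ∀ k, s (m k) = x k) : extend m x s = s := by
  funext r
  by_cases hr : ∃ k, m k = r
  · rw [extend, dif_pos hr, ← h, hr.choose_spec]
  · rw [extend_apply' _ _ _ hr]

theorem extend_extend_self (hm : Injective m) (x y : ι → B) (s : A → B) :
    extend m x (extend m y s) = extend m x s := by
  funext r
  by_cases hr : ∃ k, m k = r
  · obtain ⟨k, rfl⟩ := hr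
    simp only [hm.extend_apply]
  · simp only [extend_apply' _ _ _ hr]

theorem extend_comm (hm : Injective m) (ho : Injective o) (h : ∀ k k', m k ≠ o k') (x : ι → B)
    (y : κ → B) (s : A → B) : extend m x (extend o y s) = extend o y (extend m x s) := by
  funext r
  by_cases hr : ∃ k, m k = r
  · obtain ⟨k, rfl⟩ := hr
    rw [hm.extend_apply, extend_apply' _ _ _ fun ⟨k', hk'⟩ => h k k' hk'.symm, hm.extend_apply]
  rw [extend_apply' _ _ _ hr]
  by_cases hr' : ∃ k, o k = r
  · obtain ⟨k, rfl⟩ := hr'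
    rw [ho.extend_apply, ho.extend_apply]
  · simp only [extend_apply' _ _ _ hr', extend_apply' _ _ _ hr]

theorem extend_sumElim {o : ι ⊕ κ → A} (ho : Injective o) (x : ι → B) (y : κ → B) (s : A → B) :
    extend o (Sum.elim x y) s = extend (o ∘ .inr) y (extend (o ∘ .inl) x s) := by
  have hl : Injective (o ∘ .inl) := ho.comp Sum.inl_injective
  have hr : Injective (o ∘ .inr) := ho.comp Sum.inr_injective
  funext r
  by_cases h : ∃ k, o k = r
  · obtain ⟨k | k, rfl⟩ := h
    · rw [ho.extend_apply, ← extend_comm hl hr fun _ _ h => nomatch ho h]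
      exact (hl.extend_apply ..).symm
    · rw [ho.extend_apply]
      exact (hr.extend_apply ..).symm
  · rw [extend_apply' _ _ _ h, extend_apply' (f := o ∘ .inr) _ _ _ fun ⟨k, hk⟩ => h ⟨.inr k, hk⟩,
      extend_apply' (f := o ∘ .inl) _ _ _ fun ⟨k, hk⟩ => h ⟨.inl k, hk⟩]

theorem update_extend [DecidableEq A] {r : A} (h : ∀ k, m k ≠ r) (x : ι → B) (s : A → B) (b : B) :
    update (extend m x s) r b = extend m x (update s r b) := by
  funext r'
  by_cases hr : ∃ k, m k = r'
  · rw [update_of_ne fun h' => hr.elim fun k hk => h k (hk.trans h'), extend, extend, dif_pos hr,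
      dif_pos hr]
  · rw [extend_apply' _ _ _ hr, update_apply, update_apply, extend_apply' _ _ _ hr]

end Extend

section PolyT

open Function

/-- A type whose elements `a` are stored in finitely many registers `K` with contents `enc a`. -/
class Reg (α : Type) where
  K : Type
  [fin : Fintype K]
  enc : α → K → List Bool

attribute [reducible] Reg.fin
attribute [instance] Reg.fin

instance : Reg (List Bool) where
  K := Unit
  enc l _ := l

instance : Reg Unit where
  K := Empty
  enc _ := Empty.elim

instance {α β : Type} [Reg α] [Reg β] : Reg (α × β) where
  K := Reg.K α ⊕ Reg.K β
  enc x := Sum.elim (Reg.enc x.1) (Reg.enc x.2)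

/-- The total length of the strings storing `a`. -/
def size {α : Type} [Reg α] (a : α) : ℕ := ∑ k, (Reg.enc a k).length

@[simp] theorem size_list (l : List Bool) : size l = l.length :=
  Fintype.sum_unique fun _ : Unit => l.length

@[simp] theorem size_unit (u : Unit) : size u = 0 :=
  Finset.sum_of_isEmpty (f := fun k : Empty => (Reg.enc u k).length) Finset.univ

@[simp] theorem size_prod {α β : Type} [Reg α] [Reg β] (x : α × β) :
    size x = size x.1 + size x.2 :=
  Fintype.sum_sum_type _

variable {α β γ : Type} [Reg α] [Reg β] [Reg γ]

theorem length_enc_le_size (a : α) (k : Reg.K α) : (Reg.enc a k).length ≤ size a :=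
  Finset.single_le_sum (f := fun k => (Reg.enc a k).length) (by simp) (Finset.mem_univ k)

/-- The input registers `i` and the output registers `o` are distinct and have numbers less than
`n`. -/
structure Allocated {ι κ : Type} (i : ι → ℕ) (o : κ → ℕ) (n : ℕ) : Prop where
  injective_left : Injective i
  injective_right : Injective o
  ne : ∀ k k', i k ≠ o k'
  left_lt : ∀ k, i k < n
  right_lt : ∀ k, o k < n

/-- The program `p` writes `f a` to the empty registers `o` if `a` is stored in the registers `i`
and the registers from number `n` on are empty. The polynomial `P` bounds the time it takes. -/
def Computes (p : Prog) (P : Polynomial ℕ) (f : α → β) (i : Reg.K α → ℕ) (o : Reg.K β → ℕ)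
    (n : ℕ) : Prop :=
  ∀ a s, (∀ k, s (i k) = Reg.enc a k) → (∀ k, s (o k) = []) → (∀ r, n ≤ r → s r = []) →
    RunsIn p s (extend o (Reg.enc (f a)) s) (P.eval (size a))

/-- `f` is computed by programs in polynomial time. -/
@[fun_prop]
def PolyT (f : α → β) : Prop :=
  ∀ i o n, Allocated i o n → ∃ p P, Computes p P f i o n

theorem size_le_of_runsIn {p : Prog} {o : Reg.K β → ℕ} (ho : Injective o) {s : ℕ → List Bool}
    {b : β} {T : ℕ} (hs : ∀ k, s (o k) = []) (h : RunsIn p s (extend o (Reg.enc b) s) T) :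
    size b ≤ Fintype.card (Reg.K β) * T := by
  refine (Finset.sum_le_card_nsmul _ _ T fun k _ => ?_).trans_eq (smul_eq_mul ..)
  simpa only [ho.extend_apply, hs, List.length_nil, zero_add] using h.length_le (o k)

section Fresh

variable {ι κ : Type} {i : ι → ℕ} {o : κ → ℕ} {n : ℕ}

theorem Allocated.fresh_right [Fintype κ] (hi : Injective i) (hn : ∀ k, i k < n) :
    Allocated i (fresh n : κ → ℕ) (n + Fintype.card κ) where
  injective_left := hi
  injective_right := fresh_injective
  ne k k' := ((hn k).trans_le (le_fresh k')).ne
  left_lt k := (hn k).trans_le (Nat.le_add_right ..)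
  right_lt := fresh_lt

theorem Allocated.symm (h : Allocated i o n) : Allocated o i n :=
  ⟨h.2, h.1, fun k k' => (h.ne k' k).symm, h.5, h.4⟩

theorem Allocated.comp {ι' κ' : Type} {f : ι' → ι} {g : κ' → κ} (h : Allocated i o n)
    (hf : Injective f) (hg : Injective g) : Allocated (i ∘ f) (o ∘ g) n :=
  ⟨h.1.comp hf, h.2.comp hg, fun _ _ => h.ne _ _, fun _ => h.left_lt _, fun _ => h.right_lt _⟩

theorem extend_fresh_of_lt [Fintype κ] {r : ℕ} (hr : r < n) (x : κ → List Bool)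
    (s : ℕ → List Bool) : extend (fresh n) x s r = s r :=
  extend_apply' _ _ _ fun ⟨k, hk⟩ => (hk ▸ hr).not_ge (le_fresh k)

theorem extend_fresh_of_le [Fintype κ] {r : ℕ} (hr : n + Fintype.card κ ≤ r) (x : κ → List Bool)
    (s : ℕ → List Bool) : extend (fresh n) x s r = s r :=
  extend_apply' _ _ _ fun ⟨k, hk⟩ => (hk ▸ fresh_lt k).not_ge hr

end Fresh

theorem PolyT.exists_size_le {f : α → β} (hf : PolyT f) :
    ∃ P : Polynomial ℕ, ∀ a, size (f a) ≤ P.eval (size a) := by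
  let i : Reg.K α → ℕ := fresh 0
  have hio : Allocated i (fresh (Fintype.card (Reg.K α)) : Reg.K β → ℕ) _ :=
    .fresh_right fresh_injective fun k => by simpa using fresh_lt (n := 0) k
  obtain ⟨p, P, h⟩ := hf _ _ _ hio
  refine ⟨Polynomial.C (Fintype.card (Reg.K β)) * P, fun a => ?_⟩
  have unset : ∀ r, (∀ k, i k ≠ r) → extend i (Reg.enc a) (fun _ => []) r = [] := fun r hr =>
    extend_apply' _ _ _ (by simpa using hr)
  simpa using size_le_of_runsIn hio.2 (fun k => unset _ fun k' => hio.ne k' k)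
    (h a (extend i (Reg.enc a) fun _ => []) (hio.1.extend_apply _ _)
      (fun k => unset _ fun k' => hio.ne k' k)
      fun r hr => unset _ fun k' => ((hio.left_lt k').trans_le hr).ne)

theorem PolyT.comp {f : α → β} {g : β → γ} (hg : PolyT g) (hf : PolyT f) :
    PolyT fun a => g (f a) := by
  intro i o n h
  let m : Reg.K β → ℕ := fresh n
  have him : Allocated i m _ := .fresh_right h.1 h.4
  have hom : Allocated o m _ := .fresh_right h.2 h.5
  obtain ⟨Q, hQ⟩ := hf.exists_size_le
  obtain ⟨p, P, hp⟩ := hf i m _ him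
  obtain ⟨q, R, hq⟩ := hg m o _ hom.symm
  refine ⟨.seq p (.seq q (.clear m)), P + (R.comp Q +
    (Polynomial.C (Fintype.card (Reg.K β)) * (Q * 2 + 1) + 1)), fun a s hi ho hn => ?_⟩
  have hm : ∀ k, s (m k) = [] := fun k => hn _ (le_fresh k)
  have run_p := hp a s hi hm fun r hr => hn r ((Nat.le_add_right ..).trans hr)
  have run_q := hq (f a) (extend m (Reg.enc (f a)) s) (hom.2.extend_apply _ _)
    (fun k => by rw [extend_fresh_of_lt (h.5 k), ho])
    fun r hr => by rw [extend_fresh_of_le hr, hn r ((Nat.le_add_right ..).trans hr)]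
  have run_clear := runsIn_clear hom.2 (N := Q.eval (size a))
    (s := extend o (Reg.enc (g (f a))) (extend m (Reg.enc (f a)) s)) fun k => by
      rw [extend_comm hom.1 hom.2 hom.ne, hom.2.extend_apply]
      exact (length_enc_le_size _ k).trans (hQ a)
  rw [extend_comm hom.2 hom.1 hom.symm.ne, extend_extend_self hom.2, extend_eq_self hm] at run_clear
  refine (run_p.seq (run_q.seq run_clear)).mono ?_
  have := polynomial_eval_monotone R (hQ a)
  simpa using this

theorem PolyT.of_regs {f : α → β} (φ : Reg.K β → Reg.K α)
    (h : ∀ a k, Reg.enc (f a) k = Reg.enc a (φ k)) : PolyT f := by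
  intro i o n hio
  refine ⟨.forEach fun k => .copy (i (φ k)) n (o k),
    Polynomial.C (Fintype.card (Reg.K β)) * (Polynomial.X * 5 + 2) + 1, fun a s hi ho hn => ?_⟩
  refine (runsIn_forEach hio.2 _ (T := size a * 5 + 2) fun k s' hs' => ?_).mono (by simp)
  have hin : s' (i (φ k)) = Reg.enc (f a) k := by
    rw [hs' _ fun k' _ => (hio.ne _ k').symm, hi, h]
  have hout : s' (o k) = [] := by rw [hs' _ fun k' hk => hio.2.ne hk, ho]
  have htmp : s' n = [] := by rw [hs' _ fun k' _ => (hio.5 k').ne, hn n le_rfl]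
  have run := runsIn_copy (hio.4 (φ k)).ne (hio.ne (φ k) k) (hio.5 k).ne' htmp
  rw [hin, hout, List.append_nil, h] at run
  rw [h]
  exact run.mono (by have := length_enc_le_size a (φ k); omega)

@[fun_prop]
theorem PolyT.id' : PolyT fun a : α => a := .of_regs id fun _ _ => rfl

@[fun_prop]
theorem PolyT.fst {f : α → β × γ} (hf : PolyT f) : PolyT fun a => (f a).1 :=
  comp (.of_regs Sum.inl fun _ _ => rfl) hf

@[fun_prop]
theorem PolyT.snd {f : α → β × γ} (hf : PolyT f) : PolyT fun a => (f a).2 :=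
  comp (.of_regs Sum.inr fun _ _ => rfl) hf

theorem PolyT.unit (f : α → Unit) : PolyT f := .of_regs Empty.elim fun _ k => k.elim

theorem PolyT.nil : PolyT fun _ : α => ([] : List Bool) := fun _ _ _ _ =>
  ⟨.skip, 1, fun _ _ _ ho _ => by
    have := extend_eq_self (x := Reg.enc ([] : List Bool)) ho
    rw [this]
    exact RunsIn.skip.mono (by simp)⟩

@[fun_prop]
theorem PolyT.pair {f : α → β} {g : α → γ} (hf : PolyT f) (hg : PolyT g) :
    PolyT fun a => (f a, g a) := by
  intro i o n h
  have hl := h.comp injective_id Sum.inl_injective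
  have hr := h.comp injective_id Sum.inr_injective
  obtain ⟨p, P, hp⟩ := hf _ _ _ hl
  obtain ⟨q, Q, hq⟩ := hg _ _ _ hr
  refine ⟨.seq p q, P + Q, fun a s hi ho hn => ?_⟩
  have unchanged : ∀ r, (∀ k, o (.inl k) ≠ r) →
      extend (o ∘ .inl) (Reg.enc (f a)) s r = s r := fun r hr =>
    extend_apply' _ _ _ (by simpa using hr)
  have run_q := hq a (extend (o ∘ .inl) (Reg.enc (f a)) s)
    (fun k => (unchanged _ fun _ => (h.ne _ _).symm).trans (hi k))
    (fun k => (unchanged _ fun _ => h.2.ne (by simp)).trans (ho _))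
    fun r hr => (unchanged _ fun _ => ((h.5 _).trans_le hr).ne).trans (hn r hr)
  have run := (hp a s hi (fun k => ho _) hn).seq run_q
  rw [← extend_sumElim h.2] at run
  exact run.mono (by simp)

@[fun_prop]
theorem PolyT.cons {f : α → List Bool} (b : Bool) (hf : PolyT f) : PolyT fun a => b :: f a := by
  intro i o n h
  obtain ⟨p, P, hp⟩ := hf i o n h
  refine ⟨.seq p (.push (o ()) b), P + 1, fun a s hi ho hn => ?_⟩
  have run := (hp a s hi ho hn).seq (.push (r := o ()) b)
  rw [h.2.extend_apply] at run
  convert run using 1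
  · funext r
    by_cases hr : r = o ()
    · subst hr
      rw [h.2.extend_apply, update_self]
      rfl
    · rw [update_of_ne hr, extend_apply' _ _ _ fun ⟨_, hk⟩ => hr hk.symm,
        extend_apply' _ _ _ fun ⟨_, hk⟩ => hr hk.symm]
  · simp

theorem PolyT.const_list (l : List Bool) : PolyT fun _ : α => l := by
  induction l with
  | nil => exact .nil
  | cons b l ih => exact .cons b ih

/-- Branch on the first bit of a list. -/
def bcase {β : Type} (l : List Bool) (n : β) (t f : List Bool → β) : β :=
  match l with
  | [] => n
  | true :: l => t l
  | false :: l => f l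

@[simp] theorem bcase_nil {τ : Type} (n : τ) (t f : List Bool → τ) : bcase [] n t f = n := rfl

@[simp] theorem bcase_true {τ : Type} (l : List Bool) (n : τ) (t f : List Bool → τ) :
    bcase (true :: l) n t f = t l := rfl

@[simp] theorem bcase_false {τ : Type} (l : List Bool) (n : τ) (t f : List Bool → τ) :
    bcase (false :: l) n t f = f l := rfl

theorem Computes.runsIn_popped {p : Prog} {P : Polynomial ℕ} {f : α × List Bool → β}
    {i : Reg.K (α × List Bool) → ℕ} {o : Reg.K β → ℕ} {n : ℕ} (h : Computes p P f i o n)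
    (hio : Allocated i o n) {a : α} {b : Bool} {l : List Bool} {s : ℕ → List Bool}
    (hi : ∀ k, s (i k) = Reg.enc (a, b :: l) k) (ho : ∀ k, s (o k) = [])
    (hn : ∀ r, n ≤ r → s r = []) :
    RunsIn (.seq p (.push (i (.inr ())) b)) (update s (i (.inr ())) l)
      (extend o (Reg.enc (f (a, l))) s) (P.eval (size (a, b :: l)) + 1) := by
  have run := h (a, l) (update s (i (.inr ())) l)
    (by
      rintro (k | ⟨⟩)
      · exact (update_of_ne (hio.1.ne Sum.inl_ne_inr) ..).trans (hi _)
      · exact update_self ..)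
    (fun k => (update_of_ne (hio.ne _ k).symm ..).trans (ho k))
    fun r hr => (update_of_ne ((hio.4 _).trans_le hr).ne' ..).trans (hn r hr)
  have unpop : ∀ x, update (extend o x (update s (i (.inr ())) l)) (i (.inr ())) (b :: l) =
      extend o x s := fun x => by
    rw [update_extend fun k => (hio.ne _ k).symm, update_idem,
      ← show s (i (.inr ())) = b :: l from hi _, update_eq_self]
  have push := RunsIn.push (r := i (.inr ()))
    (s := extend o (Reg.enc (f (a, l))) (update s (i (.inr ())) l)) b
  rw [extend_apply' _ _ _ fun ⟨k, hk⟩ => hio.ne _ k hk.symm, update_self, unpop] at push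
  exact (run.seq push).mono (Nat.add_le_add_right (polynomial_eval_monotone P (by simp)) 1)

theorem polyT_bcase_snd {n : α → β} {t f : α × List Bool → β} (hn : PolyT n) (ht : PolyT t)
    (hf : PolyT f) : PolyT fun x : α × List Bool =>
      bcase x.2 (n x.1) (fun l => t (x.1, l)) (fun l => f (x.1, l)) := by
  intro i o m h
  obtain ⟨p, P, hp⟩ := hn _ _ _ (h.comp Sum.inl_injective injective_id)
  obtain ⟨q, Q, hq⟩ := ht _ _ _ h
  obtain ⟨r, R, hr⟩ := hf _ _ _ h
  refine ⟨.pop (i (.inr ())) p fun b => .seq (bif b then q else r) (.push (i (.inr ())) b),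
    P + Q + R + 2, ?_⟩
  rintro ⟨a, _ | ⟨_ | _, l⟩⟩ s hi ho hm
  · refine ((hp a s (fun k => hi (.inl k)) ho hm).pop_nil (hi (.inr ()))).mono ?_
    simp; omega
  · refine ((hr.runsIn_popped h hi ho hm).pop_cons (hi (.inr ()))).mono ?_
    simp; omega
  · refine ((hq.runsIn_popped h hi ho hm).pop_cons (hi (.inr ()))).mono ?_
    simp; omega

theorem polyT_bcase {l : α → List Bool} {n : α → β} {t f : α → List Bool → β} (hl : PolyT l)
    (hn : PolyT n) (ht : PolyT fun x : α × List Bool => t x.1 x.2)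
    (hf : PolyT fun x : α × List Bool => f x.1 x.2) :
    PolyT fun a => bcase (l a) (n a) (t a) (f a) :=
  (polyT_bcase_snd hn ht hf).comp (PolyT.id'.pair hl)

/-- The program `p` replaces `a` by `f a` in the registers `o` if the registers from number `n` on
are empty. The polynomial `P` bounds the time it takes. -/
def Updates (p : Prog) (P : Polynomial ℕ) (f : α → α) (o : Reg.K α → ℕ) (n : ℕ) : Prop :=
  ∀ a s, (∀ k, s (o k) = Reg.enc a k) → (∀ r, n ≤ r → s r = []) →
    RunsIn p s (extend o (Reg.enc (f a)) s) (P.eval (size a))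

theorem PolyT.exists_updates {f : α → α} (hf : PolyT f) {o : Reg.K α → ℕ} (ho : Injective o)
    {n : ℕ} (hn : ∀ k, o k < n) : ∃ p P, Updates p P f o n := by
  let m : Reg.K α → ℕ := fresh n
  have hom : Allocated o m _ := .fresh_right ho hn
  obtain ⟨Q, hQ⟩ := hf.exists_size_le
  obtain ⟨p, P, hp⟩ := hf o m _ hom
  obtain ⟨q, R, hq⟩ := PolyT.id' m o _ hom.symm
  let C : Polynomial ℕ := Polynomial.C (Fintype.card (Reg.K α))
  refine ⟨.seq p (.seq (.clear o) (.seq q (.clear m))), P + ((C * (Polynomial.X * 2 + 1) + 1) +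
    (R.comp Q + (C * (Q * 2 + 1) + 1))), fun a s hs hr => ?_⟩
  have hm : ∀ k, s (m k) = [] := fun k => hr _ (le_fresh k)
  have hr' : ∀ r, n + Fintype.card (Reg.K α) ≤ r → s r = [] := fun r h =>
    hr r ((Nat.le_add_right ..).trans h)
  have run_p := hp a s hs hm hr'
  have clear_o := runsIn_clear ho (N := size a) (s := extend m (Reg.enc (f a)) s) fun k => by
    rw [extend_fresh_of_lt (hn k), hs]
    exact length_enc_le_size a k
  have run_q := hq (f a) (extend o (fun _ => []) (extend m (Reg.enc (f a)) s))
    (fun k => by rw [extend_comm ho hom.2 hom.ne, hom.2.extend_apply]) (ho.extend_apply _ _)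
    fun r h => by
      rw [extend_apply' _ _ _ fun ⟨k, hk⟩ => (hom.4 k).not_ge (hk ▸ h), extend_fresh_of_le h,
        hr' r h]
  rw [extend_extend_self ho] at run_q
  have clear_m := runsIn_clear hom.2 (N := Q.eval (size a))
    (s := extend o (Reg.enc (f a)) (extend m (Reg.enc (f a)) s)) fun k => by
      rw [extend_comm ho hom.2 hom.ne, hom.2.extend_apply]
      exact (length_enc_le_size _ k).trans (hQ a)
  rw [extend_comm hom.2 ho hom.symm.ne, extend_extend_self hom.2, extend_eq_self hm] at clear_m
  refine (run_p.seq (clear_o.seq (run_q.seq clear_m))).mono ?_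
  have := polynomial_eval_monotone R (hQ a)
  simpa [C] using this

theorem Updates.runsIn_loop {p : Prog} {P : Polynomial ℕ} {f : α → α} {o : Reg.K α → ℕ} {n : ℕ}
    (hp : Updates p P f o (n + 1)) (ho : Injective o) (hon : ∀ k, o k < n) {a : α}
    {c : List Bool} {N : ℕ} (hN : ∀ k ≤ c.length, size (f^[k] a) ≤ N) {s : ℕ → List Bool}
    (hn : ∀ r, n ≤ r → s r = []) :
    RunsIn (.loop n fun _ => p) (update (extend o (Reg.enc a) s) n c)
      (extend o (Reg.enc (f^[c.length] a)) s) (c.length * (P.eval N + 1) + 1) := by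
  have hne : ∀ k, o k ≠ n := fun k => (hon k).ne
  obtain ⟨_, ⟨k, hk, rfl⟩, loop⟩ := exists_runsIn_loop (r := n) (body := fun _ => p)
    (T := P.eval N)
    (fun l s' => ∃ k, k + l.length = c.length ∧ s' = update (extend o (Reg.enc (f^[k] a)) s) n l)
    (by rintro l _ ⟨k, -, rfl⟩; exact update_self ..)
    (by
      rintro b l _ ⟨k, hk, rfl⟩
      refine ⟨_, ⟨k + 1, by rw [← hk, List.length_cons]; omega, rfl⟩, ?_⟩
      rw [update_idem, iterate_succ_apply', update_extend hne, update_extend hne]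
      have run := hp (f^[k] a) (extend o (Reg.enc (f^[k] a)) (update s n l)) (ho.extend_apply _ _)
        fun r hr => by
          rw [extend_apply' _ _ _ fun ⟨k, hk⟩ => by have := hon k; omega,
            update_of_ne (by omega), hn r (by omega)]
      rw [extend_extend_self ho] at run
      exact run.mono (polynomial_eval_monotone P (hN k (hk ▸ Nat.le_add_right ..))))
    c (update (extend o (Reg.enc a) s) n c) ⟨0, by simp, rfl⟩
  obtain rfl : k = c.length := hk
  rwa [update_extend hne _ _ [], ← hn n le_rfl, update_eq_self] at loop

theorem PolyT.iterate_snd {f : α → α} (hf : PolyT f) (Q : Polynomial ℕ)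
    (hQ : ∀ k a, size (f^[k] a) ≤ Q.eval (k + size a)) :
    PolyT fun x : List Bool × α => f^[x.1.length] x.2 := by
  intro i o n h
  obtain ⟨q, R, hq⟩ := PolyT.id' _ _ _ (h.comp Sum.inr_injective injective_id)
  obtain ⟨p, P, hp⟩ := hf.exists_updates h.2 fun k => (h.5 k).trans n.lt_succ_self
  refine ⟨.seq q (.seq (.copy (i (.inl ())) (n + 1) n) (.loop n fun _ => p)),
    R + ((Polynomial.X * 5 + 2) + (Polynomial.X * (P.comp Q + 1) + 1)), ?_⟩
  rintro ⟨c, a⟩ s hi hs hn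
  have unused : ∀ x r, n ≤ r → extend o x s r = [] := fun x r hr =>
    (extend_apply' _ _ _ fun ⟨k, hk⟩ => (h.5 k).not_ge (hk ▸ hr)).trans (hn r hr)
  have init := hq a s (fun k => hi (.inr k)) hs hn
  have copy := runsIn_copy ((h.4 (.inl ())).trans n.lt_succ_self).ne (h.4 (.inl ())).ne
    n.succ_ne_self (unused (Reg.enc a) (n + 1) n.le_succ)
  rw [extend_apply' _ _ _ fun ⟨k, hk⟩ => h.ne _ k hk.symm, show s (i (.inl ())) = c from hi _,
    unused _ n le_rfl, List.append_nil] at copy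
  have loop := hp.runsIn_loop h.2 h.5 (a := a) (c := c) (N := Q.eval (size (c, a)))
    (fun k hk => (hQ k a).trans (polynomial_eval_monotone Q (by simpa using hk))) hn
  refine (init.seq (copy.seq loop)).mono ?_
  have h1 : c.length ≤ size (c, a) := by simp
  have h2 := polynomial_eval_monotone R (show size a ≤ size (c, a) by simp)
  have h3 := Nat.mul_le_mul_right (P.eval (Q.eval (size (c, a))) + 1) h1
  simp only [Polynomial.eval_add, Polynomial.eval_mul, Polynomial.eval_comp, Polynomial.eval_X,
    Polynomial.eval_one, Polynomial.eval_ofNat] at h2 h3 ⊢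
  omega

/-- The growth has to be bounded in terms of a nonincreasing `M`: the iterates of a function which
doubles its argument are exponentially long. -/
theorem PolyT.iterate {f : α → α} (hf : PolyT f) (M : α → ℕ) (R : Polynomial ℕ)
    (hM : ∀ a, M a ≤ size a) (hM' : ∀ a, M (f a) ≤ M a)
    (hR : ∀ a, size (f a) ≤ size a + R.eval (M a)) {n : β → List Bool} {g : β → α}
    (hn : PolyT n) (hg : PolyT g) : PolyT fun b => f^[(n b).length] (g b) := by
  refine (PolyT.iterate_snd hf (Polynomial.X + Polynomial.X * R) fun i a => ?_).comp
    (hn.pair hg)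
  have h : ∀ i a, size (f^[i] a) ≤ size a + i * R.eval (M a) := by
    intro i
    induction i with
    | zero => simp
    | succ i ih =>
      intro a
      rw [iterate_succ_apply, Nat.succ_mul]
      have h1 := hR a
      have h2 : i * R.eval (M (f a)) ≤ i * R.eval (M a) :=
        Nat.mul_le_mul_left i (polynomial_eval_monotone R (hM' a))
      exact (ih (f a)).trans (by omega)
  have hR' : R.eval (M a) ≤ R.eval (i + size a) :=
    polynomial_eval_monotone R ((hM a).trans (Nat.le_add_left _ i))
  simpa using (h i a).trans
    (add_le_add (Nat.le_add_left _ i) (Nat.mul_le_mul (Nat.le_add_right i (size a)) hR'))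

theorem PolyT.polyTime {f : List Bool → List Bool} (hf : PolyT f) (μ : Str → Str)
    (h : ∀ s, (μ s).1 = f s.1) : PolyTime μ := by
  have hio : Allocated (fun _ : Unit => 0) (fun _ : Unit => 1) 2 :=
    ⟨injective_of_subsingleton _, injective_of_subsingleton _, by simp, by simp, by simp⟩
  obtain ⟨p, P, hp⟩ := hf _ _ _ hio
  refine PolyTime.of_prog (.seq p (.loop 0 fun _ => .skip)) 0 1 (P + (Polynomial.X * 2 + 1))
    fun s => ?_
  have run := hp s.1 (update (fun _ => []) 0 s.1) (fun _ => rfl) (fun _ => rfl)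
    fun r hr => update_of_ne (by omega) ..
  have clear := runsIn_clearRegister 0
    (extend (fun _ : Unit => 1) (Reg.enc (f s.1)) (update (fun _ => []) 0 s.1))
  rw [extend_apply' _ _ _ (by simp), update_self, update_extend (by simp), update_idem] at clear
  obtain ⟨t, ht, exec⟩ := run.seq clear
  refine ⟨t, by simpa using ht, ?_⟩
  convert exec using 1
  funext r
  by_cases hr : r = 1
  · subst hr
    rw [hio.2.extend_apply (a := ()), update_self, h]
    rfl
  · rw [update_of_ne hr, extend_apply' _ _ _ fun ⟨_, hk⟩ => hr hk.symm]
    simp [update_apply]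

end PolyT

/-! ### Recursion along strings -/

section Strings

open Function

/-- Primitive recursion along a string, with accumulator `s` and parameter `p`. -/
def listRec {P S : Type} (g : Bool → P → List Bool → S → S) (p : P) : List Bool → S → S
  | [], s => s
  | b :: l, s => listRec g p l (g b p l s)

/-- One step of the recursion along a string. -/
def listRecStep {P S : Type} (g : Bool → P → List Bool → S → S) (x : P × List Bool × S) :
    P × List Bool × S :=
  bcase x.2.1 x (fun l => (x.1, l, g true x.1 l x.2.2)) (fun l => (x.1, l, g false x.1 l x.2.2))

theorem listRecStep_cons {P S : Type} (g : Bool → P → List Bool → S → S) (p : P) (b : Bool)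
    (l : List Bool) (s : S) : listRecStep g (p, b :: l, s) = (p, l, g b p l s) := by
  cases b <;> rfl

theorem listRecStep_iterate {P S : Type} (g : Bool → P → List Bool → S → S) (p : P)
    (l : List Bool) (s : S) :
    (listRecStep g)^[l.length] (p, l, s) = (p, [], listRec g p l s) := by
  induction l generalizing s with
  | nil => rfl
  | cons b l ih =>
    rw [List.length_cons, iterate_succ_apply, listRecStep_cons, ih]
    rfl

variable {α P S : Type} [Reg α] [Reg P] [Reg S]

theorem polyT_listRecStep {g : Bool → P → List Bool → S → S}
    (hg : ∀ b, PolyT fun x : P × List Bool × S => g b x.1 x.2.1 x.2.2) :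
    PolyT (listRecStep g) := by
  have h : ∀ b, PolyT fun y : (P × List Bool × S) × List Bool =>
      (y.1.1, y.2, g b y.1.1 y.2 y.1.2.2) := fun b =>
    .pair (by fun_prop) (.pair (by fun_prop)
      ((hg b).comp (f := fun y : (P × List Bool × S) × List Bool => (y.1.1, y.2, y.1.2.2))
        (by fun_prop)))
  exact polyT_bcase (by fun_prop) (by fun_prop) (h true) (h false)

theorem polyT_listRec {g : Bool → P → List Bool → S → S}
    (hg : ∀ b, PolyT fun x : P × List Bool × S => g b x.1 x.2.1 x.2.2) (R : Polynomial ℕ)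
    (hR : ∀ b p l s, size (g b p l s) ≤ size s + R.eval (size p + l.length))
    {p : α → P} {l : α → List Bool} {s : α → S} (hp : PolyT p) (hl : PolyT l) (hs : PolyT s) :
    PolyT fun a => listRec g (p a) (l a) (s a) := by
  have key : PolyT fun a => (listRecStep g)^[(l a).length] (p a, l a, s a) := by
    refine (polyT_listRecStep hg).iterate (fun x => size x.1 + x.2.1.length) R ?_ ?_ ?_ hl
      (hp.pair (hl.pair hs))
    · rintro ⟨p, l, s⟩
      simp
    · rintro ⟨p, _ | ⟨b, l⟩, s⟩
      · rfl
      · simp [listRecStep_cons]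
    · rintro ⟨p, _ | ⟨b, l⟩, s⟩
      · simp [listRecStep]
      · have h1 := hR b p l s
        have h2 : R.eval (size p + l.length) ≤ R.eval (size p + (l.length + 1)) :=
          polynomial_eval_monotone R (by simp)
        simp only [listRecStep_cons, size_prod, size_list, List.length_cons]
        omega
  simpa only [listRecStep_iterate] using key.snd.snd

theorem listRec_cons (l s : List Bool) :
    listRec (fun b (_ : Unit) _ s => b :: s) () l s = l.reverse ++ s := by
  induction l generalizing s with
  | nil => rfl
  | cons b l ih => simp [listRec, ih]

theorem PolyT.reverse_append {f g : α → List Bool} (hf : PolyT f) (hg : PolyT g) :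
    PolyT fun a => (f a).reverse ++ g a := by
  simpa only [listRec_cons] using polyT_listRec (g := fun b (_ : Unit) _ (s : List Bool) => b :: s)
    (fun b => by fun_prop) 1 (by simp)
    (p := fun _ => ()) (.unit _) hf hg

@[fun_prop]
theorem PolyT.append {f g : α → List Bool} (hf : PolyT f) (hg : PolyT g) :
    PolyT fun a => f a ++ g a := by
  have hf' : PolyT fun a => (f a).reverse := by simpa using hf.reverse_append .nil
  simpa using hf'.reverse_append hg

/-- The unary representation of the length of a string. -/
def ones (l : List Bool) : List Bool := List.replicate l.length true

@[fun_prop]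
theorem polyT_ones {f : α → List Bool} (hf : PolyT f) : PolyT fun a => ones (f a) := by
  have h : ∀ n, (true :: ·)^[n] [] = List.replicate n true := fun n => by
    induction n with
    | zero => rfl
    | succ n ih => rw [iterate_succ_apply', ih, List.replicate_succ]
  simpa only [h, ones] using PolyT.iterate (f := (true :: ·)) (by fun_prop) (fun _ => 0) 1
    (by simp) (by simp) (by simp) hf .nil

@[fun_prop]
theorem PolyT.tail {f : α → List Bool} (hf : PolyT f) : PolyT fun a => (f a).tail := by
  have h : ∀ l : List Bool, bcase l [] (fun t => t) (fun t => t) = l.tail := by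
    rintro (_ | ⟨_ | _, l⟩) <;> rfl
  simpa only [h] using polyT_bcase (t := fun _ t => t) (f := fun _ t => t) hf .nil
    (by fun_prop) (by fun_prop)

@[fun_prop]
theorem PolyT.drop {f g : α → List Bool} (hf : PolyT f) (hg : PolyT g) :
    PolyT fun a => (g a).drop (f a).length := by
  have h : ∀ n (l : List Bool), List.tail^[n] l = l.drop n := fun n => by
    induction n with
    | zero => exact fun _ => rfl
    | succ n ih => intro l; rw [iterate_succ_apply, ih, List.drop_tail]
  simpa only [h] using PolyT.iterate (f := List.tail) (by fun_prop) (fun _ => 0) 0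
    (by simp) (by simp) (by simp) hf hg

/-- A string without its longest prefix consisting of ones. -/
def dropOnes (l : List Bool) : List Bool := l.dropWhile id

/-- The longest prefix consisting of ones. -/
def takeOnes (l : List Bool) : List Bool := l.takeWhile id

@[fun_prop]
theorem polyT_dropOnes {f : α → List Bool} (hf : PolyT f) : PolyT fun a => dropOnes (f a) := by
  have hstep : PolyT fun l : List Bool => bcase l [] (fun t => t) (fun _ => l) :=
    polyT_bcase (by fun_prop) .nil (by fun_prop) (by fun_prop)
  have h : ∀ (n : ℕ) (l : List Bool), l.length ≤ n →
      (fun l : List Bool => bcase l [] (fun t => t) (fun _ => l))^[n] l = dropOnes l := by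
    intro n
    induction n with
    | zero => intro l hl; simp_all [dropOnes]
    | succ n ih =>
      intro l hl
      rw [iterate_succ_apply]
      rcases l with _ | ⟨_ | _, l⟩
      · exact ih [] (by simp)
      · exact iterate_fixed rfl n
      · exact ih l (by simpa using hl)
  simpa only [h _ _ le_rfl] using hstep.iterate (fun _ => 0) 0 (by simp) (by simp)
    (by rintro (_ | ⟨_ | _, l⟩) <;> simp) hf hf

theorem takeOnes_append_dropOnes (l : List Bool) : takeOnes l ++ dropOnes l = l :=
  List.takeWhile_append_dropWhile

theorem takeOnes_eq_replicate (l : List Bool) :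
    takeOnes l = List.replicate (takeOnes l).length true :=
  List.eq_replicate_of_mem fun _ h => List.mem_takeWhile_imp h

theorem drop_takeOnes (l : List Bool) (i : ℕ) :
    (takeOnes l).drop i = List.replicate ((takeOnes l).length - i) true := by
  conv_lhs => rw [takeOnes_eq_replicate, List.drop_replicate]

@[fun_prop]
theorem polyT_takeOnes {f : α → List Bool} (hf : PolyT f) : PolyT fun a => takeOnes (f a) := by
  have h : ∀ l, (ones l).drop (dropOnes l).length = takeOnes l := fun l => by
    have := congrArg List.length (takeOnes_append_dropOnes l)
    rw [List.length_append] at this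
    rw [ones, List.drop_replicate, takeOnes_eq_replicate]
    congr 1
    omega
  simp only [← h]
  fun_prop

@[simp] theorem takeOnes_unary (n : ℕ) (l : List Bool) :
    takeOnes (List.replicate n true ++ false :: l) = List.replicate n true := by
  simp [takeOnes]

@[simp] theorem dropOnes_unary (n : ℕ) (l : List Bool) :
    dropOnes (List.replicate n true ++ false :: l) = false :: l := by
  simp [dropOnes]

theorem dropOnes_eq_nil_or (l : List Bool) : dropOnes l = [] ∨ ∃ r, dropOnes l = false :: r ∧
    l = List.replicate (takeOnes l).length true ++ false :: r := by
  rcases e : dropOnes l with _ | ⟨b, r⟩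
  · exact .inl rfl
  · have hb : b = false := by
      simpa [show l.dropWhile id = _ from e] using
        List.head_dropWhile_not id (l := l) (by rw [show l.dropWhile id = _ from e]; simp)
    subst hb
    refine .inr ⟨r, rfl, ?_⟩
    rw [← takeOnes_eq_replicate, ← e, takeOnes_append_dropOnes]

end Strings

/-! ### Reading the Polish notation symbol by symbol -/

/-- The symbols of the Polish notation; `bin true` is `∨` and `bin false` is `∧`. -/
inductive Token : Type
  | neg : Token
  | bin (b : Bool) : Token
  | var (j i : ℕ) : Token

/-- The code of a symbol. -/
def Token.encode : Token → List Bool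
  | neg => [false, false]
  | bin b => [false, true, b]
  | var j i => true :: (List.replicate j true ++ false :: (List.replicate i true ++ [false]))

theorem Token.length_encode_pos : ∀ t : Token, 0 < t.encode.length
  | neg | bin _ | var _ _ => Nat.succ_pos _

/-- Strings which do not begin with a symbol. -/
def Malformed (l : List Bool) : Prop := ∀ t : Token, ∀ r, l ≠ t.encode ++ r

@[elab_as_elim]
theorem tokenInduction {motive : List Bool → Prop} (nil : motive [])
    (token : ∀ t l, motive l → motive (Token.encode t ++ l))
    (malformed : ∀ l, l ≠ [] → Malformed l → motive l) (l : List Bool) : motive l := by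
  induction hn : l.length using Nat.strong_induction_on generalizing l with
  | _ n ih =>
    by_cases hl : l = []
    · exact hl ▸ nil
    by_cases h : Malformed l
    · exact malformed l hl h
    simp only [Malformed, not_forall, not_not] at h
    obtain ⟨t, r, rfl⟩ := h
    refine token t r (ih _ ?_ r rfl)
    have := t.length_encode_pos
    rw [← hn, List.length_append]
    omega

/-- The actions on an accumulator in `S`, with parameter in `P`, for the symbols of the
Polish notation, where the indices of a variable are given in unary, and for a malformed string. -/
structure TokenActions (P S : Type) where
  neg : P → S → S
  bin : Bool → P → S → S
  var : P → List Bool → List Bool → S → S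
  bad : P → S → S

namespace TokenActions

open Function

section Run

variable {P S : Type} (A : TokenActions P S)

/-- The action for a symbol. -/
def act : Token → P → S → S
  | .neg => A.neg
  | .bin b => A.bin b
  | .var j i => fun p => A.var p (List.replicate j true) (List.replicate i true)

/-- Read one symbol. -/
def step (x : P × List Bool × S) : P × List Bool × S :=
  bcase x.2.1 x
    (fun l => bcase (dropOnes l) (x.1, [], A.bad x.1 x.2.2)
      (fun _ => (x.1, [], A.bad x.1 x.2.2))
      (fun r => bcase (dropOnes r) (x.1, [], A.bad x.1 x.2.2)
        (fun _ => (x.1, [], A.bad x.1 x.2.2))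
        (fun r' => (x.1, r', A.var x.1 (takeOnes l) (takeOnes r) x.2.2))))
    (fun l => bcase l (x.1, [], A.bad x.1 x.2.2)
      (fun r => bcase r (x.1, [], A.bad x.1 x.2.2)
        (fun r' => (x.1, r', A.bin true x.1 x.2.2))
        (fun r' => (x.1, r', A.bin false x.1 x.2.2)))
      (fun r => (x.1, r, A.neg x.1 x.2.2)))

/-- Read all symbols of a string. -/
def run (p : P) (l : List Bool) (s : S) : S := (A.step^[l.length] (p, l, s)).2.2

theorem step_encode (t : Token) (p : P) (l : List Bool) (s : S) :
    A.step (p, t.encode ++ l, s) = (p, l, A.act t p s) := by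
  rcases t with _ | ⟨_ | _⟩ | ⟨j, i⟩
  · rfl
  · rfl
  · rfl
  · simp [step, act, Token.encode]

theorem step_malformed (p : P) {l : List Bool} (hl : l ≠ []) (h : Malformed l) (s : S) :
    A.step (p, l, s) = (p, [], A.bad p s) := by
  rcases l with _ | ⟨_ | _, l⟩
  · exact absurd rfl hl
  · rcases l with _ | ⟨_ | _, _ | ⟨b, l⟩⟩
    exacts [rfl, absurd rfl (h .neg []), absurd rfl (h .neg _), rfl, absurd rfl (h (.bin b) l)]
  · rcases dropOnes_eq_nil_or l with e | ⟨r, e, hl⟩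
    · simp [step, e]
    rcases dropOnes_eq_nil_or r with e' | ⟨r', -, hr⟩
    · simp [step, e, e']
    refine absurd ?_ (h (.var (takeOnes l).length (takeOnes r).length) r')
    conv_lhs => rw [hl, hr]
    simp [Token.encode]

theorem exists_iterate_step (p : P) (l : List Bool) (s : S) :
    ∃ s', ∀ k, l.length ≤ k → A.step^[k] (p, l, s) = (p, [], s') := by
  have hpos : ∀ {m k : ℕ}, 0 < m → m ≤ k → ∃ k', k = k' + 1 := fun hm hk =>
    ⟨_, (Nat.sub_add_cancel (hm.trans_le hk)).symm⟩
  induction l using tokenInduction generalizing s with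
  | nil => exact ⟨s, fun k _ => iterate_fixed rfl k⟩
  | token t l ih =>
    obtain ⟨s', hs'⟩ := ih (A.act t p s)
    refine ⟨s', fun k hk => ?_⟩
    rw [List.length_append] at hk
    have ht := t.length_encode_pos
    obtain ⟨k, rfl⟩ := hpos ht (show t.encode.length ≤ k by omega)
    rw [iterate_succ_apply, step_encode, hs' k (by omega)]
  | malformed l hl h =>
    refine ⟨A.bad p s, fun k hk => ?_⟩
    obtain ⟨k, rfl⟩ := hpos (List.length_pos_iff.2 hl) hk
    rw [iterate_succ_apply, A.step_malformed p hl h]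
    exact iterate_fixed rfl k

variable {A} in
theorem run_of_step {p : P} {l l' : List Bool} {s s' : S} (h : A.step (p, l, s) = (p, l', s'))
    (hl : l'.length < l.length) : A.run p l s = A.run p l' s' := by
  obtain ⟨t, ht⟩ := A.exists_iterate_step p l' s'
  obtain ⟨k, hk⟩ := Nat.exists_eq_add_one.2 (Nat.zero_lt_of_lt hl)
  rw [run, run, hk, iterate_succ_apply, h, ht k (by omega), ht _ le_rfl]

@[simp] theorem run_nil (p : P) (s : S) : A.run p [] s = s := rfl

theorem run_encode (t : Token) (p : P) (l : List Bool) (s : S) :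
    A.run p (t.encode ++ l) s = A.run p l (A.act t p s) :=
  run_of_step (A.step_encode t p l s) (by simpa using t.length_encode_pos)

theorem run_neg (p : P) (l : List Bool) (s : S) :
    A.run p (false :: false :: l) s = A.run p l (A.neg p s) :=
  A.run_encode .neg p l s

theorem run_bin (p : P) (b : Bool) (l : List Bool) (s : S) :
    A.run p (false :: true :: b :: l) s = A.run p l (A.bin b p s) :=
  A.run_encode (.bin b) p l s

theorem run_malformed (p : P) {l : List Bool} (hl : l ≠ []) (h : Malformed l) (s : S) :
    A.run p l s = A.bad p s :=
  run_of_step (A.step_malformed p hl h s) (List.length_pos_iff.2 hl)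

end Run

variable {α P S : Type} [Reg α] [Reg P] [Reg S] {A : TokenActions P S}

/-- The actions are computable, and enlarge the accumulator by a controlled amount. -/
structure Feasible (A : TokenActions P S) : Prop where
  neg : PolyT fun x : P × S => A.neg x.1 x.2
  bin : ∀ b, PolyT fun x : P × S => A.bin b x.1 x.2
  var : PolyT fun x : P × List Bool × List Bool × S => A.var x.1 x.2.1 x.2.2.1 x.2.2.2
  bad : PolyT fun x : P × S => A.bad x.1 x.2
  bound : ∃ R : Polynomial ℕ, ∀ p s, size (A.bad p s) ≤ size s + R.eval (size p) ∧
    ∀ t, size (A.act t p s) ≤ size s + R.eval (size p + t.encode.length)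

theorem Feasible.step (h : A.Feasible) : PolyT A.step := by
  have hbad : ∀ {γ : Type} [Reg γ] (f : γ → P × List Bool × S), PolyT f →
      PolyT fun c => ((f c).1, ([] : List Bool), A.bad (f c).1 (f c).2.2) := fun f hf =>
    PolyT.pair (by fun_prop) (.pair .nil
      (h.bad.comp (f := fun c => ((f c).1, (f c).2.2)) (by fun_prop)))
  refine polyT_bcase (by fun_prop) (by fun_prop) ?_ ?_
  · refine polyT_bcase (by fun_prop) (hbad _ (by fun_prop)) (hbad _ (by fun_prop)) ?_
    refine polyT_bcase (by fun_prop) (hbad _ (by fun_prop)) (hbad _ (by fun_prop)) ?_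
    exact PolyT.pair (by fun_prop) (.pair (by fun_prop) (h.var.comp
      (f := fun y : (((P × List Bool × S) × List Bool) × List Bool) × List Bool =>
        (y.1.1.1.1, takeOnes y.1.1.2, takeOnes y.1.2, y.1.1.1.2.2)) (by fun_prop)))
  · refine polyT_bcase (by fun_prop) (hbad _ (by fun_prop)) ?_ ?_
    · refine polyT_bcase (by fun_prop) (hbad _ (by fun_prop)) ?_ ?_
      all_goals exact PolyT.pair (by fun_prop) (.pair (by fun_prop) ((h.bin _).comp
        (f := fun y : (((P × List Bool × S) × List Bool) × List Bool) × List Bool =>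
          (y.1.1.1.1, y.1.1.1.2.2)) (by fun_prop)))
    · exact PolyT.pair (by fun_prop) (.pair (by fun_prop) (h.neg.comp
        (f := fun y : ((P × List Bool × S) × List Bool) × List Bool =>
          (y.1.1.1, y.1.1.2.2)) (by fun_prop)))

theorem Feasible.run (h : A.Feasible) {p : α → P} {l : α → List Bool} {s : α → S} (hp : PolyT p)
    (hl : PolyT l) (hs : PolyT s) : PolyT fun a => A.run (p a) (l a) (s a) := by
  obtain ⟨R, hR⟩ := h.bound
  refine (PolyT.iterate h.step (fun x => size x.1 + x.2.1.length) R ?_ ?_ ?_ hl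
    (hp.pair (hl.pair hs))).snd.snd
  · rintro ⟨p, l, s⟩
    simp
  · rintro ⟨p, l, s⟩
    induction l using tokenInduction with
    | nil => exact le_rfl
    | token t l => simp [step_encode]
    | malformed l hl h => simp [A.step_malformed p hl h]
  · rintro ⟨p, l, s⟩
    have hmono : ∀ m, R.eval (size p + m) ≤ R.eval (size p + l.length) ∨ l.length < m := fun m =>
      (le_or_gt m l.length).imp_left fun h => polynomial_eval_monotone R (by omega)
    induction l using tokenInduction with
    | nil => exact Nat.le_add_right _ _
    | token t l =>
      have h1 := (hR p s).2 t
      have h2 := hmono t.encode.length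
      simp only [step_encode, size_prod, size_list, List.length_append] at h2 ⊢
      omega
    | malformed l hl h =>
      have h1 := (hR p s).1
      have h2 := hmono 0
      simp only [A.step_malformed p hl h, size_prod, size_list, List.length_nil,
        add_zero] at h2 ⊢
      omega

end TokenActions

/-! ### Expressions whose variables are given by block and index -/

section RawExpressions

/-- Boolean expressions in variables given by a block number and an index. -/
inductive RawExpr : Type
  | var (j i : ℕ) : RawExpr
  | neg (e : RawExpr) : RawExpr
  | and (e₁ e₂ : RawExpr) : RawExpr
  | or (e₁ e₂ : RawExpr) : RawExpr

/-- There is a variable with index `i` of block `j`. -/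
def InBlock (ms : List ℕ+) (j i : ℕ) : Prop := ∃ m, ms[j]? = some m ∧ i < m

namespace RawExpr

/-- Polish notation. -/
def encode : RawExpr → List Bool
  | var j i => (Token.var j i).encode
  | neg e => false :: false :: e.encode
  | and e₁ e₂ => false :: true :: false :: (e₁.encode ++ e₂.encode)
  | or e₁ e₂ => false :: true :: true :: (e₁.encode ++ e₂.encode)

/-- The value under an assignment. -/
def eval (v : ℕ → ℕ → Bool) : RawExpr → Bool
  | var j i => v j i
  | neg e => !e.eval v
  | and e₁ e₂ => e₁.eval v && e₂.eval v
  | or e₁ e₂ => e₁.eval v || e₂.eval v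

/-- All variables belong to the given blocks. -/
def InRange (ms : List ℕ+) : RawExpr → Prop
  | var j i => InBlock ms j i
  | neg e => e.InRange ms
  | and e₁ e₂ => e₁.InRange ms ∧ e₂.InRange ms
  | or e₁ e₂ => e₁.InRange ms ∧ e₂.InRange ms

/-- Replace the variables by expressions. -/
def subst (g : ℕ → ℕ → RawExpr) : RawExpr → RawExpr
  | var j i => g j i
  | neg e => neg (e.subst g)
  | and e₁ e₂ => and (e₁.subst g) (e₂.subst g)
  | or e₁ e₂ => or (e₁.subst g) (e₂.subst g)

theorem eval_subst (v : ℕ → ℕ → Bool) (g : ℕ → ℕ → RawExpr) (e : RawExpr) :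
    (e.subst g).eval v = e.eval fun j i => (g j i).eval v := by
  induction e <;> simp_all [subst, eval]

theorem eval_congr {ms : List ℕ+} {v w : ℕ → ℕ → Bool} (h : ∀ j i, InBlock ms j i → v j i = w j i)
    {e : RawExpr} (he : e.InRange ms) : e.eval v = e.eval w := by
  induction e with
  | var j i => exact h j i he
  | neg e ih => simp [eval, ih he]
  | and e₁ e₂ ih₁ ih₂ => simp [eval, ih₁ he.1, ih₂ he.2]
  | or e₁ e₂ ih₁ ih₂ => simp [eval, ih₁ he.1, ih₂ he.2]

theorem InRange.mono {ms ms' : List ℕ+} (h : ∀ j i, InBlock ms j i → InBlock ms' j i)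
    {e : RawExpr} (he : e.InRange ms) : e.InRange ms' := by
  induction e with
  | var j i => exact h j i he
  | neg e ih => exact ih he
  | and e₁ e₂ ih₁ ih₂ | or e₁ e₂ ih₁ ih₂ => exact ⟨ih₁ he.1, ih₂ he.2⟩

theorem InRange.subst {ms ms' : List ℕ+} {g : ℕ → ℕ → RawExpr}
    (h : ∀ j i, InBlock ms j i → (g j i).InRange ms') {e : RawExpr} (he : e.InRange ms) :
    (e.subst g).InRange ms' := by
  induction e with
  | var j i => exact h j i he
  | neg e ih => exact ih he
  | and e₁ e₂ ih₁ ih₂ | or e₁ e₂ ih₁ ih₂ => exact ⟨ih₁ he.1, ih₂ he.2⟩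

end RawExpr

@[simp] theorem inBlock_nil (j i : ℕ) : ¬ InBlock [] j i := by simp [InBlock]

@[simp] theorem inBlock_cons_zero (m : ℕ+) (ms : List ℕ+) (i : ℕ) :
    InBlock (m :: ms) 0 i ↔ i < m := by simp [InBlock]

@[simp] theorem inBlock_cons_succ (m : ℕ+) (ms : List ℕ+) (j i : ℕ) :
    InBlock (m :: ms) (j + 1) i ↔ InBlock ms j i := by simp [InBlock]

/-- The bit with index `i` of block `j` (and `0` if there is none). -/
def getBit : {ms : List ℕ+} → Inputs ms → ℕ → ℕ → Bool
  | [], _, _, _ => false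
  | m :: _, (x, _), 0, i => if h : i < (m : ℕ) then x ⟨i, h⟩ else false
  | _ :: _, (_, y), j + 1, i => getBit y j i

/-- The block of a variable. -/
def Var.block : {ms : List ℕ+} → Var ms → ℕ
  | _ :: _, .head _ => 0
  | _ :: _, .tail v => v.block + 1

/-- The index of a variable within its block. -/
def Var.index : {ms : List ℕ+} → Var ms → ℕ
  | _ :: _, .head i => i
  | _ :: _, .tail v => v.index

theorem Var.encode_eq : ∀ {ms : List ℕ+} (v : Var ms), 
    true :: v.encode = (Token.var v.block v.index).encode
  | _ :: _, .head i => rfl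
  | _ :: _, .tail v => by
    have := v.encode_eq
    simp only [Token.encode, List.cons.injEq, true_and] at this
    simp [Var.encode, Token.encode, Var.block, Var.index, List.replicate_succ, this]

theorem Var.eval_eq : ∀ {ms : List ℕ+} (v : Var ms) (x : Inputs ms),
    v.eval x = getBit x v.block v.index
  | _ :: _, .head i, (x, y) => by simp [Var.eval, getBit, Var.block, Var.index]
  | _ :: _, .tail v, (x, y) => by simpa [Var.eval, getBit, Var.block, Var.index] using v.eval_eq y

theorem Var.inBlock : ∀ {ms : List ℕ+} (v : Var ms), InBlock ms v.block v.index
  | _ :: _, .head i => by simp [Var.block, Var.index]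
  | _ :: _, .tail v => by simpa [Var.block, Var.index] using v.inBlock

theorem InBlock.exists_var : ∀ {ms : List ℕ+} {j i : ℕ}, InBlock ms j i →
    ∃ v : Var ms, v.block = j ∧ v.index = i
  | [], _, _, h => absurd h (inBlock_nil _ _)
  | m :: ms, 0, i, h => ⟨.head ⟨i, by simpa using h⟩, rfl, rfl⟩
  | m :: ms, j + 1, i, h => by
    obtain ⟨v, hj, hi⟩ := InBlock.exists_var ((inBlock_cons_succ m ms j i).1 h)
    exact ⟨.tail v, by simp [Var.block, hj], by simp [Var.index, hi]⟩

/-- The underlying raw expression. -/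
def Expr.toRaw {ms : List ℕ+} : Expr ms → RawExpr
  | .var v => .var v.block v.index
  | .neg e => .neg e.toRaw
  | .and e₁ e₂ => .and e₁.toRaw e₂.toRaw
  | .or e₁ e₂ => .or e₁.toRaw e₂.toRaw

variable {ms : List ℕ+}

theorem Expr.encode_toRaw (e : Expr ms) : e.toRaw.encode = e.encode := by
  induction e with
  | var v => exact v.encode_eq.symm
  | _ => simp_all [Expr.toRaw, RawExpr.encode, Expr.encode]

theorem Expr.eval_toRaw (e : Expr ms) (x : Inputs ms) : e.toRaw.eval (getBit x) = e.eval x := by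
  induction e with
  | var v => exact (v.eval_eq x).symm
  | _ => simp_all [Expr.toRaw, RawExpr.eval, Expr.eval]

theorem Expr.inRange_toRaw (e : Expr ms) : e.toRaw.InRange ms := by
  induction e with
  | var v => exact v.inBlock
  | _ => simp_all [Expr.toRaw, RawExpr.InRange]

theorem RawExpr.InRange.exists_expr {e : RawExpr} (h : e.InRange ms) :
    ∃ e' : Expr ms, e'.toRaw = e := by
  induction e with
  | var j i =>
    obtain ⟨v, hj, hi⟩ := InBlock.exists_var h
    exact ⟨.var v, by simp [Expr.toRaw, hj, hi]⟩
  | neg e ih =>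
    obtain ⟨e', rfl⟩ := ih h
    exact ⟨.neg e', rfl⟩
  | and e₁ e₂ ih₁ ih₂ =>
    obtain ⟨e₁', rfl⟩ := ih₁ h.1
    obtain ⟨e₂', rfl⟩ := ih₂ h.2
    exact ⟨.and e₁' e₂', rfl⟩
  | or e₁ e₂ ih₁ ih₂ =>
    obtain ⟨e₁', rfl⟩ := ih₁ h.1
    obtain ⟨e₂', rfl⟩ := ih₂ h.2
    exact ⟨.or e₁' e₂', rfl⟩

end RawExpressions

/-! ### Substitution for the variables of an encoded expression -/

section Substitution

variable {P : Type}

/-- Copy all symbols except variables, and replace those by strings. -/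
def substActions (g : P → List Bool → List Bool → List Bool) : TokenActions P (List Bool) where
  neg _ s := s ++ [false, false]
  bin b _ s := s ++ [false, true, b]
  var p j i s := s ++ g p j i
  bad _ s := s

@[simp] theorem substActions_neg (g : P → List Bool → List Bool → List Bool) (p : P)
    (s : List Bool) : (substActions g).neg p s = s ++ [false, false] := rfl

@[simp] theorem substActions_bin (g : P → List Bool → List Bool → List Bool) (b : Bool) (p : P)
    (s : List Bool) : (substActions g).bin b p s = s ++ [false, true, b] := rfl

@[simp] theorem substActions_var (g : P → List Bool → List Bool → List Bool) (p : P)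
    (j i s : List Bool) : (substActions g).var p j i s = s ++ g p j i := rfl

theorem run_substActions {g : P → List Bool → List Bool → List Bool} {G : ℕ → ℕ → RawExpr} {p : P}
    (h : ∀ j i, g p (List.replicate j true) (List.replicate i true) = (G j i).encode)
    (e : RawExpr) (l s : List Bool) : (substActions g).run p (e.encode ++ l) s =
      (substActions g).run p l (s ++ (e.subst G).encode) := by
  induction e generalizing l s with
  | var j i =>
    simp [RawExpr.encode, TokenActions.run_encode, TokenActions.act, RawExpr.subst, ← h]
  | neg e ih => simp [RawExpr.encode, TokenActions.run_neg, ih, RawExpr.subst]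
  | and e₁ e₂ ih₁ ih₂ =>
    simp [RawExpr.encode, TokenActions.run_bin, ih₁, ih₂, RawExpr.subst]
  | or e₁ e₂ ih₁ ih₂ =>
    simp [RawExpr.encode, TokenActions.run_bin, ih₁, ih₂, RawExpr.subst]

theorem run_substActions_encode {g : P → List Bool → List Bool → List Bool} {G : ℕ → ℕ → RawExpr}
    {p : P} (h : ∀ j i, g p (List.replicate j true) (List.replicate i true) = (G j i).encode)
    (e : RawExpr) : (substActions g).run p e.encode [] = (e.subst G).encode := by
  simpa using run_substActions h e [] []

theorem polyT_substActions {α : Type} [Reg α] [Reg P] {g : P → List Bool → List Bool → List Bool}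
    (hg : PolyT fun x : P × List Bool × List Bool => g x.1 x.2.1 x.2.2) {p : α → P}
    {l : α → List Bool} (hp : PolyT p) (hl : PolyT l) :
    PolyT fun a => (substActions g).run (p a) (l a) [] := by
  refine TokenActions.Feasible.run ⟨?_, ?_, ?_, ?_, ?_⟩ hp hl .nil
  · exact .append (by fun_prop) (.const_list _)
  · exact fun b => .append (by fun_prop) (.const_list _)
  · exact .append (by fun_prop) (hg.comp
      (f := fun x : P × List Bool × List Bool × List Bool => (x.1, x.2.1, x.2.2.1)) (by fun_prop))
  · exact (by fun_prop : PolyT fun x : P × List Bool => x.2)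
  · obtain ⟨R, hR⟩ := hg.exists_size_le
    refine ⟨R + 3, fun p s => ⟨by simp [substActions], fun t => ?_⟩⟩
    rcases t with _ | b | ⟨j, i⟩
    · simp [TokenActions.act]
    · simp [TokenActions.act]
    · have h1 := hR (p, List.replicate j true, List.replicate i true)
      have h2 : R.eval (size p + (j + i)) ≤ R.eval (size p + (Token.var j i).encode.length) :=
        polynomial_eval_monotone R (by simp [Token.encode]; omega)
      simp only [size_prod, size_list, List.length_replicate] at h1
      simp [TokenActions.act]
      omega

end Substitution

/-! ### Headers -/

section Headers

variable {α : Type} [Reg α]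

/-- Remove a number in unary and the following `0`. -/
def skipBlock (l : List Bool) : List Bool := (dropOnes l).tail

@[fun_prop]
theorem polyT_skipBlock {f : α → List Bool} (hf : PolyT f) : PolyT fun a => skipBlock (f a) := by
  unfold skipBlock
  fun_prop

/-- The first `n` numbers in unary at the beginning of a string. -/
def header : ℕ → List Bool → List Bool
  | 0, _ => []
  | n + 1, l => takeOnes l ++ false :: header n (skipBlock l)

/-- The string after the first `n` numbers in unary. -/
def body : ℕ → List Bool → List Bool
  | 0, l => l
  | n + 1, l => body n (skipBlock l)

/-- A string which is empty if and only if the string `l` begins with `n` positive numbers in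
unary. -/
def headerError : ℕ → List Bool → List Bool
  | 0, _ => []
  | n + 1, l => bcase l [true]
      (fun _ => bcase (dropOnes l) [true] (fun _ => [true]) (fun r => headerError n r))
      (fun _ => [true])

@[fun_prop]
theorem polyT_header (n : ℕ) {f : α → List Bool} (hf : PolyT f) :
    PolyT fun a => header n (f a) := by
  induction n generalizing f with
  | zero => exact .nil
  | succ n ih => exact .append (by fun_prop) (.cons _ (ih (by fun_prop)))

@[fun_prop]
theorem polyT_body (n : ℕ) {f : α → List Bool} (hf : PolyT f) : PolyT fun a => body n (f a) := by
  induction n generalizing f with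
  | zero => exact hf
  | succ _ ih => exact ih (by fun_prop)

@[fun_prop]
theorem polyT_headerError (n : ℕ) {f : α → List Bool} (hf : PolyT f) :
    PolyT fun a => headerError n (f a) := by
  suffices h : PolyT (headerError n) from h.comp hf
  clear hf f
  induction n with
  | zero => exact .nil
  | succ n ih =>
    exact polyT_bcase (by fun_prop) (.const_list _) (polyT_bcase (by fun_prop) (.const_list _)
      (.const_list _) (ih.comp (by fun_prop))) (.const_list _)

theorem skipBlock_unary (k : ℕ) (l : List Bool) :
    skipBlock (List.replicate k true ++ false :: l) = l := by simp [skipBlock]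

theorem header_encodeSizes (ms : List ℕ+) (l : List Bool) :
    header ms.length (encodeSizes ms ++ l) = encodeSizes ms := by
  induction ms with
  | nil => rfl
  | cons m ms ih => simp [header, encodeSizes, skipBlock_unary, ih]

theorem body_encodeSizes (ms : List ℕ+) (l : List Bool) :
    body ms.length (encodeSizes ms ++ l) = l := by
  induction ms with
  | nil => rfl
  | cons m ms ih => simp [body, encodeSizes, skipBlock_unary, ih]

theorem headerError_encodeSizes (ms : List ℕ+) (l : List Bool) :
    headerError ms.length (encodeSizes ms ++ l) = [] := by
  induction ms with
  | nil => rfl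
  | cons m ms ih =>
    obtain ⟨k, hk⟩ : ∃ k, (m : ℕ) = k + 1 := ⟨m - 1, by have := m.pos; omega⟩
    have h := dropOnes_unary (k + 1) (encodeSizes ms ++ l)
    simp only [List.replicate_succ, List.cons_append] at h
    simp [headerError, encodeSizes, hk, List.replicate_succ, h, ih]

theorem exists_of_headerError : ∀ {n : ℕ} {l : List Bool}, headerError n l = [] →
    ∃ ms : List ℕ+, ms.length = n ∧ ∃ r, l = encodeSizes ms ++ r
  | 0, l, _ => ⟨[], rfl, l, rfl⟩
  | n + 1, [], h => by simp [headerError] at h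
  | n + 1, false :: l, h => by simp [headerError] at h
  | n + 1, true :: l, h => by
    rcases dropOnes_eq_nil_or (true :: l) with e | ⟨r, e, hl⟩
    · simp [headerError, e] at h
    · obtain ⟨ms, hms, t, rfl⟩ := exists_of_headerError (n := n) (l := r) (by
        simpa [headerError, e] using h)
      have hpos : 0 < (takeOnes (true :: l)).length := Nat.succ_pos _
      generalize (takeOnes (true :: l)).length = k at hpos hl
      lift k to ℕ+ using hpos
      refine ⟨k :: ms, by simp [hms], t, ?_⟩
      rw [hl]
      simp [encodeSizes]

end Headers

/-! ### Recognising the encodings of instances -/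

section Recognition

variable {α : Type} [Reg α]

/-- Remove as many numbers in unary as `j` is long. -/
def skipBlocks (j l : List Bool) : List Bool := skipBlock^[j.length] l

@[fun_prop]
theorem polyT_skipBlocks {f g : α → List Bool} (hf : PolyT f) (hg : PolyT g) :
    PolyT fun a => skipBlocks (f a) (g a) := by
  refine PolyT.iterate (f := skipBlock) (by fun_prop) (fun _ => 0) 0 (by simp) (by simp) ?_ hf hg
  intro l
  have : (dropOnes l).length ≤ l.length := List.length_dropWhile_le _ _
  simp [skipBlock]
  omega

theorem skipBlocks_encodeSizes (j : ℕ) (ms : List ℕ+) :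
    skipBlocks (List.replicate j true) (encodeSizes ms) = encodeSizes (ms.drop j) := by
  have h : ∀ ms : List ℕ+, skipBlock (encodeSizes ms) = encodeSizes ms.tail
    | [] => rfl
    | m :: ms => skipBlock_unary _ _
  rw [skipBlocks, List.length_replicate]
  induction j generalizing ms with
  | zero => rfl
  | succ j ih => rw [Function.iterate_succ_apply, h, ih, List.drop_tail]

/-- The accumulator counts, in unary, the expressions which are still to be read; it is `[false]`
after an error. The parameter holds the sizes of the blocks. -/
def parseActions : TokenActions (List Bool) (List Bool) where
  neg _ c := bcase c [false] (fun _ => c) (fun _ => [false])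
  bin _ _ c := bcase c [false] (fun _ => true :: c) (fun _ => [false])
  var p j i c := bcase c [false]
    (fun t => bcase ((takeOnes (skipBlocks j p)).drop i.length) [false] (fun _ => t)
      (fun _ => [false]))
    (fun _ => [false])
  bad _ _ := [false]

theorem length_bcase_le {l n : List Bool} {t f : List Bool → List Bool} {N : ℕ}
    (hn : n.length ≤ N) (ht : ∀ r, l = true :: r → (t r).length ≤ N)
    (hf : ∀ r, l = false :: r → (f r).length ≤ N) : (bcase l n t f).length ≤ N := by
  rcases l with _ | ⟨_ | _, l⟩
  exacts [hn, hf l rfl, ht l rfl]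

theorem feasible_parseActions : parseActions.Feasible := by
  refine ⟨?_, fun _ => ?_, ?_, .const_list _, 1, fun p c => ⟨?_, fun t => ?_⟩⟩
  · exact polyT_bcase (by fun_prop) (.const_list _) (by fun_prop) (.const_list _)
  · exact polyT_bcase (by fun_prop) (.const_list _) (by fun_prop) (.const_list _)
  · exact polyT_bcase (by fun_prop) (.const_list _) (polyT_bcase (by fun_prop) (.const_list _)
      (by fun_prop) (.const_list _)) (.const_list _)
  · simp [parseActions]
  · simp only [size_list, Polynomial.eval_one]
    rcases t with _ | _ | ⟨j, i⟩
    · exact length_bcase_le (by simp) (by simp) (by simp)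
    · exact length_bcase_le (by simp) (by simp) (by simp)
    · refine length_bcase_le (by simp) (fun r hr => ?_) (by simp)
      exact length_bcase_le (by simp) (by simp [hr]; omega) (by simp)

theorem inBlock_iff_drop_takeOnes_ne_nil (ms : List ℕ+) (j i : ℕ) : InBlock ms j i ↔
    (takeOnes (skipBlocks (List.replicate j true) (encodeSizes ms))).drop i ≠ [] := by
  rw [skipBlocks_encodeSizes]
  by_cases hj : j < ms.length
  · rw [List.drop_eq_getElem_cons hj, encodeSizes, takeOnes_unary]
    simp [InBlock, hj, Nat.sub_eq_zero_iff_le]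
  · rw [List.drop_eq_nil_of_le (not_lt.1 hj)]
    simp [InBlock, encodeSizes, takeOnes, List.getElem?_eq_none (not_lt.1 hj)]

theorem parseActions_var {ms : List ℕ+} {j i c : ℕ} (h : InBlock ms j i) :
    parseActions.act (.var j i) (encodeSizes ms) (List.replicate (c + 1) true) =
      List.replicate c true := by
  rw [inBlock_iff_drop_takeOnes_ne_nil, drop_takeOnes, ne_eq,
    List.replicate_eq_nil_iff] at h
  obtain ⟨k, hk⟩ := Nat.exists_eq_add_one_of_ne_zero h
  simp [parseActions, TokenActions.act, drop_takeOnes, hk, List.replicate_succ]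

theorem parseActions_var_of_not {ms : List ℕ+} {j i : ℕ} (h : ¬ InBlock ms j i) (c : List Bool) :
    parseActions.act (.var j i) (encodeSizes ms) c = [false] := by
  rw [inBlock_iff_drop_takeOnes_ne_nil, not_not] at h
  rcases c with _ | ⟨_ | _, c⟩ <;> simp [parseActions, TokenActions.act, h]

theorem run_parseActions_false (p l : List Bool) : parseActions.run p l [false] = [false] := by
  induction l using tokenInduction with
  | nil => rfl
  | token t l ih =>
    rw [TokenActions.run_encode]
    cases t <;> exact ih
  | malformed l hl h => exact parseActions.run_malformed p hl h _

theorem run_parseActions_encode {ms : List ℕ+} {e : RawExpr} (he : e.InRange ms) (l : List Bool)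
    (c : ℕ) : parseActions.run (encodeSizes ms) (e.encode ++ l) (List.replicate (c + 1) true) =
      parseActions.run (encodeSizes ms) l (List.replicate c true) := by
  induction e generalizing l c with
  | var j i => rw [RawExpr.encode, TokenActions.run_encode, parseActions_var he]
  | neg e ih =>
    rw [RawExpr.encode, List.cons_append, List.cons_append, TokenActions.run_neg]
    exact ih he l c
  | and e₁ e₂ ih₁ ih₂ | or e₁ e₂ ih₁ ih₂ =>
    simp only [RawExpr.encode, List.cons_append, TokenActions.run_bin, List.append_assoc]
    exact (ih₁ he.1 _ (c + 1)).trans (ih₂ he.2 l c)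

theorem exists_expr_of_act_parseActions {ms : List ℕ+} {t : Token} {c : ℕ} {es : List RawExpr}
    (hes : ∀ e ∈ es, e.InRange ms) (h : parseActions.act t (encodeSizes ms)
      (List.replicate c true) = List.replicate es.length true) :
    ∃ es' : List RawExpr, es'.length = c ∧ (∀ e ∈ es', e.InRange ms) ∧
      es'.flatMap RawExpr.encode = t.encode ++ es.flatMap RawExpr.encode := by
  have hlen : ∀ {k}, List.replicate k true = List.replicate es.length true → es.length = k :=
    fun h => by simpa using (congrArg List.length h).symm
  have hfalse : [false] ≠ List.replicate es.length true := by
    cases es <;> simp [List.replicate_succ]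
  rcases c with _ | c
  · rcases t with _ | _ | _ <;> exact absurd h hfalse
  rcases t with _ | b | ⟨j, i⟩
  · obtain ⟨e, es, rfl⟩ := List.exists_cons_of_length_eq_add_one (hlen h)
    exact ⟨.neg e :: es, hlen h, by simpa [RawExpr.InRange] using hes,
      by simp [RawExpr.encode, Token.encode]⟩
  · replace h := hlen (k := c + 2) h
    rcases es with _ | ⟨e₁, _ | ⟨e₂, es⟩⟩
    · simp at h
    · simp at h
    simp only [List.mem_cons, forall_eq_or_imp] at hes
    obtain ⟨h₁, h₂, hes⟩ := hes
    refine ⟨(if b then .or e₁ e₂ else .and e₁ e₂) :: es, by simpa using h,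
      List.forall_mem_cons.2 ⟨?_, hes⟩, ?_⟩ <;>
      cases b <;> simp [h₁, h₂, RawExpr.InRange, RawExpr.encode, Token.encode]
  · by_cases hB : InBlock ms j i
    · rw [parseActions_var hB] at h
      exact ⟨.var j i :: es, by simp [hlen h], by simpa [RawExpr.InRange, hB] using hes,
        by simp [RawExpr.encode]⟩
    · rw [parseActions_var_of_not hB] at h
      exact absurd h hfalse

theorem act_parseActions_eq_or (ms : List ℕ+) (t : Token) (c : ℕ) :
    parseActions.act t (encodeSizes ms) (List.replicate c true) = [false] ∨
      ∃ c', parseActions.act t (encodeSizes ms) (List.replicate c true) =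
        List.replicate c' true := by
  rcases c with _ | c
  · cases t <;> exact .inl rfl
  rcases t with _ | b | ⟨j, i⟩
  · exact .inr ⟨c + 1, rfl⟩
  · exact .inr ⟨c + 2, rfl⟩
  · by_cases h : InBlock ms j i
    · exact .inr ⟨c, parseActions_var h⟩
    · exact .inl (parseActions_var_of_not h _)

theorem exists_of_run_parseActions {ms : List ℕ+} {l : List Bool} {c : ℕ}
    (h : parseActions.run (encodeSizes ms) l (List.replicate c true) = []) :
    ∃ es : List RawExpr, es.length = c ∧ (∀ e ∈ es, e.InRange ms) ∧
      es.flatMap RawExpr.encode = l := by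
  induction l using tokenInduction generalizing c with
  | nil => exact ⟨[], (List.replicate_eq_nil_iff _).1 h |>.symm, by simp, rfl⟩
  | token t l ih =>
    rw [TokenActions.run_encode] at h
    rcases act_parseActions_eq_or ms t c with hc | ⟨c', hc⟩ <;> rw [hc] at h
    · simp [run_parseActions_false] at h
    · obtain ⟨es, rfl, hes, rfl⟩ := ih h
      exact exists_expr_of_act_parseActions hes hc
  | malformed l hl hm =>
    rw [TokenActions.run_malformed _ _ hl hm] at h
    simp [parseActions] at h

/-- A string which is empty if and only if `l` encodes an instance of level `n`. -/
def instanceError (n : ℕ) (l : List Bool) : List Bool :=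
  headerError n l ++ parseActions.run (header n l) (body n l) [true]

theorem polyT_instanceError (n : ℕ) : PolyT (instanceError n) :=
  .append (by fun_prop) (feasible_parseActions.run (by fun_prop) (by fun_prop) (.const_list _))

theorem Instance.header_encode {n : ℕ} (F : Instance n) :
    header n F.encode = encodeSizes (F.m :: F.ms) := by
  have := header_encodeSizes (F.m :: F.ms) F.expr.encode
  rwa [List.length_cons, F.length_eq] at this

theorem Instance.body_encode {n : ℕ} (F : Instance n) : body n F.encode = F.expr.encode := by
  have := body_encodeSizes (F.m :: F.ms) F.expr.encode
  rwa [List.length_cons, F.length_eq] at this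

theorem Instance.instanceError_encode {n : ℕ} (F : Instance n) : instanceError n F.encode = [] := by
  have h1 := headerError_encodeSizes (F.m :: F.ms) F.expr.encode
  rw [List.length_cons, F.length_eq] at h1
  have h2 := run_parseActions_encode F.expr.inRange_toRaw [] 0
  rw [F.expr.encode_toRaw, List.append_nil] at h2
  rw [instanceError, F.header_encode, F.body_encode]
  exact List.append_eq_nil_iff.2 ⟨h1, h2⟩

theorem exists_instance_of_instanceError {n : ℕ} (hn : 1 ≤ n) {l : List Bool}
    (h : instanceError n l = []) : ∃ F : Instance n, F.encode = l := by
  obtain ⟨h1, h2⟩ := List.append_eq_nil_iff.1 h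
  obtain ⟨ms, rfl, r, rfl⟩ := exists_of_headerError h1
  rw [header_encodeSizes, body_encodeSizes] at h2
  obtain ⟨es, hc, hes, rfl⟩ := exists_of_run_parseActions (c := 1) h2
  obtain ⟨e, rfl⟩ := List.length_eq_one_iff.1 hc
  obtain ⟨m, ms, rfl⟩ := List.exists_cons_of_length_pos hn
  obtain ⟨e', rfl⟩ := (hes e (by simp)).exists_expr
  exact ⟨⟨m, ms, rfl, e'⟩, by simp [Instance.encode, Expr.encode_toRaw]⟩

end Recognition

/-! ### Reductions between problems on instances -/

section Reductions

variable {n n' : ℕ}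

theorem promiseProblem_apply (A : Instance n → Answers) {s : Str} {F : Instance n}
    (h : F.encode = s.1) : (promiseProblem n A s).1 = (A F).1 := by
  ext b
  refine ⟨fun hb => hb F h, fun hb G hG => ?_⟩
  rwa [Instance.encode_injective n (hG.trans h.symm)]

@[simp] theorem Answers.mem_neg {A : Answers} {b : Bool} : b ∈ A.neg.1 ↔ (!b) ∈ A.1 :=
  ⟨by rintro ⟨c, hc, rfl⟩; simpa using hc, fun h => ⟨_, h, by simp⟩⟩

theorem PromiseProblem.dual_dual (φ : PromiseProblem) : φ.dual.dual = φ :=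
  funext fun _ => Subtype.ext (Set.ext fun b => by simp [PromiseProblem.dual])

theorem StrongReduces.dual {φ ψ : PromiseProblem} (h : StrongReduces φ ψ) :
    StrongReduces φ.dual ψ.dual := by
  obtain ⟨μ, hμ, h⟩ := h
  exact ⟨μ, hμ, fun s b hb => Answers.mem_neg.2 (h s (Answers.mem_neg.1 hb))⟩

theorem strongClosure_dual_eq {φ ψ : PromiseProblem} (h : StrongReduces φ.dual ψ)
    (h' : StrongReduces ψ.dual φ) : strongClosure φ.dual = strongClosure ψ :=
  strongClosure_eq h (by simpa only [PromiseProblem.dual_dual] using h'.dual)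

theorem dual_promiseProblem (A : Instance n → Answers) :
    (promiseProblem n A).dual = promiseProblem n fun F => (A F).neg := by
  funext s
  refine Subtype.ext (Set.ext fun b => Answers.mem_neg.trans ?_)
  exact forall_congr' fun F => imp_congr_right fun _ => Answers.mem_neg.symm

theorem StrongReduces.of_polyT {φ ψ : PromiseProblem} {T : List Bool → List Bool} (hT : PolyT T)
    (hne : ∀ s : Str, T s.1 ≠ []) (h : ∀ s : Str, (ψ ⟨T s.1, hne s⟩).1 ⊆ (φ s).1) :
    StrongReduces φ ψ :=
  ⟨fun s => ⟨T s.1, hne s⟩, hT.polyTime _ fun _ => rfl, h⟩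

theorem Instance.encode_ne_nil (F : Instance n) : F.encode ≠ [] := by
  simp [Instance.encode, encodeSizes]

/-- Transformations of instances which are computable in polynomial time on the encodings. -/
def PolyTransform (G : Instance n → Instance n') : Prop :=
  ∃ T : List Bool → List Bool, PolyT T ∧ ∀ F, (G F).encode = T F.encode

theorem StrongReduces.of_instances {A : Instance n → Answers} {A' : Instance n' → Answers}
    {G : Instance n → Instance n'} (hG : PolyTransform G) (h : ∀ F, (A' (G F)).1 ⊆ (A F).1) :
    StrongReduces (promiseProblem n A) (promiseProblem n' A') := by
  obtain ⟨T, hT, hGT⟩ := hG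
  -- Strings encoding no instance may be sent anywhere, except to the empty string.
  refine .of_polyT (T := fun l => bcase (T l) [true] (fun r => true :: r) (fun r => false :: r))
    (polyT_bcase hT (.const_list _) (by fun_prop) (by fun_prop)) (fun s => ?_) fun s b hb F hF => ?_
  · rcases T s.1 with _ | ⟨_ | _, r⟩ <;> simp
  · refine h F (hb (G F) ?_)
    have hne := (G F).encode_ne_nil
    rw [hGT, hF] at hne ⊢
    generalize T s.1 = l at hne
    rcases l with _ | ⟨_ | _, r⟩
    exacts [absurd rfl hne, rfl, rfl]

theorem StrongReduces.of_answers {A A' : Instance n → Answers} (h : ∀ F, (A' F).1 ⊆ (A F).1) :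
    StrongReduces (promiseProblem n A) (promiseProblem n A') :=
  .of_instances (G := id) ⟨_, PolyT.id', fun _ => rfl⟩ h

theorem StrongReduces.dual_of_instances {A : Instance n → Answers} {A' : Instance n' → Answers}
    {G : Instance n → Instance n'} (hG : PolyTransform G)
    (h : ∀ F b, b ∈ (A' (G F)).1 → (!b) ∈ (A F).1) :
    StrongReduces (promiseProblem n A).dual (promiseProblem n' A') := by
  rw [dual_promiseProblem]
  exact .of_instances hG fun F b hb => Answers.mem_neg.2 (h F b hb)

open Classical in
/-- The answer to the question whether an instance has the property `P`. -/
noncomputable def decisionAnswers (P : Instance n → Prop) (F : Instance n) : Answers :=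
  ⟨{decide (P F)}, Set.singleton_nonempty _⟩

theorem mem_decisionAnswers {P : Instance n → Prop} {F : Instance n} {b : Bool} :
    b ∈ (decisionAnswers P F).1 ↔ (b = true ↔ P F) := by
  by_cases h : P F <;> simp [decisionAnswers, h]

theorem decisionProblem_eq_true_iff {P : Instance n → Prop} {s : Str} {F : Instance n}
    (h : F.encode = s.1) : decisionProblem n P s = true ↔ P F := by
  simp only [decisionProblem, decide_eq_true_eq]
  refine ⟨?_, fun hF => ⟨F, h, hF⟩⟩
  rintro ⟨G, hG, hP⟩
  rwa [Instance.encode_injective n (h.trans hG.symm)]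

theorem decisionProblem_eq_false {P : Instance n → Prop} {s : Str}
    (h : ¬ ∃ F : Instance n, F.encode = s.1) : decisionProblem n P s = false := by
  simp only [decisionProblem, decide_eq_false_iff_not]
  rintro ⟨G, hG, -⟩
  exact h ⟨G, hG⟩

theorem decisionAnswers_reduces (P : Instance n → Prop) :
    StrongReduces (promiseProblem n (decisionAnswers P)) (decisionProblem n P).toPromise := by
  refine .of_polyT PolyT.id' (fun s => s.2) fun s b hb F hF => mem_decisionAnswers.2 ?_
  obtain rfl : b = decisionProblem n P s := hb
  exact decisionProblem_eq_true_iff hF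

theorem decisionProblem_reduces (hn : 1 ≤ n) {P : Instance n → Prop} {F₀ : Instance n}
    (h₀ : ¬ P F₀) :
    StrongReduces (decisionProblem n P).toPromise (promiseProblem n (decisionAnswers P)) := by
  have hT : PolyT fun l => bcase (instanceError n l) l (fun _ => F₀.encode) fun _ => F₀.encode :=
    polyT_bcase (polyT_instanceError n) (by fun_prop) (.const_list _) (.const_list _)
  have key : ∀ s : Str, ∃ F : Instance n, (decisionProblem n P s = true ↔ P F) ∧ F.encode =
      bcase (instanceError n s.1) s.1 (fun _ => F₀.encode) fun _ => F₀.encode := by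
    intro s
    by_cases h : ∃ F : Instance n, F.encode = s.1
    · obtain ⟨F, hF⟩ := h
      exact ⟨F, decisionProblem_eq_true_iff hF, by rw [← hF, F.instanceError_encode, bcase_nil]⟩
    · refine ⟨F₀, by simp [decisionProblem_eq_false h, h₀], ?_⟩
      rcases e : instanceError n s.1 with _ | ⟨_ | _, r⟩
      exacts [absurd (exists_instance_of_instanceError hn e) h, rfl, rfl]
  refine .of_polyT hT (fun s => ?_) fun s b hb => ?_ <;> obtain ⟨F, hF, hs⟩ := key s
  · exact hs ▸ F.encode_ne_nil
  · rw [promiseProblem_apply _ hs, mem_decisionAnswers, ← hF] at hb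
    exact Bool.eq_iff_iff.2 hb

end Reductions

/-! ### Quantified formulas -/

section Formulas

variable {n : ℕ}

theorem holds_not (ms : List ℕ+) : ∀ f : Inputs ms → Bool,
    (SatHolds ms (fun y => !f y) ↔ ¬ CoSatHolds ms f) ∧
    (CoSatHolds ms (fun y => !f y) ↔ ¬ SatHolds ms f) := by
  induction ms with
  | nil => intro f; simp [SatHolds, CoSatHolds]
  | cons m ms ih =>
    intro f
    have h : ∀ x : Word m, fixFirst (fun y => !f y) x = fun y => !fixFirst f x y := fun _ => rfl
    simp [SatHolds, CoSatHolds, h, (ih _).1, (ih _).2]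

theorem satHolds_not {ms : List ℕ+} {f : Inputs ms → Bool} :
    SatHolds ms (fun y => !f y) ↔ ¬ CoSatHolds ms f := (holds_not ms f).1

theorem coSatHolds_not {ms : List ℕ+} {f : Inputs ms → Bool} :
    CoSatHolds ms (fun y => !f y) ↔ ¬ SatHolds ms f := (holds_not ms f).2

theorem holds_const (ms : List ℕ+) (b : Bool) :
    (SatHolds ms (fun _ => b) ↔ b = true) ∧ (CoSatHolds ms (fun _ => b) ↔ b = true) := by
  induction ms with
  | nil => simp [SatHolds, CoSatHolds]
  | cons m ms ih =>
    have h : ∀ x : Word m, fixFirst (fun _ : Inputs (m :: ms) => b) x = fun _ => b := fun _ => rfl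
    simp [SatHolds, CoSatHolds, h, ih]

@[simp] theorem satHolds_const {ms : List ℕ+} {b : Bool} :
    SatHolds ms (fun _ => b) ↔ b = true := (holds_const ms b).1

@[simp] theorem coSatHolds_const {ms : List ℕ+} {b : Bool} :
    CoSatHolds ms (fun _ => b) ↔ b = true := (holds_const ms b).2

theorem coSatHolds_and {ms : List ℕ+} {f : Inputs ms → Bool} {b : Bool} :
    CoSatHolds ms (fun y => b && f y) ↔ b = true ∧ CoSatHolds ms f := by
  cases b <;> simp

theorem coSatHolds_or {ms : List ℕ+} {f : Inputs ms → Bool} {b : Bool} :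
    CoSatHolds ms (fun y => b || f y) ↔ b = true ∨ CoSatHolds ms f := by
  cases b <;> simp

theorem satHolds_or {ms : List ℕ+} {f : Inputs ms → Bool} {b : Bool} :
    SatHolds ms (fun y => b || f y) ↔ b = true ∨ SatHolds ms f := by
  cases b <;> simp

theorem Instance.sat_iff {F : Instance n} : F.Sat ↔ F.witnesses.Nonempty := by
  unfold Instance.Sat
  rw [SatHolds]
  rfl

theorem exists_instance_fn_eq_false (hn : 1 ≤ n) : ∃ F : Instance n, F.fn = fun _ => false :=
  ⟨⟨1, List.replicate (n - 1) 1, by simp; omega, .and (.var (.head 0)) (.neg (.var (.head 0)))⟩,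
    funext fun _ => Bool.and_not_self _⟩

theorem SAT_reduces_decisionAnswers (hn : 1 ≤ n) :
    StrongReduces (SAT n) (promiseProblem n (decisionAnswers Instance.Sat)) := by
  obtain ⟨F, hF⟩ := exists_instance_fn_eq_false hn
  exact decisionProblem_reduces hn (F₀ := F) (by simp [Instance.Sat, hF])

theorem coSAT_reduces_decisionAnswers (hn : 1 ≤ n) :
    StrongReduces (coSAT n) (promiseProblem n (decisionAnswers Instance.CoSat)) := by
  obtain ⟨F, hF⟩ := exists_instance_fn_eq_false hn
  exact decisionProblem_reduces hn (F₀ := F) (by simp [Instance.CoSat, hF])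

/-! ### Negated instances -/

/-- The instance describing the negation of a function. -/
def Instance.negate (F : Instance n) : Instance n := { F with expr := .neg F.expr }

theorem polyTransform_negate : PolyTransform (Instance.negate (n := n)) := by
  refine ⟨fun l => header n l ++ ([false, false] ++ body n l),
    .append (by fun_prop) (.append (.const_list _) (by fun_prop)), fun F => ?_⟩
  simp only [F.header_encode, F.body_encode]
  rfl

theorem Instance.witnesses_negate (F : Instance n) :
    F.negate.witnesses = F.counterexamples :=
  Set.ext fun x => coSatHolds_not (f := fixFirst F.fn x)

theorem Instance.counterexamples_negate (F : Instance n) :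
    F.negate.counterexamples = F.witnesses :=
  Set.ext fun x => (not_congr (satHolds_not (f := fixFirst F.fn x))).trans not_not

theorem Instance.sat_negate (F : Instance n) : F.negate.Sat ↔ ¬ F.CoSat :=
  satHolds_not (f := F.fn)

theorem Instance.coSat_negate (F : Instance n) : F.negate.CoSat ↔ ¬ F.Sat :=
  coSatHolds_not (f := F.fn)

theorem dual_decisionAnswers_reduces {P Q : Instance n → Prop} (h : ∀ F, Q F.negate ↔ ¬ P F) :
    StrongReduces (promiseProblem n (decisionAnswers P)).dual
      (promiseProblem n (decisionAnswers Q)) :=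
  .dual_of_instances polyTransform_negate fun F b hb => by
    rw [mem_decisionAnswers, h] at hb
    rw [mem_decisionAnswers]
    cases b <;> simp_all

theorem dual_SAT_reduces (hn : 1 ≤ n) : StrongReduces (SAT n).dual (coSAT n) :=
  ((SAT_reduces_decisionAnswers hn).dual.trans (dual_decisionAnswers_reduces
    Instance.coSat_negate)).trans (decisionAnswers_reduces _)

theorem dual_coSAT_reduces (hn : 1 ≤ n) : StrongReduces (coSAT n).dual (SAT n) :=
  ((coSAT_reduces_decisionAnswers hn).dual.trans (dual_decisionAnswers_reduces
    Instance.sat_negate)).trans (decisionAnswers_reduces _)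

theorem dual_USAT_reduces : StrongReduces (USAT n).dual (coUSAT n) := by
  classical
  refine .dual_of_instances polyTransform_negate fun F b hb h => ?_
  have := hb (by rwa [F.counterexamples_negate])
  simp_all [F.coSat_negate]

theorem dual_coUSAT_reduces : StrongReduces (coUSAT n).dual (USAT n) := by
  classical
  refine .dual_of_instances polyTransform_negate fun F b hb h => ?_
  have := hb (by rwa [F.witnesses_negate])
  simp_all [F.sat_negate]

/-! ### Instances restricted to strings with first bit one -/

theorem lt_of_firstBit_lt {m : ℕ+} {x y : Lex (Word m)} (hx : firstBit (ofLex x) = false)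
    (hy : firstBit (ofLex y) = true) : x < y :=
  ⟨⟨0, m.pos⟩, fun _ hj => absurd hj (Nat.not_lt_zero _), Bool.lt_iff.2 ⟨hx, hy⟩⟩

theorem eq_true_iff_of_mem_firstBitMax {m : ℕ+} {S : Set (Word m)} {b : Bool}
    (hb : b ∈ firstBitMax S) : b = true ↔ ∃ x ∈ S, firstBit x = true := by
  obtain ⟨w, ⟨hw, hmax⟩, rfl⟩ := hb
  refine ⟨fun h => ⟨_, hw, h⟩, fun ⟨x, hx, h⟩ => ?_⟩
  by_contra h'
  exact (lt_of_firstBit_lt (Bool.eq_false_of_not_eq_true h') h).not_ge (hmax (a := toLex x) hx)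

/-- The instance describing the conjunction of the first bit and a function. -/
def Instance.restrict (F : Instance n) : Instance n :=
  { F with expr := .and (.var (.head ⟨0, F.m.pos⟩)) F.expr }

theorem polyTransform_restrict : PolyTransform (Instance.restrict (n := n)) := by
  refine ⟨fun l => header n l ++ ([false, true, false, true, false, false] ++ body n l),
    .append (by fun_prop) (.append (.const_list _) (by fun_prop)), fun F => ?_⟩
  simp only [F.header_encode, F.body_encode]
  rfl

theorem Instance.mem_witnesses_restrict (F : Instance n) (x : Word F.m) :
    x ∈ F.restrict.witnesses ↔ firstBit x = true ∧ x ∈ F.witnesses :=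
  coSatHolds_and (b := firstBit x) (f := fixFirst F.fn x)

theorem Instance.sat_restrict {F : Instance n} :
    F.restrict.Sat ↔ ∃ x ∈ F.witnesses, firstBit x = true :=
  sat_iff.trans (exists_congr fun x => (F.mem_witnesses_restrict x).trans and_comm)

theorem MaxVAL_reduces_SAT : StrongReduces (MaxVAL n) (SAT n) := by
  refine .trans (.of_instances polyTransform_restrict fun F b hb h => ?_)
    (decisionAnswers_reduces Instance.Sat)
  obtain ⟨c, hc⟩ := firstBitMax_nonempty h.nonempty
  rw [mem_decisionAnswers, Instance.sat_restrict, ← eq_true_iff_of_mem_firstBitMax hc,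
    ← Bool.eq_iff_iff] at hb
  exact hb ▸ hc

theorem UVAL_reduces_USAT : StrongReduces (UVAL n) (USAT n) := by
  classical
  refine .of_instances polyTransform_restrict fun F b hb ⟨x, hx, hu⟩ => ⟨x, hx, ?_⟩
  have hle : F.restrict.witnesses.encard ≤ 1 := Set.encard_le_one_iff.2 fun y z hy hz =>
    (hu y ((F.mem_witnesses_restrict y).1 hy).2).trans
      (hu z ((F.mem_witnesses_restrict z).1 hz).2).symm
  have hb : b = decide F.restrict.Sat := hb hle
  rw [hb, Bool.eq_iff_iff, decide_eq_true_eq, Instance.sat_restrict]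
  exact ⟨fun h => ⟨x, hx, h⟩, fun ⟨y, hy, h⟩ => hu y hy ▸ h⟩

theorem USAT_reduces_SAT : StrongReduces (USAT n) (SAT n) := by
  classical
  refine .trans (.of_answers fun F b hb _ => ?_) (decisionAnswers_reduces Instance.Sat)
  rw [Set.mem_singleton_iff, Bool.eq_iff_iff, decide_eq_true_eq, mem_decisionAnswers.1 hb]

theorem UVAL_reduces_VAL : StrongReduces (UVAL n) (VAL n) :=
  .of_answers fun _ _ hb h => hb (Instance.sat_iff.2 h.exists)

theorem VAL_reduces_MaxVAL : StrongReduces (VAL n) (MaxVAL n) := by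
  refine .of_answers fun F b hb h => ?_
  obtain ⟨w, hw, rfl⟩ := hb h
  exact ⟨ofLex w, hw.1, rfl⟩

end Formulas

/-! ### Instances given by raw expressions -/

section RawInstances

variable {n : ℕ}

/-- The instance of level `n` with block lengths `m, ms` described by a raw expression. -/
noncomputable abbrev Instance.ofRaw (m : ℕ+) (ms : List ℕ+) (hn : ms.length + 1 = n) {e : RawExpr}
    (he : e.InRange (m :: ms)) : Instance n :=
  ⟨m, ms, hn, he.exists_expr.choose⟩

theorem Instance.encode_ofRaw {m : ℕ+} {ms : List ℕ+} (hn : ms.length + 1 = n) {e : RawExpr}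
    (he : e.InRange (m :: ms)) :
    (ofRaw m ms hn he).encode = encodeSizes (m :: ms) ++ e.encode := by
  simp only [Instance.encode, ofRaw, ← Expr.encode_toRaw, he.exists_expr.choose_spec]

theorem Instance.mem_witnesses {F : Instance n} {x : Word F.m} : x ∈ F.witnesses ↔
    CoSatHolds F.ms fun y => F.expr.toRaw.eval (getBit (ms := F.m :: F.ms) (x, y)) := by
  simp only [Expr.eval_toRaw]
  rfl

theorem Instance.mem_witnesses_ofRaw {m : ℕ+} {ms : List ℕ+} (hn : ms.length + 1 = n)
    {e : RawExpr} (he : e.InRange (m :: ms)) {x : Word m} :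
    x ∈ (ofRaw m ms hn he).witnesses ↔
      CoSatHolds ms fun y => e.eval (getBit (ms := m :: ms) (x, y)) := by
  have h : (ofRaw m ms hn he).expr.toRaw = e := he.exists_expr.choose_spec
  exact mem_witnesses.trans (by rw [h])

theorem Instance.body_encode_raw (F : Instance n) : body n F.encode = F.expr.toRaw.encode := by
  rw [F.body_encode, F.expr.encode_toRaw]

@[simp] theorem getBit_zero {m : ℕ+} {ms : List ℕ+} (x : Word m) (y : Inputs ms) (i : ℕ) :
    getBit (ms := m :: ms) (x, y) 0 i = if h : i < (m : ℕ) then x ⟨i, h⟩ else false := rfl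

/-- The code of a variable whose block and index are given in unary. -/
def varString (j i : List Bool) : List Bool := true :: (j ++ false :: (i ++ [false]))

@[fun_prop]
theorem polyT_varString {α : Type} [Reg α] {j i : α → List Bool} (hj : PolyT j) (hi : PolyT i) :
    PolyT fun a => varString (j a) (i a) :=
  .cons _ (.append hj (.cons _ (.append hi (.const_list _))))

theorem varString_replicate (j i : ℕ) :
    varString (List.replicate j true) (List.replicate i true) = (RawExpr.var j i).encode := rfl

end RawInstances

/-! ### Complementing the first argument -/

section Complement

variable {n : ℕ} {m : ℕ+}

/-- The bitwise complement of a string. -/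
def complement (x : Word m) : Word m := fun i => !x i

@[simp] theorem complement_complement (x : Word m) : complement (complement x) = x :=
  funext fun _ => Bool.not_not _

theorem complement_lt {x y : Word m} (h : toLex x < toLex y) :
    toLex (complement y) < toLex (complement x) := by
  obtain ⟨i, heq, hlt⟩ := h
  refine ⟨i, fun j hj => congrArg (!·) (heq j hj).symm, ?_⟩
  change x i < y i at hlt
  change (!y i) < (!x i)
  revert hlt
  cases x i <;> cases y i <;> decide

theorem complement_le {x y : Word m} (h : toLex x ≤ toLex y) :
    toLex (complement y) ≤ toLex (complement x) := by
  by_contra h'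
  have := complement_lt (not_le.1 h')
  rw [complement_complement, complement_complement] at this
  exact absurd h (not_le_of_gt this)

theorem mem_firstBitMin_complement {S : Set (Word m)} {b : Bool}
    (h : b ∈ firstBitMin (complement ⁻¹' S)) : (!b) ∈ firstBitMax S := by
  obtain ⟨w, ⟨hw, hmin⟩, rfl⟩ := h
  refine ⟨toLex (complement (ofLex w)), ⟨hw, fun v hv => ?_⟩, rfl⟩
  have : w ≤ toLex (complement (ofLex v)) := hmin (by simpa using hv)
  simpa using complement_le (x := ofLex w) this

theorem mem_firstBitMax_complement {S : Set (Word m)} {b : Bool}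
    (h : b ∈ firstBitMax (complement ⁻¹' S)) : (!b) ∈ firstBitMin S := by
  obtain ⟨w, ⟨hw, hmax⟩, rfl⟩ := h
  refine ⟨toLex (complement (ofLex w)), ⟨hw, fun v hv => ?_⟩, rfl⟩
  have : toLex (complement (ofLex v)) ≤ w := hmax (by simpa using hv)
  simpa using complement_le (y := ofLex w) this

theorem mem_image_firstBit_complement {S : Set (Word m)} {b : Bool}
    (h : b ∈ firstBit '' (complement ⁻¹' S)) : (!b) ∈ firstBit '' S := by
  obtain ⟨x, hx, rfl⟩ := h
  exact ⟨complement x, hx, rfl⟩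

/-- The substitution which negates the variables of the first block. -/
def complementVar : ℕ → ℕ → RawExpr
  | 0, i => .neg (.var 0 i)
  | j + 1, i => .var (j + 1) i

theorem Instance.inRange_complement (F : Instance n) :
    (F.expr.toRaw.subst complementVar).InRange (F.m :: F.ms) :=
  F.expr.inRange_toRaw.subst fun
    | 0, _, h => h
    | _ + 1, _, h => h

/-- The instance describing the function `f (complement x, y)`. -/
noncomputable abbrev Instance.complement (F : Instance n) : Instance n :=
  .ofRaw F.m F.ms F.length_eq F.inRange_complement

theorem polyTransform_complement : PolyTransform (Instance.complement (n := n)) := by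
  let g (_ : Unit) (j i : List Bool) : List Bool :=
    bcase j [false, false] (fun _ => []) (fun _ => []) ++ varString j i
  have hg : PolyT fun x : Unit × List Bool × List Bool => g x.1 x.2.1 x.2.2 :=
    .append (polyT_bcase (by fun_prop) (.const_list _) (.const_list _) (.const_list _))
      (by fun_prop)
  refine ⟨fun l => header n l ++ (substActions g).run () (body n l) [],
    .append (by fun_prop) (polyT_substActions hg (.unit _) (by fun_prop)), fun F => ?_⟩
  have hG : ∀ j i, g () (List.replicate j true) (List.replicate i true) =
      (complementVar j i).encode
    | 0, _ => rfl
    | _ + 1, _ => rfl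
  simp only [F.header_encode, F.body_encode_raw, run_substActions_encode hG]
  exact Instance.encode_ofRaw F.length_eq F.inRange_complement

theorem Instance.witnesses_complement (F : Instance n) :
    F.complement.witnesses = PromiseHierarchy.complement ⁻¹' F.witnesses := by
  refine Set.ext fun x : Word F.m => ?_
  refine (mem_witnesses_ofRaw F.length_eq F.inRange_complement).trans ?_
  rw [Set.mem_preimage, mem_witnesses]
  refine iff_of_eq (congrArg _ (funext fun y => ?_))
  rw [RawExpr.eval_subst]
  refine RawExpr.eval_congr (fun j i h => ?_) F.expr.inRange_toRaw
  rcases j with _ | j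
  · have hi : i < (F.m : ℕ) := by simpa using h
    simp [complementVar, RawExpr.eval, hi, PromiseHierarchy.complement]
  · rfl

theorem Instance.Sat.complement {F : Instance n} (h : F.Sat) : F.complement.Sat := by
  obtain ⟨x, hx⟩ := h.nonempty
  rw [Instance.sat_iff, F.witnesses_complement]
  exact ⟨PromiseHierarchy.complement x, by simpa using hx⟩

theorem dual_MaxVAL_reduces : StrongReduces (MaxVAL n).dual (MinVAL n) :=
  .dual_of_instances polyTransform_complement fun F _ hb h =>
    mem_firstBitMin_complement (F.witnesses_complement ▸ hb h.complement)

theorem dual_MinVAL_reduces : StrongReduces (MinVAL n).dual (MaxVAL n) :=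
  .dual_of_instances polyTransform_complement fun F _ hb h =>
    mem_firstBitMax_complement (F.witnesses_complement ▸ hb h.complement)

theorem dual_VAL_reduces : StrongReduces (VAL n).dual (VAL n) :=
  .dual_of_instances polyTransform_complement fun F _ hb h =>
    mem_image_firstBit_complement (F.witnesses_complement ▸ hb h.complement)

theorem dual_UVAL_reduces : StrongReduces (UVAL n).dual (UVAL n) := by
  refine .dual_of_instances polyTransform_complement fun F _ hb ⟨x, hx, hu⟩ =>
    mem_image_firstBit_complement (F.witnesses_complement ▸ hb ?_)
  rw [F.witnesses_complement]
  refine ⟨complement x, by simpa using hx, fun y hy => ?_⟩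
  rw [← hu _ hy, complement_complement]

end Complement

/-! ### A new first bit -/

section NewBit

variable {n : ℕ}

/-- The string with first bit `b` followed by the bits of `x`. -/
def consBit {m : ℕ+} (b : Bool) (x : Word m) : Word (m + 1) :=
  (Fin.cons b x : Fin ((m : ℕ) + 1) → Bool)

theorem exists_consBit_firstBit {m : ℕ+} (z : Word (m + 1)) : ∃ x, consBit (firstBit z) x = z :=
  ⟨_, Fin.cons_self_tail (n := m) z⟩

theorem getBit_consBit_zero {m : ℕ+} {ms : List ℕ+} (b : Bool) (x : Word m)
    (y : Inputs ms) : getBit (ms := (m + 1) :: ms) (consBit b x, y) 0 0 = b := by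
  rw [getBit_zero, dif_pos (PNat.pos _)]
  rfl

theorem getBit_consBit_succ {m : ℕ+} {ms : List ℕ+} (b : Bool) (x : Word m)
    (y : Inputs ms) (i : ℕ) : getBit (ms := (m + 1) :: ms) (consBit b x, y) 0 (i + 1) =
      getBit (ms := m :: ms) (x, y) 0 i := by
  by_cases h : i < (m : ℕ)
  · have h' : i + 1 < ((m + 1 : ℕ+) : ℕ) := Nat.succ_lt_succ h
    rw [getBit_zero, getBit_zero, dif_pos h, dif_pos h']
    rfl
  · simp [h]

/-- The substitution which increases the indices of the variables of the first block. -/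
def shiftVar : ℕ → ℕ → RawExpr
  | 0, i => .var 0 (i + 1)
  | j + 1, i => .var (j + 1) i

/-- The expression `¬ b ∨ e`, where `b` is a new first bit. -/
def extendExpr (e : RawExpr) : RawExpr := .or (.neg (.var 0 0)) (e.subst shiftVar)

theorem Instance.inRange_extend (F : Instance n) :
    (extendExpr F.expr.toRaw).InRange ((F.m + 1) :: F.ms) := by
  refine ⟨by simp [RawExpr.InRange], F.expr.inRange_toRaw.subst fun j i h => ?_⟩
  rcases j with _ | j <;> simpa [shiftVar, RawExpr.InRange] using h

/-- The instance describing the function `¬ b ∨ f (x, y)` with first argument `b x`. -/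
noncomputable abbrev Instance.extend (F : Instance n) : Instance n :=
  .ofRaw (F.m + 1) F.ms F.length_eq F.inRange_extend

theorem polyTransform_extend : PolyTransform (Instance.extend (n := n)) := by
  let g (_ : Unit) (j i : List Bool) : List Bool :=
    varString j (bcase j [true] (fun _ => []) (fun _ => []) ++ i)
  have hg : PolyT fun x : Unit × List Bool × List Bool => g x.1 x.2.1 x.2.2 :=
    polyT_varString (by fun_prop) (.append (polyT_bcase (by fun_prop) (.const_list _)
      (.const_list _) (.const_list _)) (by fun_prop))
  refine ⟨fun l => true :: (header n l ++ ([false, true, true, false, false] ++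
    (varString [] [] ++ (substActions g).run () (body n l) []))),
    .cons _ (.append (by fun_prop) (.append (.const_list _) (.append (.const_list _)
      (polyT_substActions hg (.unit _) (by fun_prop))))), fun F => ?_⟩
  have hG : ∀ j i, g () (List.replicate j true) (List.replicate i true) = (shiftVar j i).encode
    | 0, _ => rfl
    | _ + 1, _ => rfl
  simp only [F.header_encode, F.body_encode_raw, run_substActions_encode hG]
  refine (Instance.encode_ofRaw F.length_eq F.inRange_extend).trans ?_
  simp [extendExpr, RawExpr.encode, Token.encode, varString, encodeSizes, List.replicate_succ]

theorem Instance.mem_witnesses_extend (F : Instance n) (b : Bool) (x : Word F.m) :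
    consBit b x ∈ F.extend.witnesses ↔ (b = true → x ∈ F.witnesses) := by
  have h : ∀ y : Inputs F.ms,
      (F.expr.toRaw.subst shiftVar).eval (getBit (ms := (F.m + 1) :: F.ms) (consBit b x, y)) =
        F.expr.toRaw.eval (getBit (ms := F.m :: F.ms) (x, y)) := by
    intro y
    rw [RawExpr.eval_subst]
    refine RawExpr.eval_congr (fun j i _ => ?_) F.expr.inRange_toRaw
    rcases j with _ | j
    · exact getBit_consBit_succ b x y i
    · rfl
  refine (mem_witnesses_ofRaw F.length_eq F.inRange_extend).trans ?_
  simp only [extendExpr, RawExpr.eval, h, getBit_consBit_zero, coSatHolds_or, mem_witnesses]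
  cases b <;> simp

theorem SAT_reduces_MaxVAL (hn : 1 ≤ n) : StrongReduces (SAT n) (MaxVAL n) := by
  refine (SAT_reduces_decisionAnswers hn).trans (.of_instances polyTransform_extend
    fun F b hb => mem_decisionAnswers.2 ?_)
  have hsat : F.extend.Sat :=
    Instance.sat_iff.2 ⟨_, (F.mem_witnesses_extend false fun _ => false).2 nofun⟩
  rw [eq_true_iff_of_mem_firstBitMax (hb hsat), Instance.sat_iff]
  constructor
  · rintro ⟨z, hz, h⟩
    obtain ⟨x, hx⟩ := exists_consBit_firstBit z
    exact ⟨x, (F.mem_witnesses_extend _ x).1 (by rwa [hx]) h⟩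
  · rintro ⟨x, hx⟩
    exact ⟨_, (F.mem_witnesses_extend true x).2 fun _ => hx, rfl⟩

end NewBit

/-! ### Quantified formulas over infinite strings -/

section BitGames

/-- The assignment with the block `X` followed by the blocks of `v`. -/
def consBlock (X : ℕ → Bool) (v : ℕ → ℕ → Bool) : ℕ → ℕ → Bool
  | 0 => X
  | j + 1 => v j

mutual

/-- The quantified formula `∃ X₀, ∀ X₁, …, p (X₀, X₁, …)` with `k` infinite blocks. -/
def SatBits : ℕ → ((ℕ → ℕ → Bool) → Prop) → Prop
  | 0, p => p fun _ _ => false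
  | k + 1, p => ∃ X, CoSatBits k fun v => p (consBlock X v)

/-- The quantified formula `∀ X₀, ∃ X₁, …, p (X₀, X₁, …)` with `k` infinite blocks. -/
def CoSatBits : ℕ → ((ℕ → ℕ → Bool) → Prop) → Prop
  | 0, p => p fun _ _ => false
  | k + 1, p => ∀ X, SatBits k fun v => p (consBlock X v)

end

theorem bits_const (k : ℕ) (P : Prop) :
    (SatBits k (fun _ => P) ↔ P) ∧ (CoSatBits k (fun _ => P) ↔ P) := by
  induction k with
  | zero => simp [SatBits, CoSatBits]
  | succ k ih => simp [SatBits, CoSatBits, ih]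

/-- The first `m` bits of an infinite string. -/
def takeWord (m : ℕ+) (X : ℕ → Bool) : Word m := fun i => X i

/-- The infinite string which extends a string by zeros. -/
def padWord {m : ℕ+} (x : Word m) (i : ℕ) : Bool := if h : i < (m : ℕ) then x ⟨i, h⟩ else false

@[simp] theorem takeWord_padWord {m : ℕ+} (x : Word m) : takeWord m (padWord x) = x :=
  funext fun i => dif_pos i.2

theorem takeWord_surjective (m : ℕ+) : Function.Surjective (takeWord m) :=
  fun x => ⟨_, takeWord_padWord x⟩

/-- The blocks of the given lengths at the beginning of an assignment. -/
def ofBits : (ms : List ℕ+) → (ℕ → ℕ → Bool) → Inputs ms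
  | [], _ => ()
  | m :: ms, v => (takeWord m (v 0), ofBits ms fun j => v (j + 1))

theorem getBit_ofBits : ∀ {ms : List ℕ+} {v : ℕ → ℕ → Bool} {j i : ℕ}, InBlock ms j i →
    getBit (ofBits ms v) j i = v j i
  | [], _, _, _, h => absurd h (inBlock_nil _ _)
  | m :: ms, _, 0, i, h => dif_pos ((inBlock_cons_zero m ms i).1 h)
  | m :: ms, v, j + 1, i, h =>
    getBit_ofBits (v := fun j => v (j + 1)) ((inBlock_cons_succ m ms j i).1 h)

theorem eval_getBit_ofBits {ms : List ℕ+} {e : RawExpr} (he : e.InRange ms) (v : ℕ → ℕ → Bool) :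
    e.eval (getBit (ofBits ms v)) = e.eval v :=
  RawExpr.eval_congr (fun _ _ => getBit_ofBits) he

theorem holds_iff_bits {ms : List ℕ+} {k : ℕ} (h : ms.length ≤ k) (f : Inputs ms → Bool) :
    (SatHolds ms f ↔ SatBits k fun v => f (ofBits ms v) = true) ∧
    (CoSatHolds ms f ↔ CoSatBits k fun v => f (ofBits ms v) = true) := by
  induction ms generalizing k with
  | nil =>
    have := bits_const k (f () = true)
    exact ⟨by rw [SatHolds]; exact this.1.symm, by rw [CoSatHolds]; exact this.2.symm⟩
  | cons m ms ih =>
    obtain ⟨k, rfl⟩ := Nat.exists_eq_add_of_le' (Nat.one_le_of_lt h)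
    have h : ms.length ≤ k := by simpa using h
    simp only [SatHolds, CoSatHolds, SatBits, CoSatBits, (ih h _).1, (ih h _).2]
    exact ⟨(takeWord_surjective m).exists, (takeWord_surjective m).forall⟩

theorem coSatHolds_iff_coSatBits_eval {m : ℕ+} {ms : List ℕ+} {k : ℕ} (hk : ms.length ≤ k)
    {e : RawExpr} (he : e.InRange (m :: ms)) (x : Word m) :
    CoSatHolds ms (fun y => e.eval (getBit (ms := m :: ms) (x, y))) ↔
      CoSatBits k fun v => e.eval (consBlock (padWord x) v) = true := by
  have h : ∀ v, (x, ofBits ms v) = ofBits (m :: ms) (consBlock (padWord x) v) := fun v =>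
    Prod.ext (takeWord_padWord x).symm rfl
  simp only [(holds_iff_bits hk _).2, h, eval_getBit_ofBits he]

/-- A property of assignments which only depends on the first `N` bits of each block. -/
def DependsBelow (N : ℕ) (p : (ℕ → ℕ → Bool) → Prop) : Prop :=
  ∀ v w, (∀ j i, i < N → v j i = w j i) → (p v ↔ p w)

theorem DependsBelow.consBlock {N : ℕ} {p : (ℕ → ℕ → Bool) → Prop} (hp : DependsBelow N p)
    (X : ℕ → Bool) : DependsBelow N fun v => p (consBlock X v) := by
  refine fun v w h => hp _ _ fun j i hi => ?_
  rcases j with _ | j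
  exacts [rfl, h j i hi]

/-- The assignment obtained by dropping the first `N` bits of each block. -/
def dropBits (N : ℕ) (v : ℕ → ℕ → Bool) (j i : ℕ) : Bool := v j (i + N)

theorem dropBits_consBlock (N : ℕ) (X : ℕ → Bool) (v : ℕ → ℕ → Bool) :
    dropBits N (consBlock X v) = consBlock (fun i => X (i + N)) (dropBits N v) := by
  funext j i
  rcases j with _ | j <;> rfl

/-- The infinite string which consists of the first `N` bits of `X` and the bits of `Y`. -/
def mergeBits (N : ℕ) (X Y : ℕ → Bool) (i : ℕ) : Bool := if i < N then X i else Y (i - N)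

@[simp] theorem mergeBits_add (N : ℕ) (X Y : ℕ → Bool) (i : ℕ) :
    mergeBits N X Y (i + N) = Y i := by
  simp [mergeBits]

theorem DependsBelow.consBlock_mergeBits {N : ℕ} {p : (ℕ → ℕ → Bool) → Prop}
    (hp : DependsBelow N p) (X Y : ℕ → Bool) (v : ℕ → ℕ → Bool) :
    p (PromiseHierarchy.consBlock (mergeBits N X Y) v) ↔
      p (PromiseHierarchy.consBlock X v) := by
  refine hp _ _ fun j i hi => ?_
  rcases j with _ | j
  exacts [if_pos hi, rfl]

theorem bits_and (N k : ℕ) {p q : (ℕ → ℕ → Bool) → Prop} (hp : DependsBelow N p) :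
    (SatBits k (fun v => p v ∧ q (dropBits N v)) ↔ SatBits k p ∧ SatBits k q) ∧
    (CoSatBits k (fun v => p v ∧ q (dropBits N v)) ↔ CoSatBits k p ∧ CoSatBits k q) := by
  induction k generalizing p q with
  | zero => exact ⟨Iff.rfl, Iff.rfl⟩
  | succ k ih =>
    have key := fun X => ih (q := fun v => q (consBlock (fun i => X (i + N)) v)) (hp.consBlock X)
    simp only [SatBits, CoSatBits, dropBits_consBlock, (key _).1, (key _).2]
    constructor <;> constructor
    · rintro ⟨X, h₁, h₂⟩
      exact ⟨⟨X, h₁⟩, _, h₂⟩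
    · rintro ⟨⟨X, h₁⟩, Y, h₂⟩
      exact ⟨mergeBits N X Y, by simpa only [hp.consBlock_mergeBits],
        by simpa only [mergeBits_add]⟩
    · refine fun h => ⟨fun X => (h X).1, fun Y => ?_⟩
      simpa only [mergeBits_add] using (h (mergeBits N Y Y)).2
    · exact fun h X => ⟨h.1 X, h.2 _⟩

end BitGames

/-! ### Comparing strings -/

section Comparison

/-- If `r` expresses that the bits from `i + 1` on of block `1`, shifted by `N`, are greater than
those of block `0`, then this expression does so for the bits from `i` on. -/
def greaterStep (N i : ℕ) (r : RawExpr) : RawExpr :=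
  .or (.and (.var 1 (i + N)) (.neg (.var 0 i)))
    (.and (.or (.var 1 (i + N)) (.neg (.var 0 i))) r)

/-- The first `k` bits of block `1`, shifted by `N`, are greater than those of block `0`, or they
are equal and `r` holds. -/
def greaterOr (N : ℕ) : ℕ → RawExpr → RawExpr
  | 0, r => r
  | k + 1, r => greaterOr N k (greaterStep N k r)

/-- A contradiction. -/
def RawExpr.absurd : RawExpr := .and (.var 0 0) (.neg (.var 0 0))

theorem RawExpr.eval_absurd (v : ℕ → ℕ → Bool) : RawExpr.absurd.eval v = false :=
  Bool.and_not_self _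

theorem eval_greaterStep (N i : ℕ) (r : RawExpr) (v : ℕ → ℕ → Bool) :
    (greaterStep N i r).eval v = true ↔
      v 0 i < v 1 (i + N) ∨ v 0 i = v 1 (i + N) ∧ r.eval v = true := by
  simp only [greaterStep, RawExpr.eval]
  cases v 0 i <;> cases v 1 (i + N) <;> cases r.eval v <;> decide

theorem eval_greaterOr (N k : ℕ) (r : RawExpr) (v : ℕ → ℕ → Bool) :
    (greaterOr N k r).eval v = true ↔
      (∃ i < k, (∀ j < i, v 0 j = v 1 (j + N)) ∧ v 0 i < v 1 (i + N)) ∨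
        (∀ j < k, v 0 j = v 1 (j + N)) ∧ r.eval v = true := by
  induction k generalizing r with
  | zero => simp [greaterOr]
  | succ k ih =>
    rw [greaterOr, ih, eval_greaterStep, Nat.forall_lt_succ_right, Nat.exists_lt_succ_right,
      and_or_left, or_assoc, and_assoc]

theorem eval_greaterOr_absurd (N : ℕ) (m : ℕ+) (v : ℕ → ℕ → Bool) :
    (greaterOr N m .absurd).eval v = true ↔
      toLex (takeWord m (v 0)) < toLex (takeWord m (dropBits N v 1)) := by
  simp only [eval_greaterOr, RawExpr.eval_absurd, Bool.false_eq_true, and_false, or_false]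
  constructor
  · rintro ⟨i, hi, heq, hlt⟩
    exact ⟨⟨i, hi⟩, fun j hj => heq j hj, hlt⟩
  · rintro ⟨i, heq, hlt⟩
    exact ⟨i, i.2, fun j hj => heq ⟨j, hj.trans i.2⟩ hj, hlt⟩

theorem inRange_greaterOr {ms : List ℕ+} {N k : ℕ} {r : RawExpr} (h₀ : ∀ i < k, InBlock ms 0 i)
    (h₁ : ∀ i < k, InBlock ms 1 (i + N)) (hr : r.InRange ms) : (greaterOr N k r).InRange ms := by
  induction k generalizing r with
  | zero => exact hr
  | succ k ih =>
    rw [Nat.forall_lt_succ_right] at h₀ h₁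
    exact ih h₀.1 h₁.1 ⟨⟨h₁.2, h₀.2⟩, ⟨h₁.2, h₀.2⟩, hr⟩

/-- The string of `greaterStep`, where `N` and `i` are given in unary. -/
def greaterStepString (N i r : List Bool) : List Bool :=
  let x := false :: false :: varString [] i
  let y := varString [true] (i ++ N)
  [false, true, true, false, true, false] ++ (y ++ (x ++
    ([false, true, false, false, true, true] ++ (y ++ (x ++ r)))))

theorem greaterStepString_encode (N i : ℕ) (r : RawExpr) :
    greaterStepString (List.replicate N true) (List.replicate i true) r.encode =
      (greaterStep N i r).encode := by
  simp [greaterStepString, greaterStep, varString, RawExpr.encode, Token.encode,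
    List.replicate_add, -List.replicate_append_replicate]

/-- The string of `greaterOr`, where `N` and `k` are given in unary. -/
def greaterOrString (N k r : List Bool) : List Bool :=
  listRec (fun _ N i r => greaterStepString N i r) N k r

theorem greaterOrString_encode (N k : ℕ) (r : RawExpr) :
    greaterOrString (List.replicate N true) (List.replicate k true) r.encode =
      (greaterOr N k r).encode := by
  induction k generalizing r with
  | zero => rfl
  | succ k ih =>
    rw [greaterOr, ← ih, ← greaterStepString_encode, List.replicate_succ]
    rfl

theorem polyT_greaterOrString {α : Type} [Reg α] {N k r : α → List Bool} (hN : PolyT N)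
    (hk : PolyT k) (hr : PolyT r) : PolyT fun a => greaterOrString (N a) (k a) (r a) := by
  refine polyT_listRec (fun _ => ?_) (4 * Polynomial.X + 30) (fun _ N i r => ?_) hN hk hr
  · have hx : PolyT fun x : List Bool × List Bool × List Bool =>
        false :: false :: varString [] x.2.1 :=
      .cons _ (.cons _ (polyT_varString (.const_list _) (by fun_prop)))
    have hy : PolyT fun x : List Bool × List Bool × List Bool =>
        varString [true] (x.2.1 ++ x.1) := polyT_varString (.const_list _) (by fun_prop)
    exact .append (.const_list _) (.append hy (.append hx (.append (.const_list _)
      (.append hy (.append hx (by fun_prop))))))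
  · simp [greaterStepString, varString]
    omega

end Comparison

/-! ### The greatest element as a unique element -/

section GreatestUnique

variable {n : ℕ}

/-- The substitution which moves each variable to the next block and increases its index
by `N`. -/
def shiftBlocks (N j i : ℕ) : RawExpr := .var (j + 1) (i + N)

/-- The expression which describes that block `0` belongs to the set described by `e` and that
block `1`, shifted by `N`, is not a greater element of this set. -/
def greatestExpr (N m : ℕ) (e : RawExpr) : RawExpr :=
  .and e (.or (.neg (greaterOr N m .absurd)) (.neg (e.subst (shiftBlocks N))))

theorem eval_greatestExpr (N : ℕ) (m : ℕ+) (e : RawExpr) (X : ℕ → Bool) (v : ℕ → ℕ → Bool) :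
    (greatestExpr N m e).eval (consBlock X v) = true ↔ e.eval (consBlock X v) = true ∧
      (toLex (takeWord m X) < toLex (takeWord m (dropBits N v 0)) →
        e.eval (dropBits N v) = false) := by
  have h : (e.subst (shiftBlocks N)).eval (consBlock X v) = e.eval (dropBits N v) :=
    RawExpr.eval_subst ..
  have hlt := eval_greaterOr_absurd N m (consBlock X v)
  rw [show takeWord m (dropBits N (consBlock X v) 1) = takeWord m (dropBits N v 0) from rfl,
    show takeWord m (consBlock X v 0) = takeWord m X from rfl] at hlt
  rw [← hlt]
  simp only [greatestExpr, RawExpr.eval, h, Bool.and_eq_true]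
  cases (greaterOr N m .absurd).eval (consBlock X v) <;> simp

theorem coSatBits_not_greater (F : Instance n) (x : Word F.m) :
    (CoSatBits n fun v => toLex x < toLex (takeWord F.m (v 0)) → F.expr.toRaw.eval v = false) ↔
      ∀ y ∈ F.witnesses, ¬ toLex x < toLex y := by
  classical
  have h := (holds_iff_bits (ms := F.m :: F.ms) F.length_eq.le fun z =>
    !decide (toLex x < toLex z.1) || !F.expr.toRaw.eval (getBit z)).2
  have hb : ∀ v, (!decide (toLex x < toLex (ofBits (F.m :: F.ms) v).1) ||
      !F.expr.toRaw.eval (getBit (ofBits (F.m :: F.ms) v))) = true ↔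
      (toLex x < toLex (takeWord F.m (v 0)) → F.expr.toRaw.eval v = false) := fun v => by
    rw [eval_getBit_ofBits F.expr.inRange_toRaw, Bool.or_eq_true, Bool.not_eq_true',
      Bool.not_eq_true', decide_eq_false_iff_not, imp_iff_not_or]
    rfl
  simp only [hb] at h
  rw [← h, CoSatHolds]
  refine forall_congr' fun y => ?_
  refine (satHolds_or (b := !decide (toLex x < toLex y))
    (f := fun w => !F.expr.toRaw.eval (getBit (ms := F.m :: F.ms) (y, w)))).trans ?_
  rw [satHolds_not, ← F.mem_witnesses, Bool.not_eq_true', decide_eq_false_iff_not]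
  tauto

theorem InBlock.lt_length : ∀ {ms : List ℕ+} {j i : ℕ}, InBlock ms j i →
    j < ms.length ∧ i < (encodeSizes ms).length
  | [], _, _, h => absurd h (inBlock_nil _ _)
  | m :: ms, 0, i, h => by
    have hi : i < (m : ℕ) := by simpa using h
    simp [encodeSizes]
    omega
  | m :: ms, j + 1, i, h => by
    have := InBlock.lt_length ((inBlock_cons_succ m ms j i).1 h)
    simp [encodeSizes]
    omega

theorem Instance.lt_of_inBlock (F : Instance n) {j i : ℕ} (h : InBlock (F.m :: F.ms) j i) :
    j < n ∧ i < F.encode.length := by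
  refine ⟨h.lt_length.1.trans_eq F.length_eq, h.lt_length.2.trans_le ?_⟩
  exact (List.prefix_append (encodeSizes (F.m :: F.ms)) F.expr.encode).length_le

theorem inBlock_replicate {k : ℕ} {B : ℕ+} {j i : ℕ} :
    InBlock (List.replicate k B) j i ↔ j < k ∧ i < (B : ℕ) := by
  by_cases h : j < k <;> simp [InBlock, h]

/-- Twice the length of the encoding of an instance: the first half of a block of this length has
room for a block of the instance, and so has the second half. -/
def Instance.doubleLength (F : Instance n) : ℕ+ :=
  ⟨F.encode.length + F.encode.length, Nat.add_pos_left (List.length_pos_of_ne_nil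
    F.encode_ne_nil) _⟩

theorem Instance.inBlock_doubleLength (F : Instance n) {j i : ℕ} (hj : j < n)
    (hi : i < F.encode.length + F.encode.length) :
    InBlock (F.m :: List.replicate n F.doubleLength) (j + 1) i := by
  rw [inBlock_cons_succ, inBlock_replicate]
  exact ⟨hj, hi⟩

theorem Instance.inRange_greatest (F : Instance n) :
    (greatestExpr F.encode.length F.m F.expr.toRaw).InRange
      (F.m :: List.replicate n F.doubleLength) := by
  have hlt := fun {j i} (h : InBlock (F.m :: F.ms) j i) => F.lt_of_inBlock h
  have h₀ : ∀ i < (F.m : ℕ), InBlock (F.m :: F.ms) 0 i := fun i hi => by simpa using hi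
  refine ⟨F.expr.inRange_toRaw.mono fun j i h => ?_, inRange_greaterOr (fun i hi => ?_)
    (fun i hi => ?_) ?_, F.expr.inRange_toRaw.subst fun j i h => ?_⟩
  · rcases j with _ | j
    · simpa using h
    · exact F.inBlock_doubleLength (Nat.lt_of_succ_lt (hlt h).1) (Nat.lt_add_right _ (hlt h).2)
  · simpa using hi
  · exact F.inBlock_doubleLength (hlt (h₀ i hi)).1 (Nat.add_lt_add_right (hlt (h₀ i hi)).2 _)
  · simp [RawExpr.absurd, RawExpr.InRange]
  · exact F.inBlock_doubleLength (hlt h).1 (Nat.add_lt_add_right (hlt h).2 _)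

/-- The instance of the next level whose witnesses are the greatest witnesses of an instance. -/
noncomputable abbrev Instance.greatest (F : Instance n) : Instance (n + 1) :=
  .ofRaw F.m (List.replicate n F.doubleLength) (by simp) F.inRange_greatest

theorem Instance.mem_witnesses_greatest (F : Instance n) (x : Word F.m) :
    x ∈ F.greatest.witnesses ↔ x ∈ F.witnesses ∧ ∀ y ∈ F.witnesses, ¬ toLex x < toLex y := by
  have hdep : DependsBelow F.encode.length fun v =>
      F.expr.toRaw.eval (consBlock (padWord x) v) = true := fun v w h => by
    refine iff_of_eq (congrArg (· = true) (RawExpr.eval_congr (fun j i hi => ?_)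
      F.expr.inRange_toRaw))
    rcases j with _ | j
    exacts [rfl, h j i (F.lt_of_inBlock hi).2]
  refine (mem_witnesses_ofRaw _ F.inRange_greatest).trans ?_
  rw [coSatHolds_iff_coSatBits_eval (k := n) (by simp) F.inRange_greatest]
  simp only [eval_greatestExpr, takeWord_padWord]
  rw [(bits_and _ n (q := fun v => toLex x < toLex (takeWord F.m (v 0)) →
    F.expr.toRaw.eval v = false) hdep).2, coSatBits_not_greater, mem_witnesses,
    coSatHolds_iff_coSatBits_eval (k := n) (Nat.le_of_succ_le F.length_eq.le) F.expr.inRange_toRaw]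

/-- The string of `k` block lengths in unary, all equal to `2 N`, where `N` is given in unary. -/
def blocksString : ℕ → List Bool → List Bool
  | 0, _ => []
  | k + 1, N => N ++ (N ++ false :: blocksString k N)

theorem blocksString_replicate (k : ℕ) {N : ℕ} {B : ℕ+} (hB : (B : ℕ) = N + N) :
    blocksString k (List.replicate N true) = encodeSizes (List.replicate k B) := by
  induction k with
  | zero => rfl
  | succ k ih =>
    simp [blocksString, ih, List.replicate_succ, encodeSizes, hB, List.replicate_add,
      -List.replicate_append_replicate]

theorem polyT_blocksString {α : Type} [Reg α] {N : α → List Bool} (hN : PolyT N) (k : ℕ) :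
    PolyT fun a => blocksString k (N a) := by
  induction k with
  | zero => exact .nil
  | succ k ih => exact .append hN (.append hN (.cons _ ih))

/-- The string of `greatestExpr`, where `N` and `m` are given in unary. -/
def greatestExprString (N m e : List Bool) : List Bool :=
  [false, true, false] ++ (e ++ ([false, true, true, false, false] ++
    (greaterOrString N m RawExpr.absurd.encode ++ ([false, false] ++
      (substActions fun N j i => varString (true :: j) (i ++ N)).run N e []))))

theorem greatestExprString_encode (N m : ℕ) (e : RawExpr) :
    greatestExprString (List.replicate N true) (List.replicate m true) e.encode =
      (greatestExpr N m e).encode := by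
  rw [greatestExprString, greaterOrString_encode,
    run_substActions_encode (G := shiftBlocks N) fun j i => ?_]
  · simp [greatestExpr, RawExpr.encode]
  · rw [← List.replicate_succ, List.replicate_append_replicate, varString_replicate, shiftBlocks]

theorem polyT_greatestExprString {α : Type} [Reg α] {N m e : α → List Bool} (hN : PolyT N)
    (hm : PolyT m) (he : PolyT e) : PolyT fun a => greatestExprString (N a) (m a) (e a) :=
  .append (.const_list _) (.append he (.append (.const_list _) (.append
    (polyT_greaterOrString hN hm (.const_list _)) (.append (.const_list _)
      (polyT_substActions (polyT_varString (by fun_prop) (by fun_prop)) hN he)))))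

theorem polyTransform_greatest : PolyTransform (Instance.greatest (n := n)) := by
  refine ⟨fun l => takeOnes l ++ false :: (blocksString n (ones l) ++
    greatestExprString (ones l) (takeOnes l) (body n l)),
    .append (by fun_prop) (.cons _ (.append (polyT_blocksString (by fun_prop) n)
      (polyT_greatestExprString (by fun_prop) (by fun_prop) (by fun_prop)))), fun F => ?_⟩
  have htake : takeOnes F.encode = List.replicate (F.m : ℕ) true := by
    simp [Instance.encode, encodeSizes]
  refine (Instance.encode_ofRaw _ F.inRange_greatest).trans ?_
  simp only [ones, htake, F.body_encode_raw, greatestExprString_encode,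
    blocksString_replicate n (B := F.doubleLength) rfl]
  simp [encodeSizes]

theorem MaxVAL_reduces_UVAL : StrongReduces (MaxVAL n) (UVAL (n + 1)) := by
  refine .of_instances polyTransform_greatest fun F b hb h => ?_
  obtain ⟨-, w, ⟨hw, hmax⟩, -⟩ := firstBitMax_nonempty h.nonempty
  have hunique : ∃! x, x ∈ F.greatest.witnesses := by
    refine ⟨ofLex w, (F.mem_witnesses_greatest _).2 ⟨hw, fun y hy => not_lt_of_ge (hmax hy)⟩,
      fun y hy => ?_⟩
    obtain ⟨hy, hy'⟩ := (F.mem_witnesses_greatest y).1 hy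
    exact congrArg ofLex (le_antisymm (hmax hy) (not_lt.1 (hy' _ hw)))
  obtain ⟨x, hx, rfl⟩ := hb hunique
  obtain ⟨hx, hx'⟩ := (F.mem_witnesses_greatest x).1 hx
  exact ⟨toLex x, ⟨hx, fun y hy => not_lt.1 (hx' _ hy)⟩, rfl⟩

end GreatestUnique

end PromiseHierarchy

open PromiseHierarchy

theorem theorem3 (n : ℕ) (hn : 1 ≤ n) :
    PromiseHierarchy.strongClosure (PromiseHierarchy.SAT n).dual =
        PromiseHierarchy.strongClosure (PromiseHierarchy.coSAT n) ∧
      PromiseHierarchy.strongClosure (PromiseHierarchy.MaxVAL n).dual =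
        PromiseHierarchy.strongClosure (PromiseHierarchy.MinVAL n) ∧
      PromiseHierarchy.strongClosure (PromiseHierarchy.VAL n).dual =
        PromiseHierarchy.strongClosure (PromiseHierarchy.VAL n) ∧
      PromiseHierarchy.strongClosure (PromiseHierarchy.USAT n).dual =
        PromiseHierarchy.strongClosure (PromiseHierarchy.coUSAT n) ∧
      PromiseHierarchy.strongClosure (PromiseHierarchy.UVAL n).dual =
        PromiseHierarchy.strongClosure (PromiseHierarchy.UVAL n) ∧
      PromiseHierarchy.strongClosure (PromiseHierarchy.SAT n) =
        PromiseHierarchy.strongClosure (PromiseHierarchy.MaxVAL n) ∧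
      (PromiseHierarchy.StrongReduces (PromiseHierarchy.UVAL n) (PromiseHierarchy.VAL n) ∧
        PromiseHierarchy.StrongReduces (PromiseHierarchy.VAL n) (PromiseHierarchy.MaxVAL n) ∧
        PromiseHierarchy.StrongReduces (PromiseHierarchy.MaxVAL n)
          (PromiseHierarchy.UVAL (n + 1))) ∧
      (PromiseHierarchy.StrongReduces (PromiseHierarchy.UVAL n) (PromiseHierarchy.USAT n) ∧
        PromiseHierarchy.StrongReduces (PromiseHierarchy.USAT n) (PromiseHierarchy.SAT n)) := by
  exact ⟨strongClosure_dual_eq (dual_SAT_reduces hn) (dual_coSAT_reduces hn),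
    strongClosure_dual_eq dual_MaxVAL_reduces dual_MinVAL_reduces,
    strongClosure_dual_eq dual_VAL_reduces dual_VAL_reduces,
    strongClosure_dual_eq dual_USAT_reduces dual_coUSAT_reduces,
    strongClosure_dual_eq dual_UVAL_reduces dual_UVAL_reduces,
    strongClosure_eq (SAT_reduces_MaxVAL hn) MaxVAL_reduces_SAT,
    ⟨UVAL_reduces_VAL, VAL_reduces_MaxVAL, MaxVAL_reduces_UVAL⟩,
    UVAL_reduces_USAT, USAT_reduces_SAT⟩
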